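/- For a set $E$ in a metric space let $N(E,\delta)$ be the least number of $\delta$-balls centred in $E$ that cover $E$, and let $\dim_M E=\limsup_{\delta\to0^+}\log N(E,\delta)/\log(1/\delta)$ be its upper Minkowski dimension. For $K\subset\mathbb{R}^2$ and $\delta>0$ let $K_\delta=K+B(0,\delta)$, write $|\cdot|$ for Lebesgue measure on $\mathbb{R}^2$ (and for the Euclidean norm of a vector), and let $$D(K)=\{(k_1,k_2)\in K\times K:\ |k_2-k_1|=1\}\subset\mathbb{R}^2\times\mathbb{R}^2 .$$ For $0<\alpha\le 2$ let $g_2(\alpha)$ be the supremum of $\dim_M D(K)$ over all compact sets $K\subset\mathbb{R}^2$ of Hausdorff dimension $\alpha$ for which there is a constant $C=C(K)$ such that $$|K_\delta\cap B(x,r)|\le C\,(r/\delta)^{\alpha}\,\delta^{2}\qquad\text{for all } x\in\mathbb{R}^2 \text{ and all } r\ge\delta>0 .$$ Then for $0<\alpha\le1$ $$\frac{3\alpha}{2}\le g_2(\alpha)\le\min\Big\{\frac{5\alpha}{3},\ \frac{\alpha(2+\alpha)}{1+\alpha}\Big\};$$ for $1\le\alpha\le 3/2$ we have $g_2(\alpha)=\alpha+\tfrac12$;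 and for $3/2\le\alpha\le2$ we have $g_2(\alpha)=2\alpha-1$. -/

import Mathlib

open Filter Topology MeasureTheory
open scoped NNReal ENNReal

noncomputable section

/-- Upper Minkowski (box-counting) dimension
`limsup_{δ → 0+} log N(E, δ) / log (1/δ)`, where `N(E, δ)` is the least number of closed
`δ`-balls centred in `E` that cover `E`. The empty set has dimension `⊥ = -∞`. -/
def upperMinkowskiDim {X : Type*} [PseudoEMetricSpace X] (E : Set X) : EReal :=
  limsup (fun δ : ℝ≥0 =>
    ENNReal.log (Metric.coveringNumber δ E : ℝ≥0∞) / ((-Real.log (δ : ℝ) : ℝ) : EReal))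
    (𝓝[>] 0)

/-- The unit distance set `D(K) = {(k₁, k₂) ∈ K² : |k₂ - k₁| = 1}`. The metric on the product is
the maximum metric, which is bi-Lipschitz equivalent to the Euclidean one. -/
def unitDistancePairs {d : ℕ} (K : Set (EuclideanSpace ℝ (Fin d))) :
    Set (EuclideanSpace ℝ (Fin d) × EuclideanSpace ℝ (Fin d)) :=
  {p | p.1 ∈ K ∧ p.2 ∈ K ∧ ‖p.2 - p.1‖ = 1}

/-- The open `δ`-neighbourhoods `K_δ` of `K` are `δ`-discrete `α`-sets, uniformly in `δ`:
`|K_δ ∩ B(x, r)| ≤ C (r / δ)^α δ^d` for all `x` and all `r ≥ δ > 0`. -/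
def IsDiscreteAlphaSet {d : ℕ} (α : ℝ) (K : Set (EuclideanSpace ℝ (Fin d))) : Prop :=
  ∃ C : ℝ, ∀ δ : ℝ, 0 < δ → ∀ x : EuclideanSpace ℝ (Fin d), ∀ r : ℝ, δ ≤ r →
    volume (Metric.thickening δ K ∩ Metric.ball x r) ≤
      ENNReal.ofReal (C * (r / δ) ^ α * δ ^ d)

/-- `g_d(α)`: the supremum of the upper Minkowski dimensions of the unit distance sets of the
compact `K ⊆ ℝ^d` of Hausdorff dimension `α` whose neighbourhoods are `δ`-discrete `α`-sets. -/
def unitDistanceDim (d : ℕ) (α : ℝ) : EReal :=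
  sSup {s : EReal | ∃ K : Set (EuclideanSpace ℝ (Fin d)),
    IsCompact K ∧ dimH K = ENNReal.ofReal α ∧ IsDiscreteAlphaSet α K ∧
      s = upperMinkowskiDim (unitDistancePairs K)}

end

/-!
Upper bounds come from counting the pairs at nearly unit distance in a `δ`-separated set `P` that
satisfies the growth condition. Two annuli of radius `1` and width `δ` about `q` and `q'` meet in
two pieces of diameter `≲ δ / |q - q'|`, so the growth condition bounds the number of common
nearly unit neighbours of `q` and `q'`, and the Cauchy-Schwarz inequality gives the exponent
`3 α / 2`. On the other hand, the count is dominated by the integral of `|∑ exp (i ⟨p, ξ⟩)|²`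
against the Fourier transform of arc length on the circle, cut off at `|ξ| ≈ 1 / δ`. By van der
Corput's lemma that transform decays like `|ξ| ^ (-1 / 2)`, so it is dominated by a weighted sum
of Gaussians at dyadic scales. Returning to the physical side, each Gaussian counts the pairs of
`P` within its own scale, which the growth condition controls, and the sum has the exponent
`max (α + 1 / 2) (2 α - 1)`.

For the lower bound `2 α - 1`, the product of an interval with a Cantor set of restricted digits
has a segment of unit pairs above each pair of ordinates. For `3 α / 2` and `α + 1 / 2`, place
near `(0, 0)` and `(1, 0)` finite blocks of points whose fine and coarse digits are restricted to
different degrees, in opposite ways in the two coordinates. A unit vector with a small ordinate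
deviates from `(1, 0)` only quadratically, so a slight horizontal perturbation puts many pairs at
distance exactly `1` without destroying the dimension bounds.
-/

/-- A subset of a metric space is `α`-homogeneous if its part in a ball of radius `r` is covered by
`≲ (r / ε) ^ α` balls of radius `ε`, for all `0 < ε ≤ r`. This scale-free form of regularity makes
the closure a `δ`-discrete `α`-set and bounds its Hausdorff dimension by `α`. -/
def IsHomogeneousSet {X : Type*} [PseudoMetricSpace X] (α : ℝ) (K : Set X) : Prop :=
  ∃ M : ℝ, ∀ (x : X) (ε r : ℝ), 0 < ε → ε ≤ r → ∃ T : Finset X,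
    (T.card : ℝ) ≤ M * (r / ε) ^ α ∧ K ∩ Metric.ball x r ⊆ ⋃ t ∈ T, Metric.closedBall t ε

namespace IsHomogeneousSet

theorem union {X : Type*} [PseudoMetricSpace X] {α : ℝ} {K₁ K₂ : Set X}
    (h₁ : IsHomogeneousSet α K₁) (h₂ : IsHomogeneousSet α K₂) : IsHomogeneousSet α (K₁ ∪ K₂) := by
  classical
  obtain ⟨M₁, h₁⟩ := h₁
  obtain ⟨M₂, h₂⟩ := h₂
  refine ⟨M₁ + M₂, fun x ε r hε hr => ?_⟩
  obtain ⟨T₁, hc₁, hT₁⟩ := h₁ x ε r hε hr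
  obtain ⟨T₂, hc₂, hT₂⟩ := h₂ x ε r hε hr
  refine ⟨T₁ ∪ T₂, ?_, ?_⟩
  · calc ((T₁ ∪ T₂).card : ℝ) ≤ T₁.card + T₂.card := mod_cast Finset.card_union_le _ _
      _ ≤ (M₁ + M₂) * (r / ε) ^ α := by linarith
  · rw [Set.union_inter_distrib_right, Finset.set_biUnion_union]
    exact Set.union_subset_union hT₁ hT₂

theorem exists_thickening_closure_inter_ball_subset {X : Type*} [PseudoMetricSpace X] {α : ℝ}
    {K : Set X} (h : IsHomogeneousSet α K) : ∃ M : ℝ, ∀ (x : X) (δ r : ℝ), 0 < δ → δ ≤ r →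
      ∃ T : Finset X, (T.card : ℝ) ≤ M * (r / δ) ^ α ∧
        Metric.thickening δ (closure K) ∩ Metric.ball x r ⊆ ⋃ t ∈ T, Metric.ball t (2 * δ) := by
  obtain ⟨M, h⟩ := h
  refine ⟨M * 2 ^ α, fun x δ r hδ hr => ?_⟩
  have hr0 : 0 < r := hδ.trans_le hr
  obtain ⟨T, hc, hT⟩ := h x δ (2 * r) hδ (by linarith)
  refine ⟨T, hc.trans_eq ?_, ?_⟩
  · rw [mul_div_assoc, Real.mul_rpow zero_le_two (by positivity), mul_assoc]
  · rintro p ⟨hp, hpx⟩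
    rw [Metric.thickening_closure, Metric.mem_thickening_iff] at hp
    obtain ⟨k, hk, hpk⟩ := hp
    have hkx : k ∈ Metric.ball x (2 * r) := by
      rw [Metric.mem_ball] at hpx ⊢
      linarith [dist_triangle_left k x p]
    obtain ⟨t, ht, hkt⟩ := Set.mem_iUnion₂.1 (hT ⟨hk, hkx⟩)
    refine Set.mem_iUnion₂.2 ⟨t, ht, ?_⟩
    rw [Metric.mem_closedBall] at hkt
    rw [Metric.mem_ball]
    linarith [dist_triangle p k t]

theorem isDiscreteAlphaSet_closure {d : ℕ} [NeZero d] {α : ℝ} {K : Set (EuclideanSpace ℝ (Fin d))}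
    (h : IsHomogeneousSet α K) : IsDiscreteAlphaSet α (closure K) := by
  obtain ⟨M, h⟩ := h.exists_thickening_closure_inter_ball_subset
  set V : ℝ := volume.real (Metric.ball (0 : EuclideanSpace ℝ (Fin d)) 1) with hV
  have hball (t : EuclideanSpace ℝ (Fin d)) {δ : ℝ} (hδ : 0 < δ) :
      volume (Metric.ball t (2 * δ)) = ENNReal.ofReal ((2 * δ) ^ d * V) := by
    rw [Measure.addHaar_ball _ _ (by positivity), finrank_euclideanSpace_fin,
      ENNReal.ofReal_mul (by positivity), hV, ofReal_measureReal measure_ball_lt_top.ne]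
  refine ⟨M * 2 ^ d * V, fun δ hδ x r hr => ?_⟩
  obtain ⟨T, hc, hT⟩ := h x δ r hδ hr
  calc volume (Metric.thickening δ (closure K) ∩ Metric.ball x r)
      ≤ volume (⋃ t ∈ T, Metric.ball t (2 * δ)) := measure_mono hT
    _ ≤ ∑ t ∈ T, volume (Metric.ball t (2 * δ)) := measure_biUnion_finset_le _ _
    _ = ENNReal.ofReal (T.card * ((2 * δ) ^ d * V)) := by
        rw [Finset.sum_congr rfl fun t _ => hball t hδ, Finset.sum_const, nsmul_eq_mul,
          ENNReal.ofReal_mul (Nat.cast_nonneg _), ENNReal.ofReal_natCast]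
    _ ≤ ENNReal.ofReal (M * (r / δ) ^ α * ((2 * δ) ^ d * V)) :=
        ENNReal.ofReal_le_ofReal (by gcongr)
    _ = ENNReal.ofReal (M * 2 ^ d * V * (r / δ) ^ α * δ ^ d) := by
        rw [mul_pow]
        ring_nf

end IsHomogeneousSet

theorem ediam_closedBall_le_ofReal {X : Type*} [PseudoMetricSpace X] (x : X) (ε : ℝ) :
    Metric.ediam (Metric.closedBall x ε) ≤ ENNReal.ofReal (2 * ε) :=
  Metric.ediam_le_of_forall_dist_le fun p hp q hq => by
    rw [Metric.mem_closedBall] at hp hq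
    linarith [dist_triangle_right p q x]

namespace IsHomogeneousSet

theorem exists_hausdorffMeasure_closure_le {X : Type*} [MetricSpace X] [MeasurableSpace X]
    [BorelSpace X] {α : ℝ} (hα : 0 ≤ α) {K : Set X} (h : IsHomogeneousSet α K)
    (hK : Bornology.IsBounded K) :
    ∃ V : ℝ, Measure.hausdorffMeasure α (closure K) ≤ ENNReal.ofReal V := by
  obtain ⟨M, h⟩ := h
  rcases K.eq_empty_or_nonempty with rfl | ⟨x₀, -⟩
  · exact ⟨0, by simp⟩
  obtain ⟨R, hR1, hR⟩ := hK.subset_ball_lt 1 x₀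
  let ε : ℕ → ℝ := fun n => 1 / ((n : ℝ) + 1)
  have hε (n) : 0 < ε n := by positivity
  have hε1 (n) : ε n ≤ R := (Nat.one_div_le_one_div n.zero_le |>.trans (by simp)).trans hR1.le
  have hε0 : Tendsto (fun n => ENNReal.ofReal (2 * ε n)) atTop (𝓝 0) := by
    simpa [ε] using ENNReal.tendsto_ofReal (tendsto_one_div_add_atTop_nhds_zero_nat.const_mul 2)
  choose T hc hT using fun n : ℕ => h x₀ (ε n) R (hε n) (hε1 n)
  refine ⟨M * (2 * R) ^ α, (Measure.hausdorffMeasure_le_liminf_sum (ι := fun n => T n) α _ _ hε0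
    (fun n i => Metric.closedBall i.1 (ε n))
    (.of_forall fun n i => ediam_closedBall_le_ofReal _ _) (.of_forall fun n => ?_)).trans
    (liminf_le_of_frequently_le' (.of_forall fun n => ?_))⟩
  · refine closure_minimal (fun p hp => ?_) (isClosed_iUnion_of_finite fun i =>
      Metric.isClosed_closedBall)
    simpa using hT n ⟨hp, hR hp⟩
  · calc ∑ i : T n, Metric.ediam (Metric.closedBall i.1 (ε n)) ^ α
        ≤ ∑ i : T n, ENNReal.ofReal ((2 * ε n) ^ α) := by
          refine Finset.sum_le_sum fun i _ => ?_
          rw [← ENNReal.ofReal_rpow_of_nonneg (by positivity) hα]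
          exact ENNReal.rpow_le_rpow (ediam_closedBall_le_ofReal _ _) hα
      _ = ENNReal.ofReal ((T n).card * (2 * ε n) ^ α) := by
          rw [ENNReal.ofReal_mul (by positivity), ENNReal.ofReal_natCast]
          simp
      _ ≤ ENNReal.ofReal (M * (R / ε n) ^ α * (2 * ε n) ^ α) :=
          ENNReal.ofReal_le_ofReal (by gcongr; exact hc n)
      _ = ENNReal.ofReal (M * (2 * R) ^ α) := by
          rw [mul_assoc, ← Real.mul_rpow (div_nonneg (by linarith) (hε n).le) (by positivity)]
          congr 3
          field_simp [(hε n).ne']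

theorem dimH_closure_le {X : Type*} [MetricSpace X] {α : ℝ} (hα : 0 ≤ α) {K : Set X}
    (h : IsHomogeneousSet α K) (hK : Bornology.IsBounded K) :
    dimH (closure K) ≤ ENNReal.ofReal α := by
  borelize X
  obtain ⟨V, hV⟩ := h.exists_hausdorffMeasure_closure_le hα hK
  lift α to ℝ≥0 using hα
  rw [ENNReal.ofReal_coe_nnreal]
  exact dimH_le_of_hausdorffMeasure_ne_top (ne_top_of_le_ne_top ENNReal.ofReal_ne_top hV)

end IsHomogeneousSet

section Labels

variable {I T T' X : Type*}

theorem encard_image_le_card_of_code {κ : Type*} {f : I → T} {A : Set I} (S : Finset κ)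
    (code : I → κ) (hS : ∀ i ∈ A, code i ∈ S)
    (h : ∀ i ∈ A, ∀ i' ∈ A, code i = code i' → f i = f i') : (f '' A).encard ≤ S.card := by
  rcases isEmpty_or_nonempty I with _ | _
  · simp [Set.eq_empty_of_isEmpty]
  obtain ⟨g, hg⟩ : ∃ g : κ → T, ∀ i ∈ A, g (code i) = f i := by
    choose! rep hrepA hrep using fun (w : κ) (hw : w ∈ code '' A) => hw
    exact ⟨f ∘ rep, fun i hi =>
      h _ (hrepA _ ⟨i, hi, rfl⟩) _ hi (hrep _ ⟨i, hi, rfl⟩)⟩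
  calc (f '' A).encard ≤ (g '' S).encard :=
        Set.encard_le_encard (Set.image_subset_iff.2 fun i hi => ⟨code i, hS i hi, hg i hi⟩)
    _ ≤ (S : Set κ).encard := Set.encard_image_le _ _
    _ = S.card := Set.encard_coe_eq_coe_finsetCard _

theorem encard_image_le_mul_of_fiber {f : I → T} {g : I → T'} {A : Set I} {M N : ℕ}
    (hf : (f '' A).encard ≤ M) (hg : ∀ t, (g '' (f ⁻¹' {t})).encard ≤ N) :
    (g '' A).encard ≤ (M * N : ℕ) := by
  classical
  obtain ⟨hfin, hcard⟩ := Set.encard_le_coe_iff_finite_ncard_le.1 hf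
  choose hgfin hgcard using fun t => Set.encard_le_coe_iff_finite_ncard_le.1 (hg t)
  have hsub : g '' A ⊆ (hfin.toFinset.biUnion fun t => (hgfin t).toFinset : Finset T') := by
    rintro _ ⟨i, hi, rfl⟩
    simp only [Finset.coe_biUnion, Set.Finite.coe_toFinset, Set.mem_iUnion₂]
    exact ⟨f i, ⟨i, hi, rfl⟩, ⟨i, rfl, rfl⟩⟩
  refine (Set.encard_le_encard hsub).trans ?_
  rw [Set.encard_coe_eq_coe_finsetCard, Nat.cast_le]
  refine (Finset.card_biUnion_le_card_mul _ _ N fun t _ => ?_).trans (Nat.mul_le_mul_right N ?_)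
  · rw [← Set.ncard_eq_toFinset_card _ (hgfin t)]
    exact hgcard t
  · rwa [← Set.ncard_eq_toFinset_card _ hfin]

theorem encard_image_label_add_le {label : ℕ → I → T} {A : Set I} {j M N : ℕ}
    (hA : (label j '' A).encard ≤ M)
    (hchild : ∀ k t, (label (k + 1) '' (label k ⁻¹' {t})).encard ≤ N) (m : ℕ) :
    (label (j + m) '' A).encard ≤ (M * N ^ m : ℕ) := by
  induction m with
  | zero => simpa using hA
  | succ m ih =>
    rw [pow_succ, ← mul_assoc]
    exact encard_image_le_mul_of_fiber ih (hchild _)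

theorem exists_finset_cover_of_encard_image_le [PseudoMetricSpace X] {p : I → X} {f : I → T}
    {A : Set I} {M : ℕ} {ε : ℝ} (hf : (f '' A).encard ≤ M)
    (hdist : ∀ i i', f i = f i' → dist (p i) (p i') ≤ ε) :
    ∃ F : Finset X, F.card ≤ M ∧ p '' A ⊆ ⋃ t ∈ F, Metric.closedBall t ε := by
  classical
  rcases isEmpty_or_nonempty I with _ | _
  · exact ⟨∅, by simp, by simp [Set.eq_empty_of_isEmpty]⟩
  obtain ⟨hfin, hcard⟩ := Set.encard_le_coe_iff_finite_ncard_le.1 hf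
  choose! rep _ hrep using fun (t : T) (ht : t ∈ f '' A) => ht
  refine ⟨hfin.toFinset.image (p ∘ rep), Finset.card_image_le.trans ?_, ?_⟩
  · rwa [← Set.ncard_eq_toFinset_card _ hfin]
  · rintro _ ⟨i, hi, rfl⟩
    have hfi : f i ∈ f '' A := ⟨i, hi, rfl⟩
    exact Set.mem_iUnion₂.2 ⟨p (rep (f i)), Finset.mem_image.2 ⟨f i, by simpa using hfi, rfl⟩,
      hdist _ _ (hrep _ hfi).symm⟩

theorem pow_succ_le_mul_div_rpow {N α l c r ε : ℝ} {j m : ℕ} (hα : 0 ≤ α) (hl : 0 < l)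
    (hc : 0 < c) (hr : 0 < r) (hε : 0 < ε) (hN0 : 0 ≤ N) (hN : N ≤ l⁻¹ ^ α) (hj : l ^ (j + 1) ≤ r)
    (hm : ε ≤ c * l ^ (j + m)) : N ^ (m + 1) ≤ (c * l⁻¹ ^ 2) ^ α * (r / ε) ^ α := by
  have hscale : ε * l ≤ c * r * l ^ m := by
    calc ε * l ≤ c * l ^ (j + m) * l := by gcongr
      _ = c * l ^ (j + 1) * l ^ m := by ring
      _ ≤ c * r * l ^ m := by gcongr
  have hbase : l⁻¹ ^ (m + 1) ≤ c * l⁻¹ ^ 2 * (r / ε) := by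
    have hquot : c * l⁻¹ ^ 2 * (r / ε) * l ^ (m + 1) = (c * r * l ^ m) / (ε * l) := by
      field_simp
      ring
    rw [inv_pow, inv_le_iff_one_le_mul₀ (by positivity), hquot, one_le_div (by positivity)]
    exact hscale
  calc N ^ (m + 1) ≤ (l⁻¹ ^ α) ^ (m + 1) := by gcongr
    _ = (l⁻¹ ^ (m + 1)) ^ α := by
        rw [← Real.rpow_natCast, ← Real.rpow_natCast, ← Real.rpow_mul (by positivity),
          ← Real.rpow_mul (by positivity), mul_comm]
    _ ≤ (c * l⁻¹ ^ 2 * (r / ε)) ^ α := by gcongr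
    _ = (c * l⁻¹ ^ 2) ^ α * (r / ε) ^ α := Real.mul_rpow (by positivity) (by positivity)

theorem exists_scale_pow_le {N α l c r ε : ℝ} (j : ℕ) (hα : 0 ≤ α) (hl : 0 < l) (hl1 : l < 1)
    (hc : 0 < c) (hε : 0 < ε) (hr : ε ≤ r) (hN0 : 0 ≤ N) (hN : N ≤ l⁻¹ ^ α) (hj : l ^ (j + 1) ≤ r) :
    ∃ m, c * l ^ (j + m) ≤ ε ∧ N ^ m ≤ (1 + (c * l⁻¹ ^ 2) ^ α) * (r / ε) ^ α := by
  classical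
  have hex : ∃ m : ℕ, c * l ^ (j + m) ≤ ε := by
    obtain ⟨m, hm⟩ := exists_pow_lt_of_lt_one (div_pos hε hc) hl1
    rw [lt_div_iff₀' hc] at hm
    exact ⟨m, (mul_le_mul_of_nonneg_left
      (pow_le_pow_of_le_one hl.le hl1.le (Nat.le_add_left m j)) hc.le).trans hm.le⟩
  have hone : 1 ≤ (r / ε) ^ α := Real.one_le_rpow (by rwa [one_le_div hε]) hα
  have hconst : 0 ≤ (c * l⁻¹ ^ 2) ^ α := by positivity
  refine ⟨Nat.find hex, Nat.find_spec hex, ?_⟩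
  cases h : Nat.find hex with
  | zero =>
    rw [pow_zero]
    nlinarith
  | succ m =>
    have hm : ε < c * l ^ (j + m) := not_le.1 (Nat.find_min hex (by omega))
    have := pow_succ_le_mul_div_rpow hα hl hc (hε.trans_le hr) hε hN0 hN hj hm.le
    linarith

/-- A family of points organised as a tree is homogeneous: level-`j` pieces have diameter
`≲ l ^ j`, a ball of radius `l ^ j` meets boundedly many of them, and each has at most `l ^ (-α)`
children. -/
theorem isHomogeneousSet_range_of_labels [PseudoMetricSpace X] {α l c : ℝ} {N₀ N : ℕ} (hα : 0 ≤ α)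
    (hl : 0 < l) (hl1 : l < 1) (hc : 0 < c) (p : I → X) (label : ℕ → I → T)
    (hdist : ∀ j i i', label j i = label j i' → dist (p i) (p i') ≤ c * l ^ j)
    (hroot : (Set.range (label 0)).encard ≤ N₀)
    (hball : ∀ j x, (label j '' (p ⁻¹' Metric.ball x (l ^ j))).encard ≤ N₀)
    (hchild : ∀ j t, (label (j + 1) '' (label j ⁻¹' {t})).encard ≤ N) (hN : (N : ℝ) ≤ l⁻¹ ^ α) :
    IsHomogeneousSet α (Set.range p) := by
  refine ⟨N₀ * (1 + (c * l⁻¹ ^ 2) ^ α), fun x ε r hε hr => ?_⟩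
  obtain ⟨j, hj, hj'⟩ :=
    exists_nat_pow_near_of_lt_one (lt_min (hε.trans_le hr) one_pos) (min_le_right r 1) hl hl1
  have hstart : (label j '' (p ⁻¹' Metric.ball x r)).encard ≤ N₀ := by
    rcases le_or_gt r 1 with h1 | h1
    · rw [min_eq_left h1] at hj'
      exact (Set.encard_le_encard (Set.image_mono
        (Set.preimage_mono (Metric.ball_subset_ball hj')))).trans (hball j x)
    · rw [min_eq_right h1.le] at hj'
      obtain rfl : j = 0 := by
        by_contra hne
        exact hj'.not_gt (pow_lt_one₀ hl.le hl1 hne)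
      exact (Set.encard_le_encard (Set.image_subset_range _ _)).trans hroot
  obtain ⟨m, hm, hNm⟩ := exists_scale_pow_le j hα hl hl1 hc hε hr (Nat.cast_nonneg N) hN
    (hj.le.trans (min_le_left _ _))
  obtain ⟨F, hF, hcover⟩ := exists_finset_cover_of_encard_image_le
    (encard_image_label_add_le hstart hchild m)
    fun i i' h => (hdist (j + m) i i' h).trans hm
  refine ⟨F, ?_, Set.image_preimage_eq_range_inter ▸ hcover⟩
  calc (F.card : ℝ) ≤ N₀ * (N : ℝ) ^ m := mod_cast hF
    _ ≤ N₀ * ((1 + (c * l⁻¹ ^ 2) ^ α) * (r / ε) ^ α) := by gcongr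
    _ = N₀ * (1 + (c * l⁻¹ ^ 2) ^ α) * (r / ε) ^ α := by ring

end Labels

section Coordinates

variable {ι : Type*} [Fintype ι]

theorem abs_apply_sub_le_dist (x y : EuclideanSpace ℝ ι) (i : ι) :
    |x i - y i| ≤ dist x y := by
  rw [dist_eq_norm]
  exact PiLp.norm_apply_le (x - y) i

theorem floor_mem_Icc_of_abs_sub_le {x y : ℝ} {m : ℕ} (h : |x - y| ≤ m) :
    ⌊x⌋ ∈ Finset.Icc (⌊y⌋ - m) (⌊y⌋ + m) := by
  rw [abs_sub_le_iff] at h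
  rw [Finset.mem_Icc, ← Int.floor_sub_natCast, ← Int.floor_add_natCast]
  exact ⟨Int.floor_mono (by linarith), Int.floor_mono (by linarith)⟩

theorem encard_image_preimage_ball_le_of_floor {I T : Type*} {p : I → EuclideanSpace ℝ ι}
    {f : I → T} {x : EuclideanSpace ℝ ι} {r s : ℝ} {m : ℕ} (hs : 0 < s) (hr : r ≤ m * s)
    (h : ∀ i i', (∀ k, ⌊p i k / s⌋ = ⌊p i' k / s⌋) → f i = f i') :
    (f '' (p ⁻¹' Metric.ball x r)).encard ≤ ((2 * m + 1) ^ Fintype.card ι : ℕ) := by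
  classical
  let S : Finset (ι → ℤ) :=
    Fintype.piFinset fun k => Finset.Icc (⌊x k / s⌋ - m) (⌊x k / s⌋ + m)
  have hS : S.card = (2 * m + 1) ^ Fintype.card ι := by
    rw [Fintype.card_piFinset]
    simp only [Int.card_Icc]
    rw [Finset.prod_congr rfl fun k _ => (by omega : _ = 2 * m + 1), Finset.prod_const,
      Finset.card_univ]
  rw [← hS]
  refine encard_image_le_card_of_code S (fun i k => ⌊p i k / s⌋) (fun i hi => ?_)
    fun i _ i' _ hcode => h i i' (congrFun hcode)
  refine Fintype.mem_piFinset.2 fun k => floor_mem_Icc_of_abs_sub_le ?_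
  rw [← sub_div, abs_div, abs_of_pos hs, div_le_iff₀ hs]
  exact ((abs_apply_sub_le_dist _ _ k).trans (Metric.mem_ball.1 hi).le).trans hr

end Coordinates

/-- The Euclidean plane. -/
abbrev Plane := EuclideanSpace ℝ (Fin 2)

theorem Plane.dist_le (x y : Plane) : dist x y ≤ |x 0 - y 0| + |x 1 - y 1| := by
  rw [EuclideanSpace.dist_eq, Fin.sum_univ_two, Real.dist_eq, Real.dist_eq]
  refine Real.sqrt_le_iff.2 ⟨by positivity, ?_⟩
  nlinarith [abs_nonneg (x 0 - y 0), abs_nonneg (x 1 - y 1)]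

theorem Plane.Ioo_square_mem_nhds :
    {x : Plane | x 0 ∈ Set.Ioo (0 : ℝ) 1 ∧ x 1 ∈ Set.Ioo (0 : ℝ) 1} ∈ 𝓝 !₂[(1 / 2 : ℝ), 1 / 2] := by
  have hopen : IsOpen {x : Plane | x 0 ∈ Set.Ioo (0 : ℝ) 1 ∧ x 1 ∈ Set.Ioo (0 : ℝ) 1} :=
    (isOpen_Ioo.preimage (by fun_prop : Continuous fun x : Plane => x 0)).inter
      (isOpen_Ioo.preimage (by fun_prop : Continuous fun x : Plane => x 1))
  exact hopen.mem_nhds (by norm_num)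

/-- The point `∑ bᵢ l ^ i` of the Cantor set with contraction ratio `l`. -/
noncomputable def cantorSum (l : ℝ) (b : ℕ → Fin 2) : ℝ := ∑' i, (b i : ℝ) * l ^ i

section CantorSum

variable {l : ℝ}

theorem abs_fin_two_cast_sub_le (a b : Fin 2) : |((a : ℕ) : ℝ) - ((b : ℕ) : ℝ)| ≤ 1 := by
  fin_cases a <;> fin_cases b <;> simp

theorem abs_fin_two_cast_sub_eq_one {a b : Fin 2} (h : a ≠ b) :
    |((a : ℕ) : ℝ) - ((b : ℕ) : ℝ)| = 1 := by
  fin_cases a <;> fin_cases b <;> simp_all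

theorem summable_digit_sub_mul_pow (hl : 0 < l) (hl1 : l < 1) (b b' : ℕ → Fin 2) :
    Summable fun i => ((b i : ℝ) - (b' i : ℝ)) * l ^ i := by
  refine Summable.of_norm_bounded (summable_geometric_of_lt_one hl.le hl1) fun i => ?_
  rw [Real.norm_eq_abs, abs_mul, abs_of_pos (pow_pos hl i)]
  exact mul_le_of_le_one_left (pow_pos hl i).le (abs_fin_two_cast_sub_le _ _)

theorem cantorSum_sub_eq_tsum (hl : 0 < l) (hl1 : l < 1) {b b' : ℕ → Fin 2} {n : ℕ}
    (h : ∀ i < n, b i = b' i) :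
    cantorSum l b - cantorSum l b' =
      ∑' i, ((b (i + n) : ℝ) - (b' (i + n) : ℝ)) * l ^ (i + n) := by
  have hsum (b : ℕ → Fin 2) : Summable fun i => (b i : ℝ) * l ^ i := by
    simpa using summable_digit_sub_mul_pow hl hl1 b (fun _ => 0)
  rw [cantorSum, cantorSum, ← (hsum b).tsum_sub (hsum b')]
  simp_rw [← sub_mul]
  rw [← (summable_digit_sub_mul_pow hl hl1 b b').sum_add_tsum_nat_add n, Finset.sum_eq_zero,
    zero_add]
  intro i hi
  rw [h i (Finset.mem_range.1 hi), sub_self, zero_mul]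

theorem abs_tsum_digit_sub_le (hl : 0 < l) (hl1 : l < 1) (b b' : ℕ → Fin 2) (n : ℕ) :
    |∑' i, ((b (i + n) : ℝ) - (b' (i + n) : ℝ)) * l ^ (i + n)| ≤ l ^ n / (1 - l) := by
  have hgeom : HasSum (fun i => l ^ (i + n)) (l ^ n / (1 - l)) := by
    have := (hasSum_geometric_of_lt_one hl.le hl1).mul_right (l ^ n)
    simpa only [pow_add, div_eq_mul_inv, mul_comm] using this
  rw [← Real.norm_eq_abs]
  refine tsum_of_norm_bounded hgeom fun i => ?_
  rw [Real.norm_eq_abs, abs_mul, abs_of_pos (pow_pos hl _)]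
  exact mul_le_of_le_one_left (pow_pos hl _).le (abs_fin_two_cast_sub_le _ _)

theorem abs_cantorSum_sub_le (hl : 0 < l) (hl1 : l < 1) {b b' : ℕ → Fin 2} {n : ℕ}
    (h : ∀ i < n, b i = b' i) : |cantorSum l b - cantorSum l b'| ≤ l ^ n / (1 - l) := by
  rw [cantorSum_sub_eq_tsum hl hl1 h]
  exact abs_tsum_digit_sub_le hl hl1 b b' n

theorem le_abs_cantorSum_sub (hl : 0 < l) (hl1 : l < 1) {b b' : ℕ → Fin 2} (hne : b ≠ b') :
    (1 - 2 * l) / (1 - l) * l ^ PiNat.firstDiff b b' ≤ |cantorSum l b - cantorSum l b'| := by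
  set n := PiNat.firstDiff b b'
  set lead : ℝ := ((b n : ℝ) - (b' n : ℝ)) * l ^ n
  set rest : ℝ := ∑' i, ((b (i + (n + 1)) : ℝ) - (b' (i + (n + 1)) : ℝ)) * l ^ (i + (n + 1))
  have hsplit : cantorSum l b - cantorSum l b' = lead + rest := by
    rw [cantorSum_sub_eq_tsum hl hl1 (n := n) fun _ => PiNat.apply_eq_of_lt_firstDiff,
      ((summable_nat_add_iff n).2 (summable_digit_sub_mul_pow hl hl1 b b')).tsum_eq_zero_add]
    simp only [zero_add, add_assoc, add_comm 1 n, lead, rest, n]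
  have hlead : |lead| = l ^ n := by
    rw [abs_mul, abs_of_pos (pow_pos hl n),
      abs_fin_two_cast_sub_eq_one (PiNat.apply_firstDiff_ne hne), one_mul]
  have hrest : |rest| ≤ l ^ (n + 1) / (1 - l) := abs_tsum_digit_sub_le hl hl1 b b' (n + 1)
  calc (1 - 2 * l) / (1 - l) * l ^ n = l ^ n - l ^ (n + 1) / (1 - l) := by
        have : 1 - l ≠ 0 := by linarith
        field_simp
        ring
    _ ≤ |lead| - |rest| := by linarith
    _ ≤ |cantorSum l b - cantorSum l b'| := hsplit ▸ abs_sub_abs_le_abs_add lead rest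

theorem eq_of_abs_cantorSum_sub_lt (hl : 0 < l) (hl2 : l < 1 / 2) {b b' : ℕ → Fin 2} {j : ℕ}
    (h : |cantorSum l b - cantorSum l b'| < (1 - 2 * l) / (1 - l) * l ^ j) :
    ∀ i < j, b i = b' i := by
  rcases eq_or_ne b b' with rfl | hne
  · exact fun _ _ => rfl
  have hj : j ≤ PiNat.firstDiff b b' := by
    by_contra! hlt
    refine ((le_abs_cantorSum_sub hl (by linarith) hne).trans_lt h).not_ge ?_
    exact mul_le_mul_of_nonneg_left (pow_le_pow_of_le_one hl.le (by linarith) hlt.le)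
      (div_nonneg (by linarith) (by linarith))
  exact fun i hi => PiNat.apply_eq_of_lt_firstDiff (hi.trans_le hj)

theorem abs_ofDigits_sub_le_rpow {a : ℝ} (hl : 0 < l) (hl2 : l < 1 / 2) (ha : 0 ≤ a)
    (hla : l ^ a = 1 / 2) (b b' : ℕ → Fin 2) :
    |Real.ofDigits b - Real.ofDigits b'| ≤
      ((1 - 2 * l) / (1 - l))⁻¹ ^ a * |cantorSum l b - cantorSum l b'| ^ a := by
  have hκ0 : 0 < (1 - 2 * l) / (1 - l) := div_pos (by linarith) (by linarith)
  rcases eq_or_ne b b' with rfl | hne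
  · simp only [sub_self, abs_zero]
    positivity
  set n := PiNat.firstDiff b b'
  calc |Real.ofDigits b - Real.ofDigits b'| ≤ ((2 : ℝ)⁻¹) ^ n := by
        simpa using Real.abs_ofDigits_sub_ofDigits_le (x := b) (y := b') (n := n)
          fun i hi => PiNat.apply_eq_of_lt_firstDiff hi
    _ = (l ^ n) ^ a := by
        rw [← Real.rpow_natCast, ← Real.rpow_natCast, ← Real.rpow_mul hl.le, mul_comm,
          Real.rpow_mul hl.le, hla, one_div]
    _ ≤ (((1 - 2 * l) / (1 - l))⁻¹ * |cantorSum l b - cantorSum l b'|) ^ a := by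
        refine Real.rpow_le_rpow (by positivity) ?_ ha
        rw [le_inv_mul_iff₀ hκ0]
        exact le_abs_cantorSum_sub hl (by linarith) hne
    _ = _ := Real.mul_rpow (by positivity) (by positivity)

end CantorSum

/-- The point of the square of the Cantor set with digit sequences `i.1` and `i.2`. -/
noncomputable def cantorPoint (l : ℝ) (i : (ℕ → Fin 2) × (ℕ → Fin 2)) : Plane :=
  !₂[cantorSum l i.1, cantorSum l i.2]

section CantorPoint

variable {l : ℝ}

theorem dist_cantorPoint_le (hl : 0 < l) (hl1 : l < 1) {i i' : (ℕ → Fin 2) × (ℕ → Fin 2)} {n : ℕ}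
    (h₁ : ∀ k < n, i.1 k = i'.1 k) (h₂ : ∀ k < n, i.2 k = i'.2 k) :
    dist (cantorPoint l i) (cantorPoint l i') ≤ 2 / (1 - l) * l ^ n :=
  calc dist (cantorPoint l i) (cantorPoint l i')
      ≤ |cantorSum l i.1 - cantorSum l i'.1| + |cantorSum l i.2 - cantorSum l i'.2| :=
        Plane.dist_le _ _
    _ ≤ l ^ n / (1 - l) + l ^ n / (1 - l) :=
        add_le_add (abs_cantorSum_sub_le hl hl1 h₁) (abs_cantorSum_sub_le hl hl1 h₂)
    _ = 2 / (1 - l) * l ^ n := by ring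

theorem isBounded_range_cantorPoint (hl : 0 < l) (hl1 : l < 1) :
    Bornology.IsBounded (Set.range (cantorPoint l)) := by
  refine Metric.isBounded_range_iff.2 ⟨2 / (1 - l) * l ^ 0, fun i i' => ?_⟩
  exact dist_cantorPoint_le hl hl1 (by simp) (by simp)

theorem isHomogeneousSet_range_cantorPoint {α : ℝ} (hα : 0 ≤ α) (hl : 0 < l) (hl2 : l < 1 / 2)
    (h4 : 4 ≤ l⁻¹ ^ α) : IsHomogeneousSet α (Set.range (cantorPoint l)) := by
  set κ : ℝ := (1 - 2 * l) / (1 - l)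
  have hκ : 0 < κ := div_pos (by linarith) (by linarith)
  let label : ℕ → (ℕ → Fin 2) × (ℕ → Fin 2) → List (Fin 2) × List (Fin 2) :=
    fun j i => (PiNat.res i.1 j, PiNat.res i.2 j)
  have hagree {j : ℕ} {x y : Plane} {k : Fin 2} (h : ⌊x k / (κ * l ^ j)⌋ = ⌊y k / (κ * l ^ j)⌋) :
      |x k - y k| < κ * l ^ j := by
    have hs : 0 < κ * l ^ j := by positivity
    have := Int.abs_sub_lt_one_of_floor_eq_floor h
    rwa [← sub_div, abs_div, abs_of_pos hs, div_lt_one hs] at this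
  refine isHomogeneousSet_range_of_labels (c := 2 / (1 - l)) (N₀ := (2 * ⌈κ⁻¹⌉₊ + 1) ^ 2) (N := 4)
    hα hl (by linarith) (div_pos two_pos (by linarith)) (cantorPoint l) label
    (fun j i i' h => ?_) ?_ (fun j x => ?_) (fun j t => ?_) (by simpa using h4)
  · simp only [label, Prod.mk.injEq, PiNat.res_eq_res] at h
    exact dist_cantorPoint_le hl (by linarith) (fun _ => (h.1 ·)) fun _ => (h.2 ·)
  · have hrange : Set.range (label 0) ⊆ {([], [])} := by
      rintro _ ⟨i, rfl⟩
      rfl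
    refine (Set.encard_le_encard hrange).trans ?_
    rw [Set.encard_singleton]
    exact_mod_cast Nat.one_le_pow _ _ (by omega)
  · refine encard_image_preimage_ball_le_of_floor (s := κ * l ^ j) (by positivity) ?_
      fun i i' hi => Prod.ext
        (PiNat.res_eq_res.2 fun n hn => eq_of_abs_cantorSum_sub_lt hl hl2 (hagree (hi 0)) n hn)
        (PiNat.res_eq_res.2 fun n hn => eq_of_abs_cantorSum_sub_lt hl hl2 (hagree (hi 1)) n hn)
    calc l ^ j = κ⁻¹ * (κ * l ^ j) := by field_simp
      _ ≤ ⌈κ⁻¹⌉₊ * (κ * l ^ j) := by gcongr; exact Nat.le_ceil _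
  · refine encard_image_le_card_of_code (Finset.univ : Finset (Fin 2 × Fin 2))
      (fun i => (i.1 j, i.2 j)) (fun _ _ => Finset.mem_univ _) fun i hi i' hi' hcode => ?_
    have hlabel : label j i = label j i' := hi.trans hi'.symm
    simp only [label, Prod.mk.injEq, PiNat.res_succ] at hlabel hcode ⊢
    rw [hlabel.1, hlabel.2, hcode.1, hcode.2]
    exact ⟨rfl, rfl⟩

theorem mul_dimH_range_le_of_dist_le_rpow {I X Y : Type*} [MetricSpace X] [MetricSpace Y]
    {p : I → X} {q : I → Y} {C a : ℝ≥0} (ha : 0 < a)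
    (h : ∀ i i', dist (q i) (q i') ≤ C * dist (p i) (p i') ^ (a : ℝ)) :
    a * dimH (Set.range q) ≤ dimH (Set.range p) := by
  rcases isEmpty_or_nonempty I with _ | _
  · simp [Set.range_eq_empty]
  choose! inv hinv using fun x (hx : x ∈ Set.range p) => hx
  have hholder : HolderOnWith C a (q ∘ inv) (Set.range p) := by
    intro x hx y hy
    have := h (inv x) (inv y)
    rw [hinv x hx, hinv y hy] at this
    rw [edist_dist, edist_dist, ENNReal.ofReal_rpow_of_nonneg dist_nonneg a.coe_nonneg,
      ← ENNReal.ofReal_coe_nnreal, ← ENNReal.ofReal_mul C.coe_nonneg]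
    exact ENNReal.ofReal_le_ofReal this
  have hrange : Set.range q ⊆ (q ∘ inv) '' Set.range p := by
    rintro _ ⟨i, rfl⟩
    refine ⟨p i, ⟨i, rfl⟩, dist_le_zero.1 ((h _ i).trans_eq ?_)⟩
    rw [hinv _ ⟨i, rfl⟩, dist_self, Real.zero_rpow (by exact_mod_cast ha.ne'), mul_zero]
  have ha' : (a : ℝ≥0∞) ≠ 0 := by exact_mod_cast ha.ne'
  rw [mul_comm, ← ENNReal.le_div_iff_mul_le (Or.inl ha') (Or.inl ENNReal.coe_ne_top)]
  exact (dimH_mono hrange).trans (hholder.dimH_image_le ha)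

theorem dimH_range_ofDigits_prod :
    dimH (Set.range fun i : (ℕ → Fin 2) × (ℕ → Fin 2) =>
      (!₂[Real.ofDigits i.1, Real.ofDigits i.2] : Plane)) = 2 := by
  have hmem : Set.range (fun i : (ℕ → Fin 2) × (ℕ → Fin 2) =>
      (!₂[Real.ofDigits i.1, Real.ofDigits i.2] : Plane)) ∈ 𝓝 !₂[(1 / 2 : ℝ), 1 / 2] := by
    refine mem_of_superset Plane.Ioo_square_mem_nhds fun x ⟨h₀, h₁⟩ => ?_
    obtain ⟨b, -, hb⟩ := Real.ofDigits_SurjOn one_lt_two ⟨h₀.1.le, h₀.2.le⟩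
    obtain ⟨b', -, hb'⟩ := Real.ofDigits_SurjOn one_lt_two ⟨h₁.1.le, h₁.2.le⟩
    refine ⟨(b, b'), ?_⟩
    ext k
    fin_cases k
    exacts [hb, hb']
  simpa using Real.dimH_of_mem_nhds hmem

theorem two_mul_le_dimH_range_cantorPoint {a : ℝ≥0} (hl : 0 < l) (hl2 : l < 1 / 2) (ha : 0 < a)
    (hla : l ^ (a : ℝ) = 1 / 2) : a * 2 ≤ dimH (Set.range (cantorPoint l)) := by
  have hκ : 0 < (1 - 2 * l) / (1 - l) := div_pos (by linarith) (by linarith)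
  lift ((1 - 2 * l) / (1 - l))⁻¹ ^ (a : ℝ) to ℝ≥0 using by positivity with κ hκ'
  have hcoord (i i' : (ℕ → Fin 2) × (ℕ → Fin 2)) (b b' : ℕ → Fin 2)
      (h : |cantorSum l b - cantorSum l b'| ≤ dist (cantorPoint l i) (cantorPoint l i')) :
      |Real.ofDigits b - Real.ofDigits b'| ≤
        κ * dist (cantorPoint l i) (cantorPoint l i') ^ (a : ℝ) :=
    (hκ' ▸ abs_ofDigits_sub_le_rpow hl hl2 a.coe_nonneg hla b b').trans (by gcongr)
  refine (congrArg (_ * ·) dimH_range_ofDigits_prod.symm).trans_le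
    (mul_dimH_range_le_of_dist_le_rpow (C := 2 * κ) ha fun i i' => ?_)
  have h₀ := hcoord i i' i.1 i'.1 (abs_apply_sub_le_dist (cantorPoint l i) (cantorPoint l i') 0)
  have h₁ := hcoord i i' i.2 i'.2 (abs_apply_sub_le_dist (cantorPoint l i) (cantorPoint l i') 1)
  refine (Plane.dist_le _ _).trans ?_
  rw [NNReal.coe_mul, NNReal.coe_two, mul_assoc, two_mul]
  exact add_le_add h₀ h₁

end CantorPoint

theorem exists_isHomogeneousSet_of_lt_two {α : ℝ} (hα : 0 < α) (hα2 : α < 2) :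
    ∃ K : Set Plane, Bornology.IsBounded K ∧ IsHomogeneousSet α K ∧ ENNReal.ofReal α ≤ dimH K := by
  set l : ℝ := 2 ^ (-(2 / α)) with hldef
  have hl : 0 < l := by positivity
  have hl2 : l < 1 / 2 := by
    rw [one_div, ← Real.rpow_neg_one]
    exact Real.rpow_lt_rpow_of_exponent_lt one_lt_two
      (neg_lt_neg ((one_lt_div hα).2 hα2))
  refine ⟨Set.range (cantorPoint l), isBounded_range_cantorPoint hl (by linarith),
    isHomogeneousSet_range_cantorPoint hα.le hl hl2 (le_of_eq ?_), ?_⟩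
  · rw [hldef, Real.rpow_neg zero_le_two, inv_inv, ← Real.rpow_mul zero_le_two,
      div_mul_cancel₀ _ hα.ne']
    norm_num
  · have hla : l ^ ((α / 2).toNNReal : ℝ) = 1 / 2 := by
      rw [Real.coe_toNNReal _ (by linarith), hldef, ← Real.rpow_mul zero_le_two,
        show -(2 / α) * (α / 2) = -1 by field_simp, Real.rpow_neg_one, one_div]
    refine le_of_eq_of_le ?_ (two_mul_le_dimH_range_cantorPoint hl hl2
      (Real.toNNReal_pos.2 (half_pos hα)) hla)
    rw [← ENNReal.ofReal, ← ENNReal.ofReal_ofNat, ← ENNReal.ofReal_mul (by linarith)]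
    congr 1
    ring

theorem card_le_coveringNumber_of_pairwise {X : Type*} [PseudoMetricSpace X] {E : Set X}
    {P : Finset X} {δ : ℝ≥0} (hP : ↑P ⊆ E)
    (hsep : (P : Set X).Pairwise fun x y => 2 * δ < dist x y) :
    (P.card : ℕ∞) ≤ Metric.coveringNumber δ E := by
  have hsep' : Metric.IsSeparated ((2 * δ : ℝ≥0) : ℝ≥0∞) (P : Set X) := fun x hx y hy hxy => by
    have : 2 * δ < dist x y := hsep hx hy hxy
    change _ < edist x y
    rw [edist_dist, ← ENNReal.ofReal_coe_nnreal]
    exact (ENNReal.ofReal_lt_ofReal_iff_of_nonneg NNReal.zero_le_coe).2 (by simpa)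
  calc (P.card : ℕ∞) = (P : Set X).encard := (Set.encard_coe_eq_coe_finsetCard P).symm
    _ ≤ Metric.packingNumber (2 * δ) E := hsep'.encard_le_packingNumber hP
    _ ≤ Metric.externalCoveringNumber δ E :=
        Metric.packingNumber_two_mul_le_externalCoveringNumber _ _
    _ ≤ Metric.coveringNumber δ E := Metric.externalCoveringNumber_le_coveringNumber _ _

section UpperMinkowskiDim

theorem log_ofReal_rpow_neg {δ : ℝ} (hδ : 0 < δ) (τ : ℝ) :
    ENNReal.log (ENNReal.ofReal (δ ^ (-τ))) = (τ : EReal) * ((-Real.log δ : ℝ) : EReal) := by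
  rw [ENNReal.log_ofReal_of_pos (Real.rpow_pos_of_pos hδ _), Real.log_rpow hδ, ← EReal.coe_mul,
    neg_mul_comm]

theorem le_log_div_neg_log_iff {N : ℝ≥0∞} {δ τ : ℝ} (hδ : 0 < δ) (hδ1 : δ < 1) :
    (τ : EReal) ≤ ENNReal.log N / ((-Real.log δ : ℝ) : EReal) ↔ ENNReal.ofReal (δ ^ (-τ)) ≤ N := by
  have hlog : 0 < -Real.log δ := neg_pos.2 (Real.log_neg hδ hδ1)
  rw [EReal.le_div_iff_mul_le (by exact_mod_cast hlog) (EReal.coe_ne_top _),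
    ← log_ofReal_rpow_neg hδ, ENNReal.log_le_log_iff]

theorem log_div_neg_log_le_iff {N : ℝ≥0∞} {δ τ : ℝ} (hδ : 0 < δ) (hδ1 : δ < 1) :
    ENNReal.log N / ((-Real.log δ : ℝ) : EReal) ≤ (τ : EReal) ↔ N ≤ ENNReal.ofReal (δ ^ (-τ)) := by
  have hlog : 0 < -Real.log δ := neg_pos.2 (Real.log_neg hδ hδ1)
  rw [EReal.div_le_iff_le_mul (by exact_mod_cast hlog) (EReal.coe_ne_top _),
    mul_comm, ← log_ofReal_rpow_neg hδ, ENNReal.log_le_log_iff]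

theorem le_upperMinkowskiDim {X : Type*} [PseudoMetricSpace X] {E : Set X} {t : ℝ} (δ : ℕ → ℝ)
    (hδ : Tendsto δ atTop (𝓝 0)) (hδ0 : ∀ k, 0 < δ k) (P : ℕ → Finset X)
    (hP : ∀ k, ↑(P k) ⊆ E)
    (hsep : ∀ k, (P k : Set X).Pairwise fun x y => 2 * δ k < dist x y)
    (hcard : ∀ τ < t, ∀ᶠ k in atTop, δ k ^ (-τ) ≤ (P k).card) :
    (t : EReal) ≤ upperMinkowskiDim E := by
  refine EReal.ge_of_forall_gt_iff_ge.1 fun τ hτ => le_limsup_of_frequently_le' ?_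
  lift δ to ℕ → ℝ≥0 using fun k => (hδ0 k).le
  simp only [NNReal.coe_pos] at hδ0
  have hlim : Tendsto δ atTop (𝓝[>] 0) :=
    tendsto_nhdsWithin_iff.2 ⟨NNReal.tendsto_coe.1 hδ, .of_forall hδ0⟩
  refine hlim.frequently (Eventually.frequently ?_)
  filter_upwards [hcard τ (by exact_mod_cast hτ), hδ.eventually_lt_const one_pos] with k hk hk1
  refine (le_log_div_neg_log_iff (hδ0 k) hk1).2 ?_
  calc ENNReal.ofReal (δ k ^ (-τ)) ≤ ENNReal.ofReal (P k).card := ENNReal.ofReal_le_ofReal hk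
    _ = (((P k).card : ℕ∞) : ℝ≥0∞) := by simp
    _ ≤ Metric.coveringNumber (δ k) E := by
        exact_mod_cast card_le_coveringNumber_of_pairwise (hP k) (hsep k)

theorem eventually_mul_two_rpow_le_two_rpow {t τ : ℝ} (C : ℝ) (h : t < τ) :
    ∀ᶠ J : ℕ in atTop, C * ((J + 1 : ℕ) + 1) * 2 ^ (t * (J + 1 : ℕ)) ≤ (2 : ℝ) ^ (τ * J) := by
  set q : ℝ := 2 ^ (τ - t)
  have hq : 1 < q := Real.one_lt_rpow one_lt_two (by linarith)
  have hlim : Tendsto (fun J : ℕ => C * 2 ^ t * ((J : ℝ) ^ 1 / q ^ J + 2 * ((J : ℝ) ^ 0 / q ^ J)))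
      atTop (𝓝 (C * 2 ^ t * (0 + 2 * 0))) :=
    ((tendsto_pow_const_div_const_pow_of_one_lt 1 hq).add
      ((tendsto_pow_const_div_const_pow_of_one_lt 0 hq).const_mul 2)).const_mul _
  simp only [mul_zero, add_zero] at hlim
  filter_upwards [hlim.eventually_le_const one_pos] with J hJ
  have : 0 < q ^ J := by positivity
  have hτ : (2 : ℝ) ^ (τ * J) = q ^ J * 2 ^ (t * J) := by
    rw [← Real.rpow_natCast, ← Real.rpow_mul two_pos.le, ← Real.rpow_add two_pos]
    ring_nf
  have ht : (2 : ℝ) ^ (t * (J + 1 : ℕ)) = 2 ^ t * 2 ^ (t * J) := by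
    rw [← Real.rpow_add two_pos]
    push_cast
    ring_nf
  calc C * ((J + 1 : ℕ) + 1) * 2 ^ (t * (J + 1 : ℕ))
      = C * 2 ^ t * ((J : ℝ) ^ 1 / q ^ J + 2 * ((J : ℝ) ^ 0 / q ^ J)) *
          (q ^ J * 2 ^ (t * J)) := by
        rw [ht]
        field_simp
        push_cast
        ring
    _ ≤ 1 * (q ^ J * 2 ^ (t * J)) := by gcongr
    _ = 2 ^ (τ * J) := by rw [hτ, one_mul]

theorem upperMinkowskiDim_le {X : Type*} [PseudoEMetricSpace X] {E : Set X} {t C : ℝ} (ht : 0 ≤ t)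
    (h : ∀ J : ℕ, (Metric.coveringNumber ((2 : ℝ≥0)⁻¹ ^ J) E : ℝ≥0∞) ≤
      ENNReal.ofReal (C * (J + 1) * 2 ^ (t * J))) :
    upperMinkowskiDim E ≤ (t : EReal) := by
  refine EReal.le_of_forall_lt_iff_le.1 fun τ hτ => limsup_le_of_le (h := ?_)
  replace hτ : t < τ := by exact_mod_cast hτ
  obtain ⟨J₀, hJ₀⟩ := eventually_atTop.1 (eventually_mul_two_rpow_le_two_rpow C hτ)
  filter_upwards [Ioo_mem_nhdsGT (by positivity : (0 : ℝ≥0) < 2⁻¹ ^ (J₀ + 1))] with δ ⟨hδ0, hδ⟩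
  have hδ1 : δ < 1 := hδ.trans_le (pow_le_one₀ (by positivity) (by norm_num))
  obtain ⟨J, hJδ, hδJ⟩ := exists_nat_pow_near_of_lt_one (y := (2 : ℝ≥0)⁻¹) hδ0 hδ1.le
    (by norm_num) (by norm_num)
  have hJ : J₀ ≤ J := by
    have := hJδ.trans hδ
    rw [pow_lt_pow_iff_right_of_lt_one₀ (by norm_num) (by norm_num)] at this
    omega
  rw [log_div_neg_log_le_iff (by exact_mod_cast hδ0) (by exact_mod_cast hδ1)]
  calc (Metric.coveringNumber δ E : ℝ≥0∞) ≤ Metric.coveringNumber (2⁻¹ ^ (J + 1)) E := by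
        exact_mod_cast Metric.coveringNumber_anti hJδ.le
    _ ≤ ENNReal.ofReal (2 ^ (τ * J)) := (h (J + 1)).trans (ENNReal.ofReal_le_ofReal (hJ₀ J hJ))
    _ = ENNReal.ofReal ((2⁻¹ ^ J) ^ (-τ)) := by
        rw [inv_pow, Real.rpow_neg (by positivity), Real.inv_rpow (by positivity), inv_inv,
          ← Real.rpow_natCast, ← Real.rpow_mul two_pos.le, mul_comm]
    _ ≤ ENNReal.ofReal (δ ^ (-τ)) := ENNReal.ofReal_le_ofReal <|
        Real.rpow_le_rpow_of_nonpos (by exact_mod_cast hδ0) (by exact_mod_cast hδJ) (by linarith)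

end UpperMinkowskiDim

/-- The numbers below `B ^ N` whose `i`-th base-`B` digit is less than `E i` for all `i`. -/
def digitSet (B : ℕ) (E : ℕ → ℕ) (N : ℕ) : Finset ℕ :=
  (Finset.range (B ^ N)).filter fun u => ∀ i < N, u / B ^ i % B < E i

section DigitSet

variable {B : ℕ} {E : ℕ → ℕ} {N : ℕ}

theorem mem_digitSet {u : ℕ} :
    u ∈ digitSet B E N ↔ u < B ^ N ∧ ∀ i < N, u / B ^ i % B < E i := by
  simp [digitSet]

theorem digit_lt_of_mem_digitSet {u : ℕ} (hB : 0 < B) (hE : ∀ i, 0 < E i)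
    (hu : u ∈ digitSet B E N) (i : ℕ) : u / B ^ i % B < E i := by
  rw [mem_digitSet] at hu
  rcases lt_or_ge i N with h | h
  · exact hu.2 i h
  · rw [Nat.div_eq_of_lt (hu.1.trans_le (Nat.pow_le_pow_right hB h)), Nat.zero_mod]
    exact hE i

theorem mul_pow_add_digit_eq {i a u : ℕ} (hB : 0 < B) (hi : i < N) :
    (a * B ^ N + u) / B ^ i % B = u / B ^ i % B := by
  obtain ⟨m, rfl⟩ := Nat.exists_eq_add_of_lt hi
  have : a * B ^ (i + m + 1) + u = u + B ^ i * (a * B ^ m * B) := by ring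
  rw [this, Nat.add_mul_div_left _ _ (pow_pos hB i), Nat.add_mul_mod_self_right]

theorem mul_pow_add_mem_digitSet {u d : ℕ} (hB : 0 < B) (hEB : E N ≤ B) (hu : u ∈ digitSet B E N)
    (hd : d < E N) : d * B ^ N + u ∈ digitSet B E (N + 1) := by
  obtain ⟨huN, hdig⟩ := mem_digitSet.1 hu
  refine mem_digitSet.2 ⟨?_, fun i hi => ?_⟩
  · calc d * B ^ N + u < (d + 1) * B ^ N := by linarith
      _ ≤ B * B ^ N := by gcongr; omega
      _ = B ^ (N + 1) := (pow_succ' B N).symm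
  · rcases Nat.lt_succ_iff_lt_or_eq.1 hi with h | rfl
    · rw [mul_pow_add_digit_eq hB h]
      exact hdig i h
    · rw [mul_comm, Nat.mul_add_div (pow_pos hB i), Nat.div_eq_of_lt huN, add_zero]
      exact (Nat.mod_le _ _).trans_lt hd

theorem eq_of_mul_add_eq_mul_add {M d d' u u' : ℕ} (hu : u < M) (hu' : u' < M)
    (h : d * M + u = d' * M + u') : d = d' ∧ u = u' := by
  have hM : 0 < M := u.zero_le.trans_lt hu
  have hdiv := congrArg (· / M) h
  have hmod := congrArg (· % M) h
  simpa [mul_comm _ M, Nat.mul_add_div hM, Nat.mul_add_mod, Nat.div_eq_of_lt,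
    Nat.mod_eq_of_lt, hu, hu'] using And.intro hdiv hmod

theorem prod_le_card_digitSet (hB : 0 < B) (hE : ∀ i, E i ≤ B) (N : ℕ) :
    ∏ i ∈ Finset.range N, E i ≤ (digitSet B E N).card := by
  induction N with
  | zero => simp [digitSet]
  | succ N ih =>
    calc ∏ i ∈ Finset.range (N + 1), E i ≤ (digitSet B E N).card * E N := by
          rw [Finset.prod_range_succ]
          gcongr
      _ = (digitSet B E N ×ˢ Finset.range (E N)).card := by
          rw [Finset.card_product, Finset.card_range]
      _ ≤ (digitSet B E (N + 1)).card := by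
          refine Finset.card_le_card_of_injOn (fun q => q.2 * B ^ N + q.1) (fun q hq => ?_)
            fun q hq q' hq' h => ?_
          · obtain ⟨hu, hd⟩ := Finset.mem_product.1 hq
            exact mul_pow_add_mem_digitSet hB (hE N) hu (Finset.mem_range.1 hd)
          · have hu := (mem_digitSet.1 (Finset.mem_product.1 hq).1).1
            have hu' := (mem_digitSet.1 (Finset.mem_product.1 hq').1).1
            exact (Prod.ext_iff.2 (eq_of_mul_add_eq_mul_add hu hu' h).symm)

end DigitSet

theorem floor_pow_succ_mul_ediv {B : ℕ} (hB : 0 < B) (j : ℕ) (x : ℝ) :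
    ⌊(B : ℝ) ^ (j + 1) * x⌋ / (B : ℤ) = ⌊(B : ℝ) ^ j * x⌋ := by
  rw [← Int.floor_div_natCast]
  congr 1
  have : (B : ℝ) ≠ 0 := by positivity
  field_simp
  ring

theorem floor_pow_mul_digit_lt {B D n v : ℕ} (hB : 0 < B) (hD : 0 < D)
    (hv : v ∈ digitSet B (fun _ => D) n) (j : ℕ) :
    ⌊(B : ℝ) ^ (j + 1) * (v * (B : ℝ)⁻¹ ^ n)⌋ % (B : ℤ) < D := by
  rcases le_or_gt (j + 1) n with h | h
  · have hdiv : (B : ℝ) ^ (j + 1) * (v * (B : ℝ)⁻¹ ^ n) = v / ((B ^ (n - (j + 1)) : ℕ) : ℝ) := by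
      obtain ⟨m, rfl⟩ := Nat.exists_eq_add_of_le h
      rw [Nat.add_sub_cancel_left]
      push_cast
      rw [inv_pow, pow_add _ (j + 1)]
      field_simp
    rw [hdiv, Int.floor_div_natCast, Int.floor_natCast]
    exact_mod_cast digit_lt_of_mem_digitSet hB (fun _ => hD) hv _
  · have hmul : (B : ℝ) ^ (j + 1) * (v * (B : ℝ)⁻¹ ^ n) = ((v * B ^ (j - n) * B : ℕ) : ℝ) := by
      obtain ⟨m, rfl⟩ := Nat.exists_eq_add_of_le (Nat.lt_succ_iff.1 h)
      rw [Nat.add_sub_cancel_left]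
      push_cast
      rw [inv_pow, pow_succ, pow_add]
      field_simp
    rw [hmul, Int.floor_natCast]
    push_cast
    rw [Int.mul_emod_left]
    exact_mod_cast hD

theorem cast_mul_inv_pow_lt_one {B n v : ℕ} (hv : v < B ^ n) : (v : ℝ) * (B : ℝ)⁻¹ ^ n < 1 := by
  rw [inv_pow, ← div_eq_mul_inv]
  exact (div_lt_one (by exact_mod_cast v.zero_le.trans_lt hv)).2 (by exact_mod_cast hv)

/-- The product of `[0, 2)` with the set of `c ∈ [0, 1)` all of whose base-`B` digits are
less than `D`: the example for large `α`, containing many unit distances between points of nearby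
heights. -/
def stripSet (B D : ℕ) : Set Plane :=
  {x | x 0 ∈ Set.Ico 0 2 ∧ x 1 ∈ Set.Ico 0 1 ∧ ∀ j : ℕ, ⌊(B : ℝ) ^ (j + 1) * x 1⌋ % B < D}

section StripSet

variable {B D : ℕ}

theorem stripSet_subset_ball (B D : ℕ) : stripSet B D ⊆ Metric.ball 0 3 := by
  rintro x ⟨⟨h₀, h₀'⟩, ⟨h₁, h₁'⟩, -⟩
  refine Metric.mem_ball.2 ((Plane.dist_le x 0).trans_lt ?_)
  rw [PiLp.zero_apply, PiLp.zero_apply, sub_zero, sub_zero, abs_of_nonneg h₀, abs_of_nonneg h₁]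
  linarith

theorem isBounded_stripSet (B D : ℕ) : Bornology.IsBounded (stripSet B D) :=
  Metric.isBounded_ball.subset (stripSet_subset_ball B D)

theorem isHomogeneousSet_stripSet {α : ℝ} (hα : 0 ≤ α) (hB : 2 ≤ B)
    (hBD : (B * D : ℝ) ≤ (B : ℝ) ^ α) : IsHomogeneousSet α (stripSet B D) := by
  have : (0 : ℝ) < B := by positivity
  have hB1 : (1 : ℝ) < B := by exact_mod_cast hB
  have hBz : (0 : ℤ) < B := by omega
  let label : ℕ → stripSet B D → Fin 2 → ℤ := fun j x k => ⌊(B : ℝ) ^ j * x.1 k⌋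
  have hcell (j : ℕ) (x x' : stripSet B D)
      (h : ∀ k, ⌊x.1 k / (B : ℝ)⁻¹ ^ j⌋ = ⌊x'.1 k / (B : ℝ)⁻¹ ^ j⌋) : label j x = label j x' := by
    ext k
    simpa [label, div_eq_mul_inv, mul_comm] using h k
  rw [← Subtype.range_coe (s := stripSet B D)]
  refine isHomogeneousSet_range_of_labels (l := (B : ℝ)⁻¹) (c := 2) (N₀ := (2 * 3 + 1) ^ 2)
    (N := B * D) hα (by positivity) (inv_lt_one_of_one_lt₀ hB1) two_pos _ label
    (fun j x x' h => ?_) ?_ (fun j x => ?_) (fun j t => ?_) (by simpa using hBD)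
  · have hk (k : Fin 2) : |x.1 k - x'.1 k| ≤ (B : ℝ)⁻¹ ^ j := by
      have := (Int.abs_sub_lt_one_of_floor_eq_floor (congrFun h k)).le
      rw [← mul_sub, abs_mul, abs_of_pos (by positivity)] at this
      rwa [inv_pow, inv_eq_one_div, le_div_iff₀' (by positivity)]
    linarith [Plane.dist_le x.1 x'.1, hk 0, hk 1]
  · rw [← Set.image_univ, ← Set.preimage_eq_univ_iff.2
      (Subtype.range_coe.trans_subset (stripSet_subset_ball B D))]
    exact encard_image_preimage_ball_le_of_floor (m := 3) (by positivity) (by simp) (hcell 0)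
  · have hj : 0 < (B : ℝ)⁻¹ ^ j := by positivity
    exact encard_image_preimage_ball_le_of_floor (m := 3) hj (by push_cast; linarith) (hcell j)
  · refine (encard_image_le_card_of_code (Finset.Ico 0 (B : ℤ) ×ˢ Finset.Ico 0 (D : ℤ))
      (fun x => (label (j + 1) x 0 % B, label (j + 1) x 1 % B)) (fun x _ => ?_)
      fun x hx x' hx' hcode => ?_).trans_eq (by simp)
    · rw [Finset.mem_product, Finset.mem_Ico, Finset.mem_Ico]
      exact ⟨⟨Int.emod_nonneg _ hBz.ne', Int.emod_lt_of_pos _ hBz⟩, Int.emod_nonneg _ hBz.ne',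
        x.2.2.2 j⟩
    · have hparent (k : Fin 2) : label (j + 1) x k / B = label (j + 1) x' k / B := by
        simpa only [label, floor_pow_succ_mul_ediv (two_pos.trans_le hB)] using
          congrFun (hx.trans hx'.symm) k
      have hdigit (k : Fin 2) : label (j + 1) x k % B = label (j + 1) x' k % B := by
        rw [Prod.mk.injEq] at hcode
        fin_cases k
        exacts [hcode.1, hcode.2]
      ext k
      rw [← Int.mul_ediv_add_emod (label (j + 1) x k) B, hparent, hdigit, Int.mul_ediv_add_emod]

theorem mem_stripSet_of_mem_digitSet {n v : ℕ} {a : ℝ} (hB : 0 < B) (hD : 0 < D)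
    (ha : a ∈ Set.Ico 0 2) (hv : v ∈ digitSet B (fun _ => D) n) :
    !₂[a, v * (B : ℝ)⁻¹ ^ n] ∈ stripSet B D :=
  ⟨ha, ⟨by simpa using by positivity, cast_mul_inv_pow_lt_one (mem_digitSet.1 hv).1⟩,
    floor_pow_mul_digit_lt hB hD hv⟩

end StripSet

theorem exists_isHomogeneousSet_of_le_two {α : ℝ} (hα : 0 < α) (hα2 : α ≤ 2) :
    ∃ K : Set Plane, Bornology.IsBounded K ∧ IsHomogeneousSet α K ∧ ENNReal.ofReal α ≤ dimH K := by
  rcases hα2.lt_or_eq with h | rfl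
  · exact exists_isHomogeneousSet_of_lt_two hα h
  refine ⟨stripSet 2 2, isBounded_stripSet 2 2, isHomogeneousSet_stripSet zero_le_two le_rfl
    (by norm_num), ?_⟩
  have hmem : stripSet 2 2 ∈ 𝓝 (!₂[(1 / 2 : ℝ), 1 / 2] : Plane) :=
    mem_of_superset Plane.Ioo_square_mem_nhds fun x ⟨h₀, h₁⟩ =>
      ⟨⟨h₀.1.le, h₀.2.trans one_lt_two⟩, ⟨h₁.1.le, h₁.2⟩, fun j =>
        Int.emod_lt_of_pos _ (by norm_num)⟩
  simp [Real.dimH_of_mem_nhds hmem]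

theorem le_unitDistanceDim_of_upperMinkowskiDim {α t : ℝ} (hα : 0 < α) (hα2 : α ≤ 2) {K : Set Plane}
    (hK : Bornology.IsBounded K) (hhom : IsHomogeneousSet α K)
    (h : ∀ K' ⊇ K, (t : EReal) ≤ upperMinkowskiDim (unitDistancePairs K')) :
    (t : EReal) ≤ unitDistanceDim 2 α := by
  -- Adding a set of full dimension `α` makes the Hausdorff dimension exactly `α`.
  obtain ⟨K₀, hK₀, hhom₀, hdim₀⟩ := exists_isHomogeneousSet_of_le_two hα hα2
  have hb := hK₀.union hK
  have hhom' := hhom₀.union hhom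
  have hsub : K₀ ∪ K ⊆ closure (K₀ ∪ K) := subset_closure
  exact (h _ (Set.subset_union_right.trans hsub)).trans (le_sSup ⟨_, hb.isCompact_closure,
    (hhom'.dimH_closure_le hα.le hb).antisymm
      (hdim₀.trans (dimH_mono (Set.subset_union_left.trans hsub))),
    hhom'.isDiscreteAlphaSet_closure, rfl⟩)

theorem eventually_rpow_neg_le_rpow {B τ : ℝ} (hB : 1 < B) {m : ℕ → ℕ} {e : ℕ → ℝ}
    (h : Tendsto (fun k => e k - τ * m k) atTop atTop) :
    ∀ᶠ k in atTop, (B⁻¹ ^ m k / 3) ^ (-τ) ≤ B ^ e k := by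
  have hB0 : 0 < B := by linarith
  filter_upwards [h.eventually_ge_atTop (τ * Real.logb B 3)] with k hk
  have h3 : (3 : ℝ) = B ^ Real.logb B 3 := (Real.rpow_logb hB0 hB.ne' (by norm_num)).symm
  rw [inv_pow, ← Real.rpow_natCast, ← Real.rpow_neg hB0.le, h3, ← Real.rpow_sub hB0,
    ← Real.rpow_mul hB0.le]
  refine Real.rpow_le_rpow_of_exponent_le hB.le ?_
  linarith

theorem le_unitDistanceDim_of_separated {α t B : ℝ} (hα : 0 < α) (hα2 : α ≤ 2) (hB : 1 < B)
    {K : Set Plane} (hK : Bornology.IsBounded K) (hhom : IsHomogeneousSet α K) {m : ℕ → ℕ}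
    (hm : Tendsto m atTop atTop) {e : ℕ → ℝ} {ι : Type*} (S : ℕ → Finset ι)
    (P : ℕ → ι → Plane × Plane) (hP : ∀ k, ∀ i ∈ S k, P k i ∈ unitDistancePairs K)
    (hsep : ∀ k, ∀ i ∈ S k, ∀ i' ∈ S k, i ≠ i' → B⁻¹ ^ m k ≤ dist (P k i) (P k i'))
    (hcard : ∀ k, B ^ e k ≤ (S k).card)
    (he : ∀ τ < t, Tendsto (fun k => e k - τ * m k) atTop atTop) :
    (t : EReal) ≤ unitDistanceDim 2 α := by
  classical
  have hB0 : 0 < B⁻¹ := by positivity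
  have hpow (k : ℕ) : 0 < B⁻¹ ^ m k := by positivity
  have hδ : Tendsto (fun k => B⁻¹ ^ m k / 3) atTop (𝓝 0) := by
    simpa using ((tendsto_pow_atTop_nhds_zero_of_lt_one hB0.le
      (inv_lt_one_of_one_lt₀ hB)).comp hm).div_const 3
  have hinj (k : ℕ) : Set.InjOn (P k) (S k) := fun i hi i' hi' heq => by
    by_contra hne
    have := hsep k i hi i' hi' hne
    rw [heq, dist_self] at this
    linarith [hpow k]
  refine le_unitDistanceDim_of_upperMinkowskiDim hα hα2 hK hhom fun K' hK' =>
    le_upperMinkowskiDim _ hδ (fun k => by linarith [hpow k]) (fun k => (S k).image (P k))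
      (fun k => ?_) (fun k => ?_) fun τ hτ => ?_
  · rw [Finset.coe_image]
    rintro _ ⟨i, hi, rfl⟩
    obtain ⟨h₁, h₂, h⟩ := hP k i hi
    exact ⟨hK' h₁, hK' h₂, h⟩
  · rw [Finset.coe_image]
    rintro _ ⟨i, hi, rfl⟩ _ ⟨i', hi', rfl⟩ hne
    linarith [hsep k i hi i' hi' fun h => hne (h ▸ rfl), hpow k]
  · filter_upwards [eventually_rpow_neg_le_rpow hB (he τ hτ)] with k hk
    rw [Finset.card_image_of_injOn (hinj k)]
    exact hk.trans (hcard k)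

theorem exists_base_digit {a s : ℝ} (hs0 : 0 ≤ s) (hs : s < a) (ha : a ≤ 1) :
    ∃ B D : ℕ, 8 ≤ B ∧ 1 ≤ D ∧ D ≤ B ∧ (D + 1 : ℝ) ≤ (B : ℝ) ^ a ∧ (B : ℝ) ^ s ≤ D := by
  have hlim : Tendsto (fun B : ℕ => (B : ℝ) ^ (a - s)) atTop atTop :=
    (tendsto_rpow_atTop (by linarith)).comp tendsto_natCast_atTop_atTop
  obtain ⟨B, hB3, hB8⟩ := ((hlim.eventually_ge_atTop 3).and (eventually_ge_atTop 8)).exists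
  have hB0 : (0 : ℝ) < B := by positivity
  have hB1 : (1 : ℝ) ≤ B := by exact_mod_cast (by omega : 1 ≤ B)
  have hs1 : 1 ≤ (B : ℝ) ^ s := Real.one_le_rpow hB1 hs0
  have hgap : (B : ℝ) ^ s + 2 ≤ (B : ℝ) ^ a := by
    have hmul : (B : ℝ) ^ a = (B : ℝ) ^ (a - s) * (B : ℝ) ^ s := by
      rw [← Real.rpow_add hB0, sub_add_cancel]
    nlinarith
  obtain ⟨D, hD⟩ : ∃ D, ⌈(B : ℝ) ^ s⌉₊ = D := ⟨_, rfl⟩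
  have hDs : (B : ℝ) ^ s ≤ D := hD ▸ Nat.le_ceil _
  have hDa : (D + 1 : ℝ) ≤ (B : ℝ) ^ a := by
    have := Nat.ceil_lt_add_one (zero_le_one.trans hs1)
    rw [hD] at this
    linarith
  have haB : (B : ℝ) ^ a ≤ B := by
    simpa using Real.rpow_le_rpow_of_exponent_le hB1 ha
  exact ⟨B, D, hB8, by exact_mod_cast hs1.trans hDs, by exact_mod_cast (by linarith : (D : ℝ) ≤ B),
    hDa, hDs⟩

/-- The pair with first point `(a, b)` whose second point lies to the right at unit distance and
height `b + w`. -/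
noncomputable def unitPair (a b w : ℝ) : Plane × Plane :=
  (!₂[a, b], !₂[a + √(1 - w ^ 2), b + w])

section UnitPair

theorem norm_unitPair_sub {a b w : ℝ} (hw : |w| ≤ 1) :
    ‖(unitPair a b w).2 - (unitPair a b w).1‖ = 1 := by
  have : 0 ≤ 1 - w ^ 2 := by nlinarith [abs_le.1 hw]
  rw [EuclideanSpace.norm_eq, Fin.sum_univ_two]
  simp [unitPair, Real.sq_sqrt this]

variable (a b w a' b' w' : ℝ)

theorem abs_abscissa_sub_le_dist_unitPair :
    |a - a'| ≤ dist (unitPair a b w) (unitPair a' b' w') :=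
  (abs_apply_sub_le_dist (unitPair a b w).1 (unitPair a' b' w').1 0).trans (le_max_left _ _)

theorem abs_ordinate_sub_le_dist_unitPair :
    |b - b'| ≤ dist (unitPair a b w) (unitPair a' b' w') :=
  (abs_apply_sub_le_dist (unitPair a b w).1 (unitPair a' b' w').1 1).trans (le_max_left _ _)

theorem abs_ordinate_add_sub_le_dist_unitPair :
    |(b + w) - (b' + w')| ≤ dist (unitPair a b w) (unitPair a' b' w') :=
  (abs_apply_sub_le_dist (unitPair a b w).2 (unitPair a' b' w').2 1).trans (le_max_right _ _)

end UnitPair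

theorem le_abs_cast_mul_sub_cast_mul {u v : ℕ} {x : ℝ} (hx : 0 ≤ x) (h : u ≠ v) :
    x ≤ |(u : ℝ) * x - v * x| := by
  have : (1 : ℝ) ≤ |(u : ℝ) - v| := by
    exact_mod_cast Int.one_le_abs (by omega : (u : ℤ) - v ≠ 0)
  rw [← sub_mul, abs_mul, abs_of_nonneg hx]
  exact le_mul_of_one_le_left hx this

section StripPairs

variable {B D : ℕ}

theorem unitPair_mem_unitDistancePairs_stripSet {n i v v' : ℕ} (hB : 0 < B) (hD : 0 < D)
    (hi : i < B ^ n) (hv : v ∈ digitSet B (fun _ => D) n) (hv' : v' ∈ digitSet B (fun _ => D) n) :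
    unitPair (i * (B : ℝ)⁻¹ ^ n) (v * (B : ℝ)⁻¹ ^ n)
      (v' * (B : ℝ)⁻¹ ^ n - v * (B : ℝ)⁻¹ ^ n) ∈ unitDistancePairs (stripSet B D) := by
  have hi0 : 0 ≤ (i : ℝ) * (B : ℝ)⁻¹ ^ n := by positivity
  have hi1 := cast_mul_inv_pow_lt_one hi
  have hw : |(v' : ℝ) * (B : ℝ)⁻¹ ^ n - v * (B : ℝ)⁻¹ ^ n| ≤ 1 := abs_sub_le_of_nonneg_of_le
    (by positivity) (cast_mul_inv_pow_lt_one (mem_digitSet.1 hv').1).le (by positivity)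
    (cast_mul_inv_pow_lt_one (mem_digitSet.1 hv).1).le
  have hsqrt := Real.sqrt_nonneg (1 - ((v' : ℝ) * (B : ℝ)⁻¹ ^ n - v * (B : ℝ)⁻¹ ^ n) ^ 2)
  have hsqrt1 : √(1 - ((v' : ℝ) * (B : ℝ)⁻¹ ^ n - v * (B : ℝ)⁻¹ ^ n) ^ 2) ≤ 1 := by
    rw [Real.sqrt_le_one]
    linarith [sq_nonneg ((v' : ℝ) * (B : ℝ)⁻¹ ^ n - v * (B : ℝ)⁻¹ ^ n)]
  refine ⟨mem_stripSet_of_mem_digitSet hB hD ⟨hi0, by linarith⟩ hv, ?_, norm_unitPair_sub hw⟩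
  rw [unitPair, add_sub_cancel]
  exact mem_stripSet_of_mem_digitSet hB hD ⟨by linarith, by linarith⟩ hv'

theorem inv_pow_le_dist_unitPair {n : ℕ} {q q' : ℕ × ℕ × ℕ} (h : q ≠ q') :
    (B : ℝ)⁻¹ ^ n ≤ dist
      (unitPair (q.1 * (B : ℝ)⁻¹ ^ n) (q.2.1 * (B : ℝ)⁻¹ ^ n)
        (q.2.2 * (B : ℝ)⁻¹ ^ n - q.2.1 * (B : ℝ)⁻¹ ^ n))
      (unitPair (q'.1 * (B : ℝ)⁻¹ ^ n) (q'.2.1 * (B : ℝ)⁻¹ ^ n)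
        (q'.2.2 * (B : ℝ)⁻¹ ^ n - q'.2.1 * (B : ℝ)⁻¹ ^ n)) := by
  have hx : 0 ≤ (B : ℝ)⁻¹ ^ n := by positivity
  obtain ⟨i, v, v'⟩ := q
  obtain ⟨j, u, u'⟩ := q'
  by_cases hi : i = j
  · by_cases hv : v = u
    · have hv' : v' ≠ u' := fun h' => h (by rw [hi, hv, h'])
      refine (le_abs_cast_mul_sub_cast_mul hx hv').trans ?_
      simpa only [add_sub_cancel] using abs_ordinate_add_sub_le_dist_unitPair
        (i * (B : ℝ)⁻¹ ^ n) (v * (B : ℝ)⁻¹ ^ n) (v' * (B : ℝ)⁻¹ ^ n - v * (B : ℝ)⁻¹ ^ n)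
        (j * (B : ℝ)⁻¹ ^ n) (u * (B : ℝ)⁻¹ ^ n) (u' * (B : ℝ)⁻¹ ^ n - u * (B : ℝ)⁻¹ ^ n)
    · exact (le_abs_cast_mul_sub_cast_mul hx hv).trans (abs_ordinate_sub_le_dist_unitPair ..)
  · exact (le_abs_cast_mul_sub_cast_mul hx hi).trans (abs_abscissa_sub_le_dist_unitPair ..)

theorem rpow_mul_le_card_digitSet {s : ℝ} (hB : 0 < B) (hDB : D ≤ B) (hs : (B : ℝ) ^ s ≤ D)
    (n : ℕ) : (B : ℝ) ^ (s * n) ≤ (digitSet B (fun _ => D) n).card := by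
  rw [Real.rpow_mul_natCast (Nat.cast_nonneg B)]
  have hcard : D ^ n ≤ (digitSet B (fun _ => D) n).card := by
    simpa using prod_le_card_digitSet hB (fun _ => hDB) n
  exact (pow_le_pow_left₀ (by positivity) hs n).trans (by exact_mod_cast hcard)

theorem strip_le_unitDistanceDim {α s : ℝ} (hα : 0 < α) (hα2 : α ≤ 2) (hB : 2 ≤ B)
    (hD : 0 < D) (hDB : D ≤ B) (hBD : (B * D : ℝ) ≤ (B : ℝ) ^ α) (hs : (B : ℝ) ^ s ≤ D) :
    ((1 + 2 * s : ℝ) : EReal) ≤ unitDistanceDim 2 α := by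
  have hB0 : 0 < B := by omega
  have hB0' : (0 : ℝ) < B := by positivity
  refine le_unitDistanceDim_of_separated hα hα2 (by exact_mod_cast hB) (isBounded_stripSet B D)
    (isHomogeneousSet_stripSet hα.le hB hBD) (m := fun n => n) tendsto_id
    (e := fun n => (1 + 2 * s) * n)
    (fun n => Finset.range (B ^ n) ×ˢ digitSet B (fun _ => D) n ×ˢ digitSet B (fun _ => D) n) _
    (fun n q hq => ?_) (fun n q _ q' _ h => inv_pow_le_dist_unitPair h) (fun n => ?_) fun τ hτ => ?_
  · simp only [Finset.mem_product, Finset.mem_range] at hq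
    exact unitPair_mem_unitDistancePairs_stripSet hB0 hD hq.1 hq.2.1 hq.2.2
  · have hcard := rpow_mul_le_card_digitSet hB0 hDB hs n
    calc (B : ℝ) ^ ((1 + 2 * s) * n) = (B : ℝ) ^ n * ((B : ℝ) ^ (s * n) * (B : ℝ) ^ (s * n)) := by
          rw [← Real.rpow_natCast, ← Real.rpow_add hB0', ← Real.rpow_add hB0']
          ring_nf
      _ ≤ (B : ℝ) ^ n *
          ((digitSet B (fun _ => D) n).card * (digitSet B (fun _ => D) n).card) := by gcongr
      _ = _ := by simp
  · simp_rw [← sub_mul]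
    exact tendsto_natCast_atTop_atTop.const_mul_atTop (sub_pos.2 hτ)

end StripPairs

theorem two_mul_sub_one_le_unitDistanceDim {α : ℝ} (hα : 1 < α) (hα2 : α ≤ 2) :
    ((2 * α - 1 : ℝ) : EReal) ≤ unitDistanceDim 2 α := by
  refine EReal.ge_of_forall_gt_iff_ge.1 fun τ hτ => ?_
  replace hτ : τ < 2 * α - 1 := by exact_mod_cast hτ
  obtain ⟨B, D, hB, hD, hDB, hle, hs⟩ := exists_base_digit (a := α - 1) (s := max 0 ((τ - 1) / 2))
    (le_max_left _ _) (max_lt (by linarith) (by linarith)) (by linarith)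
  have hmul : (B : ℝ) ^ α = B * (B : ℝ) ^ (α - 1) := by
    rw [← Real.rpow_one_add' (Nat.cast_nonneg B) (by linarith), add_sub_cancel]
  refine le_trans ?_ (strip_le_unitDistanceDim (by linarith) hα2 (by omega) hD hDB ?_ hs)
  · have := le_max_right 0 ((τ - 1) / 2)
    exact_mod_cast (by linarith : τ ≤ 1 + 2 * max 0 ((τ - 1) / 2))
  · rw [hmul]
    gcongr
    linarith

section Truncation

variable {B L j a b : ℕ}

theorem abs_cast_sub_cast_le_of_div_eq {P : ℕ} (hP : 0 < P) (h : a / P = b / P) :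
    |(a : ℝ) - b| ≤ P := by
  have hle {a b : ℕ} (h : a / P = b / P) : a ≤ b + P := by
    have ha := Nat.div_add_mod a P
    have hb := Nat.div_add_mod b P
    have := Nat.mod_lt a hP
    rw [h] at ha
    omega
  rw [abs_sub_le_iff, sub_le_iff_le_add', sub_le_iff_le_add']
  exact ⟨by exact_mod_cast hle h, by exact_mod_cast hle h.symm⟩

theorem div_eq_div_of_mod_eq {P C : ℕ} (hP : 0 < P) (h : |(a : ℝ) - b| ≤ C * P)
    (hmod : a / P % (C + 1) = b / P % (C + 1)) : a / P = b / P := by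
  have hle {a b : ℕ} (h : (a : ℝ) - b ≤ C * P) : a / P ≤ b / P + C := by
    rw [← Nat.add_mul_div_right b C hP]
    exact Nat.div_le_div_right (by exact_mod_cast sub_le_iff_le_add'.1 h)
  have h₁ := hle (abs_sub_le_iff.1 h).1
  have h₂ := hle (abs_sub_le_iff.1 h).2
  exact Nat.ModEq.eq_of_abs_lt hmod (abs_sub_lt_iff.2 ⟨by omega, by omega⟩)

theorem pow_sub_mul_inv_pow (hB : 0 < B) (hj : j ≤ L) :
    (B : ℝ) ^ (L - j) * (B : ℝ)⁻¹ ^ L = (B : ℝ)⁻¹ ^ j := by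
  obtain ⟨m, rfl⟩ := Nat.exists_eq_add_of_le hj
  have hB0 : (B : ℝ) ≠ 0 := by positivity
  rw [Nat.add_sub_cancel_left, pow_add, mul_left_comm, ← mul_pow, mul_inv_cancel₀ hB0, one_pow,
    mul_one]

theorem inv_pow_le_pow_sub_mul_inv_pow (hB : 0 < B) (L j : ℕ) :
    (B : ℝ)⁻¹ ^ j ≤ (B : ℝ) ^ (L - j) * (B : ℝ)⁻¹ ^ L := by
  rcases le_total j L with hj | hj
  · exact (pow_sub_mul_inv_pow hB hj).ge
  · rw [Nat.sub_eq_zero_of_le hj, pow_zero, one_mul]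
    exact pow_le_pow_of_le_one (by positivity) (Nat.cast_inv_le_one B) hj

theorem abs_sub_mul_inv_pow_le (hB : 0 < B) (h : a / B ^ (L - j) = b / B ^ (L - j)) :
    |(a : ℝ) - b| * (B : ℝ)⁻¹ ^ L ≤ (B : ℝ)⁻¹ ^ j := by
  rcases le_total j L with hj | hj
  · rw [← pow_sub_mul_inv_pow hB hj]
    gcongr
    exact_mod_cast abs_cast_sub_cast_le_of_div_eq (pow_pos hB _) h
  · rw [Nat.sub_eq_zero_of_le hj, pow_zero, Nat.div_one, Nat.div_one] at h
    rw [h, sub_self, abs_zero, zero_mul]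
    positivity

theorem div_pow_sub_succ_eq (h : a / B ^ (L - j) = b / B ^ (L - j))
    (hd : j < L → a / B ^ (L - (j + 1)) % B = b / B ^ (L - (j + 1)) % B) :
    a / B ^ (L - (j + 1)) = b / B ^ (L - (j + 1)) := by
  rcases lt_or_ge j L with hj | hj
  · have e : L - j = (L - (j + 1)) + 1 := by omega
    rw [e, pow_succ, ← Nat.div_div_eq_div_mul, ← Nat.div_div_eq_div_mul] at h
    rw [← Nat.div_add_mod (a / B ^ (L - (j + 1))) B, h, hd hj, Nat.div_add_mod]
  · rwa [Nat.sub_eq_zero_of_le hj, ← Nat.sub_eq_zero_of_le (hj.trans j.le_succ)] at h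

end Truncation

/-- The number of base-`B` digits of the fine part of the `k`-th block. -/
def fineLength (k : ℕ) : ℕ := (k + 1) ^ 2 + k

/-- The number of base-`B` digits of the coordinates in the `k`-th block. -/
def blockLength (k : ℕ) : ℕ := fineLength k + (k + 1) ^ 2

/-- The coordinates in the `k`-th block are, up to the horizontal perturbation, multiples of
`B ^ (-blockScale k)`. -/
def blockScale (k : ℕ) : ℕ := 2 * fineLength k

theorem blockLength_add (k : ℕ) : blockLength k + k = blockScale k := by
  simp only [blockLength, blockScale, fineLength]
  ring

theorem le_blockScale (k : ℕ) : k ≤ blockScale k := by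
  have := blockLength_add k
  omega

/-- The numbers with as many base-`B` digits as a coordinate of the `k`-th block, the fine digits
being below `D` and the coarse ones below `E`. -/
def splitDigitSet (B k D E : ℕ) : Finset ℕ :=
  digitSet B (fun i => if i < fineLength k then D else E) (blockLength k)

section SplitDigitSet

variable {B D E k u : ℕ}

theorem lt_pow_of_mem_splitDigitSet (hu : u ∈ splitDigitSet B k D E) : u < B ^ blockLength k :=
  (mem_digitSet.1 hu).1

theorem mul_inv_pow_le_of_mem_splitDigitSet (hB : 0 < B) (hu : u ∈ splitDigitSet B k D E) :
    u * (B : ℝ)⁻¹ ^ blockScale k ≤ (B : ℝ)⁻¹ ^ k := by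
  rw [← blockLength_add, pow_add, ← mul_assoc]
  exact mul_le_of_le_one_left (by positivity)
    (cast_mul_inv_pow_lt_one (lt_pow_of_mem_splitDigitSet hu)).le

theorem fine_digit_lt (hu : u ∈ splitDigitSet B k D E) {i : ℕ} (hi : i < fineLength k) :
    u / B ^ i % B < D := by
  have := (mem_digitSet.1 hu).2 i (hi.trans_le (Nat.le_add_right _ _))
  rwa [if_pos hi] at this

theorem coarse_digit_lt (hB : 0 < B) (hE : 0 < E) (hu : u ∈ splitDigitSet B k D E) {i : ℕ}
    (hi : fineLength k ≤ i) : u / B ^ i % B < E := by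
  rcases lt_or_ge i (blockLength k) with h | h
  · have := (mem_digitSet.1 hu).2 i h
    rwa [if_neg hi.not_gt] at this
  · rwa [Nat.div_eq_of_lt ((lt_pow_of_mem_splitDigitSet hu).trans_le (Nat.pow_le_pow_right hB h)),
      Nat.zero_mod]

theorem div_mul_pow_add_mem_splitDigitSet {z : ℕ} (hB : 0 < B) (hu : u ∈ splitDigitSet B k D E)
    (hz : z ∈ digitSet B (fun _ => D) (fineLength k)) :
    u / B ^ fineLength k * B ^ fineLength k + z ∈ splitDigitSet B k D E := by
  rw [splitDigitSet, mem_digitSet] at hu ⊢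
  rw [mem_digitSet] at hz
  have hpos : 0 < B ^ fineLength k := pow_pos hB _
  have hdiv : (u / B ^ fineLength k * B ^ fineLength k + z) / B ^ fineLength k =
      u / B ^ fineLength k := by
    rw [mul_comm, Nat.mul_add_div hpos, Nat.div_eq_of_lt hz.1, add_zero]
  refine ⟨?_, fun i hi => ?_⟩
  · rw [blockLength, add_comm (fineLength k), pow_add] at hu ⊢
    rw [← Nat.div_lt_iff_lt_mul hpos, hdiv, Nat.div_lt_iff_lt_mul hpos]
    exact hu.1
  · by_cases hc : i < fineLength k
    · rw [if_pos hc, mul_pow_add_digit_eq hB hc]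
      exact hz.2 i hc
    · have := hu.2 i hi
      obtain ⟨m, rfl⟩ := Nat.exists_eq_add_of_le (not_lt.1 hc)
      rw [pow_add, ← Nat.div_div_eq_div_mul] at this ⊢
      rwa [hdiv]

theorem pow_mul_pow_le_card_splitDigitSet (hB : 0 < B) (hD : D ≤ B) (hE : E ≤ B) (k : ℕ) :
    D ^ fineLength k * E ^ (k + 1) ^ 2 ≤ (splitDigitSet B k D E).card := by
  calc D ^ fineLength k * E ^ (k + 1) ^ 2
      = ∏ i ∈ Finset.range (blockLength k), if i < fineLength k then D else E := by
        rw [blockLength, Finset.prod_range_add,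
          Finset.prod_congr rfl fun i hi => if_pos (Finset.mem_range.1 hi)]
        simp
    _ ≤ _ := prod_le_card_digitSet hB (fun i => by split_ifs <;> assumption) (blockLength k)

end SplitDigitSet

/-- An index of a point of the block construction: the number `k` of the block, the base-`B`
expansions `u` and `v` of the abscissa and the ordinate, and a parameter `z` of the horizontal
perturbation. -/
structure BlockIndex where
  /-- The number of the block. -/
  k : ℕ
  /-- The abscissa in units of `B ^ (-blockScale k)`. -/
  u : ℕ
  /-- The ordinate in units of `B ^ (-blockScale k)`. -/
  v : ℕ
  /-- The parameter of the perturbation. -/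
  z : ℕ

/-- The indices whose fine digits of `u` and coarse digits of `v` are below `D₂`, while the coarse
digits of `u`, the fine digits of `v` and the digits of `z` are below `D₁`. -/
def blockIndexSet (B D₁ D₂ : ℕ) : Set BlockIndex :=
  {q | q.u ∈ splitDigitSet B q.k D₂ D₁ ∧ q.v ∈ splitDigitSet B q.k D₁ D₂ ∧
    q.z ∈ digitSet B (fun _ => D₁) (fineLength q.k)}

/-- The cell of generation `j` containing a point of the block construction, within its block. -/
def blockCell (B j : ℕ) (q : BlockIndex) : ℕ × ℕ × ℕ :=
  (q.u / B ^ (blockScale q.k - j), q.v / B ^ (blockScale q.k - j),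
    q.z / B ^ (blockScale q.k + fineLength q.k - j))

/-- The cell of generation `j` containing a point of the block construction. The blocks of diameter
at most about `B ^ (-j)` are all in one cell, labelled `none`. -/
def blockLabel (B j : ℕ) (q : BlockIndex) : Option (ℕ × ℕ × ℕ × ℕ) :=
  if j ≤ q.k then none else some (q.k, blockCell B j q)

theorem blockLabel_of_le {B j : ℕ} {q : BlockIndex} (h : j ≤ q.k) : blockLabel B j q = none :=
  if_pos h

theorem blockLabel_of_lt {B j : ℕ} {q : BlockIndex} (h : q.k < j) :
    blockLabel B j q = some (q.k, blockCell B j q) :=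
  if_neg h.not_ge

section BlockLabel

variable {B D₁ D₂ : ℕ} {q q' : BlockIndex}

theorem z_div_eq_zero (hB : 0 < B) (hq : q ∈ blockIndexSet B D₁ D₂) {j : ℕ}
    (hj : j ≤ blockScale q.k) : q.z / B ^ (blockScale q.k + fineLength q.k - j) = 0 :=
  Nat.div_eq_of_lt ((mem_digitSet.1 hq.2.2).1.trans_le (Nat.pow_le_pow_right hB (by omega)))

theorem blockCell_self (hB : 0 < B) (hq : q ∈ blockIndexSet B D₁ D₂) :
    blockCell B q.k q = (0, 0, 0) := by
  have e : blockScale q.k - q.k = blockLength q.k := by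
    have := blockLength_add q.k
    omega
  rw [blockCell, z_div_eq_zero hB hq (le_blockScale _), e,
    Nat.div_eq_of_lt (lt_pow_of_mem_splitDigitSet hq.1),
    Nat.div_eq_of_lt (lt_pow_of_mem_splitDigitSet hq.2.1)]

theorem blockCell_succ_eq_of_lt (hB : 0 < B) (hq : q ∈ blockIndexSet B D₁ D₂)
    (hq' : q' ∈ blockIndexSet B D₁ D₂) {j : ℕ} (hk : q.k = q'.k) (hj : j < blockScale q.k)
    (h : blockCell B j q = blockCell B j q')
    (hu : q.u / B ^ (blockScale q.k - (j + 1)) % B = q'.u / B ^ (blockScale q.k - (j + 1)) % B)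
    (hv : q.v / B ^ (blockScale q.k - (j + 1)) % B = q'.v / B ^ (blockScale q.k - (j + 1)) % B) :
    blockCell B (j + 1) q = blockCell B (j + 1) q' := by
  have hz := z_div_eq_zero hB hq (j := j + 1) hj
  have hz' := z_div_eq_zero hB hq' (j := j + 1) (hk ▸ hj)
  simp only [blockCell, ← hk, Prod.mk.injEq] at h hz' ⊢
  exact ⟨div_pow_sub_succ_eq h.1 fun _ => hu, div_pow_sub_succ_eq h.2.1 fun _ => hv,
    hz.trans hz'.symm⟩

theorem blockCell_succ_eq_of_le {j : ℕ} (hk : q.k = q'.k) (hj : blockScale q.k ≤ j)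
    (h : blockCell B j q = blockCell B j q')
    (hz : q.z / B ^ (blockScale q.k + fineLength q.k - (j + 1)) % B =
      q'.z / B ^ (blockScale q.k + fineLength q.k - (j + 1)) % B) :
    blockCell B (j + 1) q = blockCell B (j + 1) q' := by
  simp only [blockCell, ← hk, Prod.mk.injEq] at h ⊢
  exact ⟨div_pow_sub_succ_eq h.1 fun hlt => absurd hlt hj.not_gt,
    div_pow_sub_succ_eq h.2.1 fun hlt => absurd hlt hj.not_gt,
    div_pow_sub_succ_eq h.2.2 fun _ => hz⟩

theorem encard_image_blockCell_succ_le (hB : 0 < B) (h₁ : 0 < D₁) (h₂ : 0 < D₂) (k j : ℕ)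
    (c : ℕ × ℕ × ℕ) :
    (blockCell B (j + 1) ''
      {q | q ∈ blockIndexSet B D₁ D₂ ∧ q.k = k ∧ blockCell B j q = c}).encard ≤
        (D₁ * D₂ : ℕ) := by
  let i := blockScale k - (j + 1)
  rcases lt_or_ge j (blockScale k) with hj | hj
  · have hpair {D E : ℕ} (h : ∀ q ∈ blockIndexSet B D₁ D₂, q.k = k →
        q.u / B ^ i % B < D ∧ q.v / B ^ i % B < E) : (blockCell B (j + 1) ''
        {q | q ∈ blockIndexSet B D₁ D₂ ∧ q.k = k ∧ blockCell B j q = c}).encard ≤ (D * E : ℕ) := by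
      rw [← Finset.card_range D, ← Finset.card_range E, ← Finset.card_product]
      refine encard_image_le_card_of_code _ (fun q => (q.u / B ^ i % B, q.v / B ^ i % B)) ?_ ?_
      · rintro q ⟨hq, hk, -⟩
        exact Finset.mk_mem_product (Finset.mem_range.2 (h q hq hk).1)
          (Finset.mem_range.2 (h q hq hk).2)
      · rintro q ⟨hq, rfl, hc⟩ q' ⟨hq', hk, hc'⟩ hcode
        exact blockCell_succ_eq_of_lt hB hq hq' hk.symm hj (hc.trans hc'.symm)
          (Prod.mk.inj hcode).1 (Prod.mk.inj hcode).2
    rcases lt_or_ge i (fineLength k) with hi | hi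
    · rw [mul_comm]
      refine hpair ?_
      rintro q hq rfl
      exact ⟨fine_digit_lt hq.1 hi, fine_digit_lt hq.2.1 hi⟩
    · refine hpair ?_
      rintro q hq rfl
      exact ⟨coarse_digit_lt hB h₁ hq.1 hi, coarse_digit_lt hB h₂ hq.2.1 hi⟩
  · refine (encard_image_le_card_of_code (Finset.range D₁)
      (fun q => q.z / B ^ (blockScale k + fineLength k - (j + 1)) % B) ?_ ?_).trans ?_
    · rintro q ⟨hq, rfl, -⟩
      exact Finset.mem_range.2 (digit_lt_of_mem_digitSet hB (fun _ => h₁) hq.2.2 _)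
    · rintro q ⟨-, rfl, hc⟩ q' ⟨-, hk, hc'⟩ h
      exact blockCell_succ_eq_of_le hk.symm hj (hc.trans hc'.symm) h
    · rw [Finset.card_range]
      exact_mod_cast Nat.le_mul_of_pos_right D₁ h₂

theorem encard_image_blockLabel_succ_le (hB : 0 < B) (h₁ : 0 < D₁) (h₂ : 0 < D₂) (j : ℕ)
    (t : Option (ℕ × ℕ × ℕ × ℕ)) :
    (blockLabel B (j + 1) '' {q | q ∈ blockIndexSet B D₁ D₂ ∧ blockLabel B j q = t}).encard ≤
      (D₁ * D₂ + 1 : ℕ) := by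
  have hmain (k : ℕ) (c : ℕ × ℕ × ℕ) :
      (insert none ((fun c => some (k, c)) '' (blockCell B (j + 1) ''
        {q | q ∈ blockIndexSet B D₁ D₂ ∧ q.k = k ∧ blockCell B j q = c}))).encard ≤
          (D₁ * D₂ + 1 : ℕ) := by
    refine (Set.encard_insert_le _ _).trans ?_
    rw [Nat.cast_add, Nat.cast_one]
    gcongr
    exact (Set.encard_image_le _ _).trans (encard_image_blockCell_succ_le hB h₁ h₂ k j c)
  rcases t with - | ⟨k, c⟩
  · refine (Set.encard_le_encard ?_).trans (hmain j (0, 0, 0))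
    rintro _ ⟨q, ⟨hq, ht⟩, rfl⟩
    have hle : j ≤ q.k := not_lt.1 fun hlt => by simp [blockLabel_of_lt hlt] at ht
    rcases hle.eq_or_lt with rfl | hlt
    · rw [blockLabel_of_lt (Nat.lt_succ_self _)]
      exact Or.inr ⟨_, ⟨q, ⟨hq, rfl, blockCell_self hB hq⟩, rfl⟩, rfl⟩
    · exact Or.inl (blockLabel_of_le hlt)
  · refine (Set.encard_le_encard ?_).trans (hmain k c)
    rintro _ ⟨q, ⟨hq, ht⟩, rfl⟩
    have hlt : q.k < j := not_le.1 fun hle => by simp [blockLabel_of_le hle] at ht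
    rw [blockLabel_of_lt hlt, Option.some.injEq, Prod.mk.injEq] at ht
    obtain ⟨rfl, rfl⟩ := ht
    rw [blockLabel_of_lt (hlt.trans j.lt_succ_self)]
    exact Or.inr ⟨_, ⟨q, ⟨hq, rfl, rfl⟩, rfl⟩, rfl⟩

end BlockLabel

/-- A union of finite blocks of points, the `k`-th one at distance about `B ^ (-k)` from the point
`(e, 0)`: points with restricted digits, raised by `o k` and perturbed horizontally by `g`. -/
noncomputable def blockPoint (B : ℕ) (e : ℝ) (o : ℕ → ℝ) (g : BlockIndex → ℝ) (q : BlockIndex) :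
    Plane :=
  !₂[e + q.u * (B : ℝ)⁻¹ ^ blockScale q.k + g q, o q.k + q.v * (B : ℝ)⁻¹ ^ blockScale q.k]

/-- Conditions on the offsets `o` and the perturbation `g` under which `blockPoint` maps the set `J`
of indices onto a homogeneous set. The perturbation resolves the parameter `z` at the scale
`B ^ (-(blockScale k + fineLength k))`. -/
structure BlockData (B D₁ D₂ : ℕ) (o : ℕ → ℝ) (g : BlockIndex → ℝ) (J : Set BlockIndex) : Prop where
  subset : J ⊆ blockIndexSet B D₁ D₂
  le_offset : ∀ k, 2 * (B : ℝ)⁻¹ ^ k ≤ o k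
  offset_le : ∀ k, o k ≤ 4 * (B : ℝ)⁻¹ ^ k
  abs_shift_le : ∀ q ∈ J, |g q| ≤ 9 * (B : ℝ)⁻¹ ^ blockScale q.k
  abs_shift_sub_le : ∀ q ∈ J, ∀ q' ∈ J, q.k = q'.k → q.v = q'.v →
    |g q - g q'| ≤ 6 * (|(q.z : ℝ) - q'.z| * (B : ℝ)⁻¹ ^ (blockScale q.k + fineLength q.k))
  le_abs_shift_sub : ∀ q ∈ J, ∀ q' ∈ J, q.k = q'.k → q.v = q'.v →
    |(q.z : ℝ) - q'.z| * (B : ℝ)⁻¹ ^ (blockScale q.k + fineLength q.k) ≤ |g q - g q'|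

namespace BlockData

variable {B D₁ D₂ : ℕ} {e : ℝ} {o : ℕ → ℝ} {g : BlockIndex → ℝ} {J : Set BlockIndex}
  {q q' : BlockIndex} {j : ℕ}

theorem dist_center_le (hB : 0 < B) (hd : BlockData B D₁ D₂ o g J) (hq : q ∈ J) :
    dist (blockPoint B e o g q) !₂[e, 0] ≤ 15 * (B : ℝ)⁻¹ ^ q.k := by
  have hu := mul_inv_pow_le_of_mem_splitDigitSet hB (hd.subset hq).1
  have hv := mul_inv_pow_le_of_mem_splitDigitSet hB (hd.subset hq).2.1
  have hu0 : 0 ≤ q.u * (B : ℝ)⁻¹ ^ blockScale q.k := by positivity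
  have hv0 : 0 ≤ q.v * (B : ℝ)⁻¹ ^ blockScale q.k := by positivity
  have hg := _root_.abs_le.1 (hd.abs_shift_le q hq)
  have hscale : (B : ℝ)⁻¹ ^ blockScale q.k ≤ (B : ℝ)⁻¹ ^ q.k :=
    pow_le_pow_of_le_one (by positivity) (Nat.cast_inv_le_one B) (le_blockScale _)
  have ho := hd.le_offset q.k
  have ho' := hd.offset_le q.k
  refine (Plane.dist_le _ _).trans ?_
  simp only [blockPoint, PiLp.toLp_apply, Matrix.cons_val_zero, Matrix.cons_val_one, sub_zero]
  have hx : |e + q.u * (B : ℝ)⁻¹ ^ blockScale q.k + g q - e| ≤ 10 * (B : ℝ)⁻¹ ^ q.k :=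
    _root_.abs_le.2 ⟨by linarith, by linarith⟩
  have hy : |o q.k + q.v * (B : ℝ)⁻¹ ^ blockScale q.k| ≤ 5 * (B : ℝ)⁻¹ ^ q.k :=
    _root_.abs_le.2 ⟨by linarith, by linarith⟩
  linarith

theorem dist_blockPoint_le (hk : q.k = q'.k) :
    dist (blockPoint B e o g q) (blockPoint B e o g q') ≤
      |(q.u : ℝ) - q'.u| * (B : ℝ)⁻¹ ^ blockScale q.k + |g q - g q'| +
        |(q.v : ℝ) - q'.v| * (B : ℝ)⁻¹ ^ blockScale q.k := by
  have hp : (0 : ℝ) ≤ (B : ℝ)⁻¹ ^ blockScale q.k := by positivity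
  refine (Plane.dist_le _ _).trans ?_
  simp only [blockPoint, PiLp.toLp_apply, Matrix.cons_val_zero, Matrix.cons_val_one, ← hk]
  rw [add_sub_add_left_eq_sub, ← sub_mul, abs_mul, abs_of_nonneg hp, add_sub_add_comm,
    add_sub_add_left_eq_sub, ← sub_mul]
  gcongr
  refine (abs_add_le _ _).trans_eq ?_
  rw [abs_mul, abs_of_nonneg hp]

theorem abs_ordinate_sub_le (hk : q.k = q'.k) :
    |(q.v : ℝ) - q'.v| * (B : ℝ)⁻¹ ^ blockScale q.k ≤
      dist (blockPoint B e o g q) (blockPoint B e o g q') := by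
  refine le_trans (le_of_eq ?_) (abs_apply_sub_le_dist _ _ 1)
  simp only [blockPoint, PiLp.toLp_apply, Matrix.cons_val_one, Matrix.cons_val_zero, ← hk]
  rw [add_sub_add_left_eq_sub, ← sub_mul, abs_mul,
    abs_of_nonneg (by positivity : (0 : ℝ) ≤ (B : ℝ)⁻¹ ^ blockScale q.k)]

theorem abs_abscissa_sub_le (hd : BlockData B D₁ D₂ o g J) (hq : q ∈ J) (hq' : q' ∈ J)
    (hk : q.k = q'.k) :
    |(q.u : ℝ) - q'.u| * (B : ℝ)⁻¹ ^ blockScale q.k ≤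
      dist (blockPoint B e o g q) (blockPoint B e o g q') + 18 * (B : ℝ)⁻¹ ^ blockScale q.k := by
  have hg := _root_.abs_le.1 (hd.abs_shift_le q hq)
  have hg' := _root_.abs_le.1 (hd.abs_shift_le q' hq')
  have hx := _root_.abs_le.1
    (abs_apply_sub_le_dist (blockPoint B e o g q) (blockPoint B e o g q') 0)
  rw [← hk] at hg'
  simp only [blockPoint, PiLp.toLp_apply, Matrix.cons_val_zero, ← hk] at hx ⊢
  rw [← abs_of_nonneg (by positivity : (0 : ℝ) ≤ (B : ℝ)⁻¹ ^ blockScale q.k), ← abs_mul, sub_mul,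
    abs_of_nonneg (by positivity : (0 : ℝ) ≤ (B : ℝ)⁻¹ ^ blockScale q.k)]
  exact _root_.abs_le.2 ⟨by linarith, by linarith⟩

theorem abs_param_sub_le (hd : BlockData B D₁ D₂ o g J) (hq : q ∈ J) (hq' : q' ∈ J)
    (hk : q.k = q'.k) (hu : q.u = q'.u) (hv : q.v = q'.v) :
    |(q.z : ℝ) - q'.z| * (B : ℝ)⁻¹ ^ (blockScale q.k + fineLength q.k) ≤
      dist (blockPoint B e o g q) (blockPoint B e o g q') := by
  refine (hd.le_abs_shift_sub q hq q' hq' hk hv).trans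
    (le_trans (le_of_eq ?_) (abs_apply_sub_le_dist _ _ 0))
  simp only [blockPoint, PiLp.toLp_apply, Matrix.cons_val_zero, ← hk, hu]
  rw [add_sub_add_left_eq_sub]

theorem abs_shift_sub_le_of_blockCell_eq (hB : 0 < B) (hd : BlockData B D₁ D₂ o g J) (hq : q ∈ J)
    (hq' : q' ∈ J) (hk : q.k = q'.k) (h : blockCell B j q = blockCell B j q') :
    |g q - g q'| ≤ 18 * (B : ℝ)⁻¹ ^ j := by
  rcases le_or_gt j (blockScale q.k) with hj | hj
  · have hg := hd.abs_shift_le q hq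
    have hg' := hd.abs_shift_le q' hq'
    rw [← hk] at hg'
    have : (B : ℝ)⁻¹ ^ blockScale q.k ≤ (B : ℝ)⁻¹ ^ j :=
      pow_le_pow_of_le_one (by positivity) (Nat.cast_inv_le_one B) hj
    exact (abs_sub _ _).trans (by linarith)
  · simp only [blockCell, ← hk, Nat.sub_eq_zero_of_le hj.le, pow_zero, Nat.div_one,
      Prod.mk.injEq] at h
    have hz := abs_sub_mul_inv_pow_le hB h.2.2
    have : (0 : ℝ) ≤ (B : ℝ)⁻¹ ^ j := by positivity
    exact (hd.abs_shift_sub_le q hq q' hq' hk h.2.1).trans (by linarith)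

theorem dist_le (hB : 0 < B) (hd : BlockData B D₁ D₂ o g J) (hq : q ∈ J) (hq' : q' ∈ J)
    (h : blockLabel B j q = blockLabel B j q') :
    dist (blockPoint B e o g q) (blockPoint B e o g q') ≤ 30 * (B : ℝ)⁻¹ ^ j := by
  rcases le_or_gt j q.k with hj | hj
  · have hj' : j ≤ q'.k := not_lt.1 fun hlt => by
      simp [blockLabel_of_le hj, blockLabel_of_lt hlt] at h
    have hanti {k : ℕ} (hk : j ≤ k) : (B : ℝ)⁻¹ ^ k ≤ (B : ℝ)⁻¹ ^ j :=
      pow_le_pow_of_le_one (by positivity) (Nat.cast_inv_le_one B) hk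
    refine (dist_triangle_right _ _ !₂[e, 0]).trans ?_
    linarith [hd.dist_center_le (e := e) hB hq, hd.dist_center_le (e := e) hB hq', hanti hj,
      hanti hj']
  · have hj' : q'.k < j := not_le.1 fun hle => by
      simp [blockLabel_of_lt hj, blockLabel_of_le hle] at h
    rw [blockLabel_of_lt hj, blockLabel_of_lt hj', Option.some.injEq, Prod.mk.injEq] at h
    obtain ⟨hk, hcell⟩ := h
    have hg := hd.abs_shift_sub_le_of_blockCell_eq hB hq hq' hk hcell
    simp only [blockCell, ← hk, Prod.mk.injEq] at hcell
    have hu := abs_sub_mul_inv_pow_le hB hcell.1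
    have hv := abs_sub_mul_inv_pow_le hB hcell.2.1
    have : (0 : ℝ) ≤ (B : ℝ)⁻¹ ^ j := by positivity
    linarith [dist_blockPoint_le (B := B) (e := e) (o := o) (g := g) hk]

theorem k_eq_of_dist_lt (hB : 8 ≤ B) (hd : BlockData B D₁ D₂ o g J) (hq : q ∈ J) (hq' : q' ∈ J)
    (hj : q.k < j) (hj' : q'.k < j)
    (h : dist (blockPoint B e o g q) (blockPoint B e o g q') < 2 * (B : ℝ)⁻¹ ^ j) :
    q.k = q'.k := by
  wlog hlt : q.k < q'.k generalizing q q'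
  · rcases eq_or_lt_of_le (not_lt.1 hlt) with h' | h'
    · exact h'.symm
    · exact (this hq' hq hj' hj (by rwa [dist_comm]) h').symm
  exfalso
  have hl8 : (B : ℝ)⁻¹ ≤ 1 / 8 := by
    rw [one_div]
    exact inv_anti₀ (by norm_num) (by exact_mod_cast hB)
  have hstep {a b : ℕ} (hab : a < b) : (B : ℝ)⁻¹ ^ b ≤ (1 / 8) * (B : ℝ)⁻¹ ^ a :=
    calc (B : ℝ)⁻¹ ^ b ≤ (B : ℝ)⁻¹ ^ (a + 1) :=
          pow_le_pow_of_le_one (by positivity) (by linarith) hab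
      _ = (B : ℝ)⁻¹ * (B : ℝ)⁻¹ ^ a := pow_succ' _ _
      _ ≤ _ := by gcongr
  have hv' := mul_inv_pow_le_of_mem_splitDigitSet (by omega) (hd.subset hq').2.1
  have hv0 : (0 : ℝ) ≤ q.v * (B : ℝ)⁻¹ ^ blockScale q.k := by positivity
  have hy := (abs_apply_sub_le_dist (blockPoint B e o g q) (blockPoint B e o g q') 1).trans_lt h
  simp only [blockPoint, PiLp.toLp_apply, Matrix.cons_val_one, Matrix.cons_val_zero] at hy
  have : 0 < (B : ℝ)⁻¹ ^ q.k := by positivity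
  linarith [(abs_lt.1 hy).2, hd.le_offset q.k, hd.offset_le q'.k, hstep hlt, hstep hj]

theorem blockCell_eq_of_dist_lt (hB : 0 < B) (hd : BlockData B D₁ D₂ o g J) (hq : q ∈ J)
    (hq' : q' ∈ J) (hk : q.k = q'.k)
    (h : dist (blockPoint B e o g q) (blockPoint B e o g q') < 2 * (B : ℝ)⁻¹ ^ j)
    (hu : (blockCell B j q).1 % (20 + 1) = (blockCell B j q').1 % (20 + 1))
    (hv : (blockCell B j q).2.1 % (2 + 1) = (blockCell B j q').2.1 % (2 + 1))
    (hz : (blockCell B j q).2.2 % (2 + 1) = (blockCell B j q').2.2 % (2 + 1)) :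
    blockCell B j q = blockCell B j q' := by
  have hpos {n : ℕ} : (0 : ℝ) < (B : ℝ)⁻¹ ^ n := by positivity
  have hj (L : ℕ) := inv_pow_le_pow_sub_mul_inv_pow hB L j
  have hone : (B : ℝ)⁻¹ ^ blockScale q.k ≤
      (B : ℝ) ^ (blockScale q.k - j) * (B : ℝ)⁻¹ ^ blockScale q.k :=
    le_mul_of_one_le_left hpos.le (one_le_pow₀ (by exact_mod_cast hB))
  simp only [blockCell, ← hk, Prod.mk.injEq] at hu hv hz ⊢
  have hu' := div_eq_div_of_mod_eq (pow_pos hB _) (C := 20)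
    (le_of_mul_le_mul_right (a := (B : ℝ)⁻¹ ^ blockScale q.k) (by
      push_cast
      linarith [hd.abs_abscissa_sub_le (e := e) hq hq' hk, hj (blockScale q.k)]) hpos) hu
  have hv' := div_eq_div_of_mod_eq (pow_pos hB _) (C := 2)
    (le_of_mul_le_mul_right (a := (B : ℝ)⁻¹ ^ blockScale q.k) (by
      push_cast
      linarith [abs_ordinate_sub_le (B := B) (e := e) (o := o) (g := g) hk, hj (blockScale q.k)])
      hpos) hv
  refine ⟨hu', hv', ?_⟩
  rcases le_or_gt j (blockScale q.k) with hL | hL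
  · have hz' := z_div_eq_zero hB (hd.subset hq') (hk ▸ hL)
    rw [← hk] at hz'
    rw [z_div_eq_zero hB (hd.subset hq) hL, hz']
  · rw [Nat.sub_eq_zero_of_le hL.le, pow_zero, Nat.div_one, Nat.div_one] at hu' hv'
    refine div_eq_div_of_mod_eq (pow_pos hB _) (C := 2) (le_of_mul_le_mul_right
      (a := (B : ℝ)⁻¹ ^ (blockScale q.k + fineLength q.k)) ?_ hpos) hz
    push_cast
    linarith [hd.abs_param_sub_le (e := e) hq hq' hk hu' hv', hj (blockScale q.k + fineLength q.k)]

theorem encard_image_blockLabel_le_of_dist_lt (hB : 8 ≤ B) (hd : BlockData B D₁ D₂ o g J)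
    {A : Set BlockIndex} (hA : A ⊆ J) (h : ∀ q ∈ A, ∀ q' ∈ A,
      dist (blockPoint B e o g q) (blockPoint B e o g q') < 2 * (B : ℝ)⁻¹ ^ j) :
    (blockLabel B j '' A).encard ≤ (190 : ℕ) := by
  let reduce (t : ℕ × ℕ × ℕ × ℕ) : ℕ × ℕ × ℕ :=
    (t.2.1 % (20 + 1), t.2.2.1 % (2 + 1), t.2.2.2 % (2 + 1))
  let S := Finset.insertNone (Finset.range (20 + 1) ×ˢ Finset.range (2 + 1) ×ˢ Finset.range (2 + 1))
  refine encard_image_le_card_of_code S (fun q => (blockLabel B j q).map reduce)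
    (fun q _ => ?_) fun q hq q' hq' hcode => ?_
  · refine Finset.mem_insertNone.2 fun d hmem => ?_
    obtain ⟨t, -, rfl⟩ := Option.mem_map.1 hmem
    simp [reduce, Nat.mod_lt]
  rcases le_or_gt j q.k with hj | hj <;> rcases le_or_gt j q'.k with hj' | hj'
  · rw [blockLabel_of_le hj, blockLabel_of_le hj']
  · simp [blockLabel_of_le hj, blockLabel_of_lt hj'] at hcode
  · simp [blockLabel_of_lt hj, blockLabel_of_le hj'] at hcode
  · have hdist := h q hq q' hq'
    have hk := hd.k_eq_of_dist_lt hB (hA hq) (hA hq') hj hj' hdist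
    simp only [blockLabel_of_lt hj, blockLabel_of_lt hj', Option.map_some, Option.some.injEq,
      Prod.mk.injEq, reduce] at hcode ⊢
    exact ⟨hk, hd.blockCell_eq_of_dist_lt (by omega) (hA hq) (hA hq') hk hdist
      hcode.1 hcode.2.1 hcode.2.2⟩

theorem isHomogeneousSet {α : ℝ} (hα : 0 ≤ α) (hB : 8 ≤ B) (h₁ : 0 < D₁) (h₂ : 0 < D₂)
    (hD : (D₁ * D₂ + 1 : ℝ) ≤ (B : ℝ) ^ α) (hd : BlockData B D₁ D₂ o g J) :
    IsHomogeneousSet α (blockPoint B e o g '' J) := by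
  have hB0 : 0 < B := by omega
  rw [Set.image_eq_range]
  refine isHomogeneousSet_range_of_labels hα (inv_pos.2 (by positivity))
    (inv_lt_one_of_one_lt₀ (by exact_mod_cast (by omega : 1 < B))) (c := 30) (by norm_num) _
    (fun j (i : J) => blockLabel B j i.1) (N₀ := 190) (N := D₁ * D₂ + 1)
    (fun j i i' => hd.dist_le hB0 i.2 i'.2) ?_ (fun j x => ?_) (fun j t => ?_) ?_
  · refine (Set.encard_le_encard (t := {none}) ?_).trans (by simp)
    rintro _ ⟨i, rfl⟩
    exact blockLabel_of_le (Nat.zero_le _)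
  · rw [← Set.image_image (blockLabel B j) Subtype.val]
    refine hd.encard_image_blockLabel_le_of_dist_lt (e := e) hB (Subtype.coe_image_subset _ _) ?_
    rintro _ ⟨i, hi, rfl⟩ _ ⟨i', hi', rfl⟩
    rw [two_mul]
    exact (dist_triangle_right _ _ x).trans_lt (add_lt_add hi hi')
  · rw [← Set.image_image (blockLabel B (j + 1)) Subtype.val]
    refine (Set.encard_le_encard (Set.image_mono ?_)).trans
      (encard_image_blockLabel_succ_le hB0 h₁ h₂ j t)
    rintro _ ⟨i, hi, rfl⟩
    exact ⟨hd.subset i.2, hi⟩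
  · rw [inv_inv]
    exact_mod_cast hD

theorem isBounded (hB : 0 < B) (hd : BlockData B D₁ D₂ o g J) :
    Bornology.IsBounded (blockPoint B e o g '' J) := by
  refine Metric.isBounded_iff.2 ⟨30 * (B : ℝ)⁻¹ ^ 0, ?_⟩
  rintro _ ⟨q, hq, rfl⟩ _ ⟨q', hq', rfl⟩
  exact hd.dist_le hB hq hq' (by rw [blockLabel_of_le q.k.zero_le, blockLabel_of_le q'.k.zero_le])

end BlockData

/-- The height of the unit vector joining the two points with index `q`, one in the left block and
one in the right block; it lies between `B ^ (-fineLength q.k)` and `3 * B ^ (-fineLength q.k)`. -/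
noncomputable def blockHeight (B : ℕ) (q : BlockIndex) : ℝ :=
  ((q.v % B ^ fineLength q.k : ℕ) - q.z + 2 * (B : ℝ) ^ fineLength q.k) * (B : ℝ)⁻¹ ^ blockScale q.k

/-- The horizontal deviation from `(1, 0)` of the unit vector of height `blockHeight B q`. -/
noncomputable def blockShift (B : ℕ) (q : BlockIndex) : ℝ := √(1 - blockHeight B q ^ 2) - 1

section BlockHeight

variable {B D₁ D₂ : ℕ}

theorem pow_mul_inv_pow_blockScale (hB : 0 < B) (k : ℕ) :
    (B : ℝ) ^ fineLength k * (B : ℝ)⁻¹ ^ blockScale k = (B : ℝ)⁻¹ ^ fineLength k := by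
  have hB0 : (B : ℝ) ≠ 0 := by positivity
  rw [blockScale, two_mul, pow_add, ← mul_assoc, ← mul_pow, mul_inv_cancel₀ hB0, one_pow, one_mul]

theorem blockHeight_mem_Icc (hB : 0 < B) {q : BlockIndex} (hq : q ∈ blockIndexSet B D₁ D₂) :
    blockHeight B q ∈ Set.Icc ((B : ℝ)⁻¹ ^ fineLength q.k) (3 * (B : ℝ)⁻¹ ^ fineLength q.k) := by
  have hv : ((q.v % B ^ fineLength q.k : ℕ) : ℝ) ≤ (B : ℝ) ^ fineLength q.k := by
    exact_mod_cast (Nat.mod_lt q.v (pow_pos hB _)).le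
  have hz : (q.z : ℝ) ≤ (B : ℝ) ^ fineLength q.k := by exact_mod_cast (mem_digitSet.1 hq.2.2).1.le
  have : (0 : ℝ) ≤ (q.v % B ^ fineLength q.k : ℕ) := Nat.cast_nonneg _
  have : (0 : ℝ) ≤ q.z := Nat.cast_nonneg _
  rw [← pow_mul_inv_pow_blockScale hB, blockHeight, ← mul_assoc]
  constructor <;> gcongr <;> linarith

theorem inv_pow_fineLength_le (hB : 8 ≤ B) (k : ℕ) : (B : ℝ)⁻¹ ^ fineLength k ≤ 1 / 8 := by
  have h8 : (B : ℝ)⁻¹ ≤ 1 / 8 := by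
    rw [one_div]
    exact inv_anti₀ (by norm_num) (by exact_mod_cast hB)
  have hk : fineLength k ≠ 0 := by
    rw [fineLength]
    positivity
  exact (pow_le_of_le_one (by positivity) (by linarith) hk).trans h8

theorem abs_blockHeight_sub {q q' : BlockIndex} (hk : q.k = q'.k) (hv : q.v = q'.v) :
    |blockHeight B q - blockHeight B q'| = |(q.z : ℝ) - q'.z| * (B : ℝ)⁻¹ ^ blockScale q.k := by
  rw [blockHeight, blockHeight, ← hk, ← hv, ← sub_mul, abs_mul,
    abs_of_nonneg (by positivity : (0 : ℝ) ≤ (B : ℝ)⁻¹ ^ blockScale q.k), abs_sub_comm (q.z : ℝ)]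
  congr 2
  ring

theorem abs_sqrt_one_sub_sq_sub_one_le {w : ℝ} (hw : w ^ 2 ≤ 1) : |√(1 - w ^ 2) - 1| ≤ w ^ 2 := by
  have hle : √(1 - w ^ 2) ≤ 1 := by
    rw [Real.sqrt_le_one]
    linarith [sq_nonneg w]
  have hge : 1 - w ^ 2 ≤ √(1 - w ^ 2) :=
    Real.le_sqrt_of_sq_le (by nlinarith [sq_nonneg w])
  rw [abs_of_nonpos (by linarith)]
  linarith

theorem sqrt_one_sub_sq_mem_Icc {w : ℝ} (hw : w ^ 2 ≤ 3 / 4) :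
    √(1 - w ^ 2) ∈ Set.Icc (1 / 2) 1 := by
  refine ⟨Real.le_sqrt_of_sq_le (by linarith), ?_⟩
  rw [Real.sqrt_le_one]
  linarith [sq_nonneg w]

theorem abs_sqrt_sub_sqrt_mul_add {w w' : ℝ} (hw : w ^ 2 ≤ 1) (hw' : w' ^ 2 ≤ 1) :
    |√(1 - w ^ 2) - √(1 - w' ^ 2)| * (√(1 - w ^ 2) + √(1 - w' ^ 2)) = |w - w'| * |w + w'| := by
  have h := Real.sq_sqrt (sub_nonneg.2 hw)
  have h' := Real.sq_sqrt (sub_nonneg.2 hw')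
  rw [← abs_of_nonneg (by positivity : 0 ≤ √(1 - w ^ 2) + √(1 - w' ^ 2)), ← abs_mul, ← abs_mul,
    ← abs_neg]
  congr 1
  linear_combination h' - h

theorem abs_sqrt_sub_sqrt_mem_Icc {m w w' : ℝ} (hm : m ≤ 1 / 8) (hw : w ∈ Set.Icc m (3 * m))
    (hw' : w' ∈ Set.Icc m (3 * m)) :
    |√(1 - w ^ 2) - √(1 - w' ^ 2)| ∈ Set.Icc (|w - w'| * m) (6 * (|w - w'| * m)) := by
  obtain ⟨hw₁, hw₂⟩ := hw
  obtain ⟨hw₁', hw₂'⟩ := hw'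
  have hsq : w ^ 2 ≤ 3 / 4 := by nlinarith
  have hsq' : w' ^ 2 ≤ 3 / 4 := by nlinarith
  obtain ⟨ha, ha'⟩ := sqrt_one_sub_sq_mem_Icc hsq
  obtain ⟨hc, hc'⟩ := sqrt_one_sub_sq_mem_Icc hsq'
  have key := abs_sqrt_sub_sqrt_mul_add (w := w) (w' := w') (by linarith) (by linarith)
  rw [abs_of_nonneg (by linarith : 0 ≤ w + w')] at key
  constructor
  · have hl : |√(1 - w ^ 2) - √(1 - w' ^ 2)| * (√(1 - w ^ 2) + √(1 - w' ^ 2)) ≤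
        |√(1 - w ^ 2) - √(1 - w' ^ 2)| * 2 := by gcongr; linarith
    have hr : |w - w'| * (2 * m) ≤ |w - w'| * (w + w') := by gcongr; linarith
    linarith
  · have hl : |√(1 - w ^ 2) - √(1 - w' ^ 2)| * 1 ≤
        |√(1 - w ^ 2) - √(1 - w' ^ 2)| * (√(1 - w ^ 2) + √(1 - w' ^ 2)) := by gcongr; linarith
    have hr : |w - w'| * (w + w') ≤ |w - w'| * (6 * m) := by gcongr; linarith
    linarith

theorem abs_blockShift_le (hB : 8 ≤ B) {q : BlockIndex} (hq : q ∈ blockIndexSet B D₁ D₂) :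
    |blockShift B q| ≤ 9 * (B : ℝ)⁻¹ ^ blockScale q.k := by
  obtain ⟨hw, hw'⟩ := blockHeight_mem_Icc (by omega) hq
  have hm := inv_pow_fineLength_le hB q.k
  have : (0 : ℝ) ≤ (B : ℝ)⁻¹ ^ fineLength q.k := by positivity
  have hsq : blockHeight B q ^ 2 ≤ 9 * ((B : ℝ)⁻¹ ^ fineLength q.k) ^ 2 := by nlinarith
  rw [blockScale, mul_comm 2, pow_mul]
  exact (abs_sqrt_one_sub_sq_sub_one_le (by nlinarith)).trans hsq

theorem abs_blockShift_sub_mem_Icc (hB : 8 ≤ B) {q q' : BlockIndex}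
    (hq : q ∈ blockIndexSet B D₁ D₂) (hq' : q' ∈ blockIndexSet B D₁ D₂) (hk : q.k = q'.k)
    (hv : q.v = q'.v) :
    |blockShift B q - blockShift B q'| ∈
      Set.Icc (|(q.z : ℝ) - q'.z| * (B : ℝ)⁻¹ ^ (blockScale q.k + fineLength q.k))
        (6 * (|(q.z : ℝ) - q'.z| * (B : ℝ)⁻¹ ^ (blockScale q.k + fineLength q.k))) := by
  have h := abs_sqrt_sub_sqrt_mem_Icc (inv_pow_fineLength_le hB q.k)
    (blockHeight_mem_Icc (by omega) hq) (hk ▸ blockHeight_mem_Icc (by omega) hq')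
  rw [abs_blockHeight_sub hk hv, mul_assoc, ← pow_add] at h
  rwa [blockShift, blockShift, sub_sub_sub_cancel_right]

theorem blockData_left (B D₁ D₂ : ℕ) : BlockData B D₁ D₂ (fun k => 2 * (B : ℝ)⁻¹ ^ k) (fun _ => 0)
    {q | q ∈ blockIndexSet B D₁ D₂ ∧ q.z = 0} where
  subset _ hq := hq.1
  le_offset _ := le_rfl
  offset_le k := by
    gcongr
    norm_num
  abs_shift_le q _ := by
    rw [abs_zero]
    positivity
  abs_shift_sub_le q _ q' _ _ _ := by
    rw [sub_self, abs_zero]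
    positivity
  le_abs_shift_sub q hq q' hq' _ _ := by rw [hq.2, hq'.2, sub_self, sub_self, abs_zero, zero_mul]

theorem blockData_right (hB : 8 ≤ B) : BlockData B D₁ D₂
    (fun k => 2 * (B : ℝ)⁻¹ ^ k + 2 * (B : ℝ)⁻¹ ^ fineLength k) (blockShift B)
    (blockIndexSet B D₁ D₂) where
  subset := subset_rfl
  le_offset k := le_add_of_nonneg_right (by positivity)
  offset_le k := by
    have : (B : ℝ)⁻¹ ^ fineLength k ≤ (B : ℝ)⁻¹ ^ k :=
      pow_le_pow_of_le_one (by positivity) (Nat.cast_inv_le_one B) (Nat.le_add_left _ _)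
    linarith
  abs_shift_le _ hq := abs_blockShift_le hB hq
  abs_shift_sub_le _ hq _ hq' hk hv := (abs_blockShift_sub_mem_Icc hB hq hq' hk hv).2
  le_abs_shift_sub _ hq _ hq' hk hv := (abs_blockShift_sub_mem_Icc hB hq hq' hk hv).1

end BlockHeight

/-- The union of the left blocks, near the origin, and the right blocks, near `(1, 0)`. -/
noncomputable def blockSet (B D₁ D₂ : ℕ) : Set Plane :=
  blockPoint B 0 (fun k => 2 * (B : ℝ)⁻¹ ^ k) (fun _ => 0) ''
      {q | q ∈ blockIndexSet B D₁ D₂ ∧ q.z = 0} ∪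
    blockPoint B 1 (fun k => 2 * (B : ℝ)⁻¹ ^ k + 2 * (B : ℝ)⁻¹ ^ fineLength k) (blockShift B) ''
      blockIndexSet B D₁ D₂

/-- The unit pair from the left block to the right block with index `q`. The ordinate of the left
point has the coarse digits of `q.v` and the fine digits `q.z`. -/
noncomputable def blockPair (B : ℕ) (q : BlockIndex) : Plane × Plane :=
  unitPair (q.u * (B : ℝ)⁻¹ ^ blockScale q.k)
    (2 * (B : ℝ)⁻¹ ^ q.k + (q.v / B ^ fineLength q.k * B ^ fineLength q.k + q.z : ℕ) *
      (B : ℝ)⁻¹ ^ blockScale q.k)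
    (blockHeight B q)

section BlockPair

variable {B D₁ D₂ : ℕ} {q q' : BlockIndex}

theorem ordinate_add_blockHeight (B : ℕ) (q : BlockIndex) :
    ((q.v / B ^ fineLength q.k * B ^ fineLength q.k + q.z : ℕ) : ℝ) * (B : ℝ)⁻¹ ^ blockScale q.k +
        blockHeight B q =
      (q.v + 2 * (B : ℝ) ^ fineLength q.k) * (B : ℝ)⁻¹ ^ blockScale q.k := by
  have hdm : ((q.v / B ^ fineLength q.k * B ^ fineLength q.k : ℕ) : ℝ) +
      (q.v % B ^ fineLength q.k : ℕ) = q.v := by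
    exact_mod_cast Nat.div_add_mod' q.v (B ^ fineLength q.k)
  rw [Nat.cast_add, blockHeight]
  linear_combination (B : ℝ)⁻¹ ^ blockScale q.k * hdm

theorem blockPair_fst (B : ℕ) (q : BlockIndex) :
    (blockPair B q).1 = blockPoint B 0 (fun k => 2 * (B : ℝ)⁻¹ ^ k) (fun _ => 0)
      ⟨q.k, q.u, q.v / B ^ fineLength q.k * B ^ fineLength q.k + q.z, 0⟩ := by
  simp only [blockPair, unitPair, blockPoint, zero_add, add_zero]

theorem blockPair_snd (hB : 0 < B) (q : BlockIndex) :
    (blockPair B q).2 = blockPoint B 1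
      (fun k => 2 * (B : ℝ)⁻¹ ^ k + 2 * (B : ℝ)⁻¹ ^ fineLength k) (blockShift B) q := by
  have h := ordinate_add_blockHeight B q
  rw [add_mul, mul_assoc 2, pow_mul_inv_pow_blockScale hB] at h
  ext i
  fin_cases i
  · simp only [blockPair, unitPair, blockPoint, blockShift, Fin.zero_eta, PiLp.toLp_apply,
      Matrix.cons_val_zero]
    ring
  · simp only [blockPair, unitPair, blockPoint, Fin.mk_one, PiLp.toLp_apply, Matrix.cons_val_one,
      Matrix.cons_val_zero]
    linarith

theorem blockPair_mem_unitDistancePairs (hB : 8 ≤ B) (h₁ : 0 < D₁)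
    (hq : q ∈ blockIndexSet B D₁ D₂) : blockPair B q ∈ unitDistancePairs (blockSet B D₁ D₂) := by
  have hB0 : 0 < B := by omega
  have hzero : 0 ∈ digitSet B (fun _ => D₁) (fineLength q.k) :=
    mem_digitSet.2 ⟨pow_pos hB0 _, fun i _ => by rwa [Nat.zero_div, Nat.zero_mod]⟩
  refine ⟨Or.inl ?_, Or.inr ⟨q, hq, (blockPair_snd hB0 q).symm⟩, norm_unitPair_sub ?_⟩
  · rw [blockPair_fst]
    exact Set.mem_image_of_mem _
      ⟨⟨hq.1, div_mul_pow_add_mem_splitDigitSet hB0 hq.2.1 hq.2.2, hzero⟩, rfl⟩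
  · obtain ⟨hw, hw'⟩ := blockHeight_mem_Icc hB0 hq
    have hm := inv_pow_fineLength_le hB q.k
    have : (0 : ℝ) ≤ (B : ℝ)⁻¹ ^ fineLength q.k := by positivity
    exact abs_le.2 ⟨by linarith, by linarith⟩

theorem inv_pow_le_dist_blockPair (hk : q.k = q'.k) (hne : q ≠ q') :
    (B : ℝ)⁻¹ ^ blockScale q.k ≤ dist (blockPair B q) (blockPair B q') := by
  have hx : 0 ≤ (B : ℝ)⁻¹ ^ blockScale q.k := by positivity
  by_cases hu : q.u = q'.u
  · by_cases hv : q.v = q'.v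
    · have hz : q.z ≠ q'.z := fun hz => hne (by
        cases q; cases q'; simp_all)
      refine (le_abs_cast_mul_sub_cast_mul hx hz).trans
        (le_trans (le_of_eq ?_) (abs_ordinate_sub_le_dist_unitPair ..))
      rw [← hk, ← hv, Nat.cast_add, Nat.cast_add]
      congr 1
      ring
    · refine (le_abs_cast_mul_sub_cast_mul hx hv).trans
        (le_trans (le_of_eq ?_) (abs_ordinate_add_sub_le_dist_unitPair ..))
      rw [add_assoc, add_assoc, ordinate_add_blockHeight, ordinate_add_blockHeight, ← hk]
      congr 1
      ring
  · refine (le_abs_cast_mul_sub_cast_mul hx hu).trans ?_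
    nth_rw 2 [hk]
    exact abs_abscissa_sub_le_dist_unitPair ..

theorem rpow_le_card_block {s₁ s₂ : ℝ} (hB : 0 < B) (h₁ : 1 ≤ D₁) (h₂ : 1 ≤ D₂) (h₁B : D₁ ≤ B)
    (h₂B : D₂ ≤ B) (hs₁ : (B : ℝ) ^ s₁ ≤ D₁) (hs₂ : (B : ℝ) ^ s₂ ≤ D₂) (k : ℕ) :
    (B : ℝ) ^ ((3 * s₁ + 2 * s₂) * (k + 1) ^ 2) ≤ (splitDigitSet B k D₂ D₁ ×ˢ
      splitDigitSet B k D₁ D₂ ×ˢ digitSet B (fun _ => D₁) (fineLength k)).card := by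
  have hB0 : (0 : ℝ) < B := by positivity
  have hfine : (k + 1) ^ 2 ≤ fineLength k := Nat.le_add_right _ _
  have hsplit {D E : ℕ} (hD : 1 ≤ D) (hDB : D ≤ B) (hEB : E ≤ B) :
      D ^ (k + 1) ^ 2 * E ^ (k + 1) ^ 2 ≤ (splitDigitSet B k D E).card :=
    (Nat.mul_le_mul_right _ (Nat.pow_le_pow_right hD hfine)).trans
      (pow_mul_pow_le_card_splitDigitSet hB hDB hEB k)
  have hz : D₁ ^ (k + 1) ^ 2 ≤ (digitSet B (fun _ => D₁) (fineLength k)).card :=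
    (Nat.pow_le_pow_right h₁ hfine).trans
      (by simpa using prod_le_card_digitSet hB (fun _ => h₁B) (fineLength k))
  have hcard := Nat.mul_le_mul (hsplit h₂ h₂B h₁B) (Nat.mul_le_mul (hsplit h₁ h₁B h₂B) hz)
  calc (B : ℝ) ^ ((3 * s₁ + 2 * s₂) * (k + 1) ^ 2)
      = ((B : ℝ) ^ s₁) ^ (3 * (k + 1) ^ 2) * ((B : ℝ) ^ s₂) ^ (2 * (k + 1) ^ 2) := by
        rw [← Real.rpow_mul_natCast hB0.le, ← Real.rpow_mul_natCast hB0.le, ← Real.rpow_add hB0]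
        push_cast
        ring_nf
    _ ≤ (D₁ : ℝ) ^ (3 * (k + 1) ^ 2) * (D₂ : ℝ) ^ (2 * (k + 1) ^ 2) := by gcongr
    _ = ((D₂ ^ (k + 1) ^ 2 * D₁ ^ (k + 1) ^ 2 *
          (D₁ ^ (k + 1) ^ 2 * D₂ ^ (k + 1) ^ 2 * D₁ ^ (k + 1) ^ 2) : ℕ) : ℝ) := by
        push_cast
        ring
    _ ≤ _ := by
        rw [Finset.card_product, Finset.card_product]
        exact_mod_cast hcard

theorem tendsto_sub_mul_blockScale {c τ : ℝ} (h : 2 * τ < c) :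
    Tendsto (fun k : ℕ => c * ((k : ℝ) + 1) ^ 2 - τ * blockScale k) atTop atTop := by
  have hk : Tendsto (fun k : ℕ => (k : ℝ) + 1) atTop atTop :=
    tendsto_atTop_add_const_right _ _ tendsto_natCast_atTop_atTop
  have hmain := tendsto_atTop_add_const_right _ (2 * τ) (hk.atTop_mul_atTop₀
    (tendsto_atTop_add_const_right _ (-(2 * τ)) (hk.const_mul_atTop (sub_pos.2 h))))
  refine hmain.congr fun k => ?_
  simp only [blockScale, fineLength]
  push_cast
  ring

theorem block_le_unitDistanceDim {α s₁ s₂ : ℝ} (hα : 0 < α) (hα2 : α ≤ 2) (hB : 8 ≤ B)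
    (h₁ : 1 ≤ D₁) (h₂ : 1 ≤ D₂) (h₁B : D₁ ≤ B) (h₂B : D₂ ≤ B)
    (hD : (D₁ * D₂ + 1 : ℝ) ≤ (B : ℝ) ^ α) (hs₁ : (B : ℝ) ^ s₁ ≤ D₁)
    (hs₂ : (B : ℝ) ^ s₂ ≤ D₂) :
    ((3 * s₁ / 2 + s₂ : ℝ) : EReal) ≤ unitDistanceDim 2 α := by
  have hB0 : 0 < B := by omega
  have hl := blockData_left B D₁ D₂
  have hr := blockData_right (D₁ := D₁) (D₂ := D₂) hB
  refine le_unitDistanceDim_of_separated hα hα2 (by exact_mod_cast (by omega : 1 < B))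
    (K := blockSet B D₁ D₂) ((hl.isBounded hB0).union (hr.isBounded hB0))
    ((hl.isHomogeneousSet hα.le hB h₁ h₂ hD).union (hr.isHomogeneousSet hα.le hB h₁ h₂ hD))
    (tendsto_atTop_mono le_blockScale tendsto_id) (e := fun k => (3 * s₁ + 2 * s₂) * (k + 1) ^ 2)
    (fun k => splitDigitSet B k D₂ D₁ ×ˢ splitDigitSet B k D₁ D₂ ×ˢ
      digitSet B (fun _ => D₁) (fineLength k))
    (fun k t => blockPair B ⟨k, t.1, t.2.1, t.2.2⟩) (fun k t ht => ?_) (fun k t _ t' _ hne => ?_)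
    (rpow_le_card_block hB0 h₁ h₂ h₁B h₂B hs₁ hs₂)
    fun τ hτ => tendsto_sub_mul_blockScale (by linarith)
  · simp only [Finset.mem_product] at ht
    exact blockPair_mem_unitDistancePairs hB h₁ ht
  · refine inv_pow_le_dist_blockPair (q := ⟨k, t.1, t.2.1, t.2.2⟩)
      (q' := ⟨k, t'.1, t'.2.1, t'.2.2⟩) rfl fun h => hne ?_
    simp only [BlockIndex.mk.injEq, true_and] at h
    exact Prod.ext h.1 (Prod.ext h.2.1 h.2.2)

end BlockPair

theorem three_mul_div_two_le_unitDistanceDim {α : ℝ} (hα : 0 < α) (hα1 : α ≤ 1) :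
    ((3 * α / 2 : ℝ) : EReal) ≤ unitDistanceDim 2 α := by
  refine EReal.ge_of_forall_gt_iff_ge.1 fun τ hτ => ?_
  replace hτ : τ < 3 * α / 2 := by exact_mod_cast hτ
  obtain ⟨B, D, hB, hD, hDB, hle, hs⟩ := exists_base_digit (a := α) (s := max 0 (2 * τ / 3))
    (le_max_left _ _) (max_lt hα (by linarith)) hα1
  refine le_trans ?_ (block_le_unitDistanceDim (D₁ := D) (D₂ := 1) (s₂ := 0) hα (by linarith) hB hD
    le_rfl hDB (by omega) (by simpa using hle) hs (by simp))
  have := le_max_right 0 (2 * τ / 3)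
  exact_mod_cast (by linarith : τ ≤ 3 * max 0 (2 * τ / 3) / 2 + 0)

theorem add_half_le_unitDistanceDim {α : ℝ} (hα : 1 ≤ α) (hα2 : α ≤ 2) :
    ((α + 1 / 2 : ℝ) : EReal) ≤ unitDistanceDim 2 α := by
  rcases hα.eq_or_lt with rfl | hα1
  · convert! three_mul_div_two_le_unitDistanceDim one_pos le_rfl using 2
    norm_num
  refine EReal.ge_of_forall_gt_iff_ge.1 fun τ hτ => ?_
  replace hτ : τ < α + 1 / 2 := by exact_mod_cast hτ
  obtain ⟨B, D, hB, hD, hDB, hle, hs⟩ := exists_base_digit (a := α - 1) (s := max 0 (τ - 3 / 2))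
    (le_max_left _ _) (max_lt (by linarith) (by linarith)) (by linarith)
  have hB1 : (1 : ℝ) ≤ B := by exact_mod_cast (by omega : 1 ≤ B)
  have hmul : (B : ℝ) ^ α = B * (B : ℝ) ^ (α - 1) := by
    rw [← Real.rpow_one_add' (Nat.cast_nonneg B) (by linarith), add_sub_cancel]
  refine le_trans ?_ (block_le_unitDistanceDim (D₁ := B) (D₂ := D) (s₁ := 1) (by linarith) hα2 hB
    (by omega) hD le_rfl hDB ?_ (by simp) hs)
  · have := le_max_right 0 (τ - 3 / 2)
    exact_mod_cast (by linarith : τ ≤ 3 * 1 / 2 + max 0 (τ - 3 / 2))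
  · rw [hmul]
    nlinarith

namespace Plane

theorem dist_sq (x y : Plane) : dist x y ^ 2 = (x 0 - y 0) ^ 2 + (x 1 - y 1) ^ 2 := by
  rw [EuclideanSpace.dist_sq_eq, Fin.sum_univ_two, Real.dist_eq, Real.dist_eq, sq_abs, sq_abs]

/-- The inner product of `p - q` and `q' - q`: the position of `p` along the line `qq'`. -/
def proj (q q' p : Plane) : ℝ := (p 0 - q 0) * (q' 0 - q 0) + (p 1 - q 1) * (q' 1 - q 1)

/-- Twice the signed area of the triangle `q p q'`: its sign tells on which side of the line `qq'`
the point `p` lies. -/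
def side (q q' p : Plane) : ℝ := (p 1 - q 1) * (q' 0 - q 0) - (p 0 - q 0) * (q' 1 - q 1)

variable {q q' p p' : Plane} {η : ℝ}

theorem proj_sq_add_side_sq (q q' p : Plane) :
    proj q q' p ^ 2 + side q q' p ^ 2 = dist p q ^ 2 * dist q q' ^ 2 := by
  simp only [proj, side, dist_sq]
  ring

theorem two_mul_proj (q q' p : Plane) :
    2 * proj q q' p = dist p q ^ 2 - dist p q' ^ 2 + dist q q' ^ 2 := by
  simp only [proj, dist_sq]
  ring

theorem dist_sq_mul_dist_sq (q q' p p' : Plane) :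
    dist p p' ^ 2 * dist q q' ^ 2 =
      (proj q q' p - proj q q' p') ^ 2 + (side q q' p - side q q' p') ^ 2 := by
  simp only [proj, side, dist_sq]
  ring

theorem abs_proj_sub_le (h : |dist p q ^ 2 - 1| ≤ 5 * η) (h' : |dist p q' ^ 2 - 1| ≤ 5 * η) :
    |proj q q' p - dist q q' ^ 2 / 2| ≤ 5 * η := by
  rw [abs_le] at *
  constructor <;> linarith [two_mul_proj q q' p]

theorem sq_dist_div_two_le_side_sq (hqq : dist q q' ≤ 1 / 2) (hη : 100 * η ≤ dist q q')
    (h : |dist p q ^ 2 - 1| ≤ 5 * η) (h' : |dist p q' ^ 2 - 1| ≤ 5 * η) :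
    dist q q' ^ 2 / 2 ≤ side q q' p ^ 2 := by
  have ht : 0 ≤ dist q q' := dist_nonneg
  have hd := abs_le.1 (abs_proj_sub_le h h')
  have hproj : proj q q' p ^ 2 ≤ (3 / 10 * dist q q') ^ 2 := by
    apply sq_le_sq' <;> nlinarith
  have hpq : 3 / 4 * dist q q' ^ 2 ≤ dist p q ^ 2 * dist q q' ^ 2 := by
    have : 3 / 4 ≤ dist p q ^ 2 := by linarith [abs_le.1 h]
    gcongr
  linarith [proj_sq_add_side_sq q q' p, mul_pow (3 / 10) (dist q q') 2, sq_nonneg (dist q q')]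

theorem dist_le_abs_side_add (hqq : dist q q' ≤ 1 / 2) (hη : 100 * η ≤ dist q q')
    (hpq : |dist p q ^ 2 - 1| ≤ 5 * η) (hpq' : |dist p q' ^ 2 - 1| ≤ 5 * η)
    (hp'q : |dist p' q ^ 2 - 1| ≤ 5 * η) (hp'q' : |dist p' q' ^ 2 - 1| ≤ 5 * η)
    (hs : 0 ≤ side q q' p * side q q' p') :
    dist q q' ≤ |side q q' p + side q q' p'| := by
  refine (abs_le_of_sq_le_sq' ?_ (abs_nonneg _)).2
  rw [sq_abs]
  linarith [sq_dist_div_two_le_side_sq hqq hη hpq hpq',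
    sq_dist_div_two_le_side_sq hqq hη hp'q hp'q', add_sq (side q q' p) (side q q' p')]

theorem abs_proj_sub_proj_le (hpq : |dist p q ^ 2 - 1| ≤ 5 * η) (hpq' : |dist p q' ^ 2 - 1| ≤ 5 * η)
    (hp'q : |dist p' q ^ 2 - 1| ≤ 5 * η) (hp'q' : |dist p' q' ^ 2 - 1| ≤ 5 * η) :
    |proj q q' p - proj q q' p'| ≤ 10 * η := by
  have h := abs_le.1 (abs_proj_sub_le hpq hpq')
  have h' := abs_le.1 (abs_proj_sub_le hp'q hp'q')
  rw [abs_le]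
  constructor <;> linarith

theorem abs_side_sub_side_le (hη0 : 0 < η) (hqq : dist q q' ≤ 1 / 2) (hη : 100 * η ≤ dist q q')
    (hpq : |dist p q ^ 2 - 1| ≤ 5 * η) (hpq' : |dist p q' ^ 2 - 1| ≤ 5 * η)
    (hp'q : |dist p' q ^ 2 - 1| ≤ 5 * η) (hp'q' : |dist p' q' ^ 2 - 1| ≤ 5 * η)
    (hs : 0 ≤ side q q' p * side q q' p') :
    |side q q' p - side q q' p'| ≤ 11 * η := by
  have ht : 0 < dist q q' := by linarith
  have hsum := dist_le_abs_side_add hqq hη hpq hpq' hp'q hp'q' hs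
  have hproj := abs_proj_sub_proj_le hpq hpq' hp'q hp'q'
  have hdist : |dist p q ^ 2 - dist p' q ^ 2| ≤ 10 * η := by
    rw [abs_le] at *
    constructor <;> linarith
  have hproj_add : |proj q q' p + proj q q' p'| ≤ dist q q' ^ 2 + 10 * η := by
    have h := abs_le.1 (abs_proj_sub_le hpq hpq')
    have h' := abs_le.1 (abs_proj_sub_le hp'q hp'q')
    rw [abs_le]
    constructor <;> linarith [sq_nonneg (dist q q')]
  set t := dist q q'
  refine le_of_mul_le_mul_right ?_ ht
  calc |side q q' p - side q q' p'| * t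
      ≤ |side q q' p - side q q' p'| * |side q q' p + side q q' p'| := by gcongr
    _ = |(dist p q ^ 2 - dist p' q ^ 2) * t ^ 2 -
          (proj q q' p - proj q q' p') * (proj q q' p + proj q q' p')| := by
        rw [← abs_mul]
        congr 1
        linear_combination proj_sq_add_side_sq q q' p - proj_sq_add_side_sq q q' p'
    _ ≤ 10 * η * t ^ 2 + 10 * η * (t ^ 2 + 10 * η) := by
        refine (abs_sub _ _).trans ?_
        rw [abs_mul, abs_mul, abs_of_nonneg (sq_nonneg t)]
        gcongr
    _ ≤ 11 * η * t := by nlinarith [mul_pos hη0 ht]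

/-- Two thin annuli of radius `1` about `q` and `q'` meet in two pieces of diameter
`O(η / dist q q')`, one on each side of the line `qq'`. -/
theorem dist_mul_dist_le_of_near_unit (hη0 : 0 < η) (hqq : dist q q' ≤ 1 / 2)
    (hη : 100 * η ≤ dist q q')
    (hpq : |dist p q ^ 2 - 1| ≤ 5 * η) (hpq' : |dist p q' ^ 2 - 1| ≤ 5 * η)
    (hp'q : |dist p' q ^ 2 - 1| ≤ 5 * η) (hp'q' : |dist p' q' ^ 2 - 1| ≤ 5 * η)
    (hs : 0 ≤ side q q' p * side q q' p') :
    dist p p' * dist q q' ≤ 15 * η := by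
  have hproj := abs_le.1 (abs_proj_sub_proj_le hpq hpq' hp'q hp'q')
  have hside := abs_le.1 (abs_side_sub_side_le hη0 hqq hη hpq hpq' hp'q hp'q' hs)
  refine abs_le_of_sq_le_sq ?_ (by positivity) |> (le_abs_self _).trans
  rw [mul_pow, dist_sq_mul_dist_sq]
  nlinarith [sq_le_sq' hproj.1 hproj.2, sq_le_sq' hside.1 hside.2, sq_nonneg η]

theorem abs_dist_sq_sub_one_le (hη : η ≤ 1 / 4) (h : |dist p q - 1| ≤ 2 * η) :
    |dist p q ^ 2 - 1| ≤ 5 * η := by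
  rw [abs_le] at *
  constructor <;> nlinarith [dist_nonneg (x := p) (y := q)]

end Plane

theorem exists_separated_net {X : Type*} [MetricSpace X] {K : Set X} (hK : IsCompact K) {η : ℝ}
    (hη : 0 < η) :
    ∃ P : Finset X, ↑P ⊆ K ∧ (P : Set X).Pairwise (fun p q => η < dist p q) ∧
      ∀ x ∈ K, ∃ p ∈ P, dist x p ≤ η := by
  lift η to ℝ≥0 using hη.le
  have hη0 : η ≠ 0 := (NNReal.coe_pos.1 hη).ne'
  have hfin : Metric.packingNumber η K ≠ ⊤ := by
    obtain ⟨N, -, hN, hcov⟩ := Metric.exists_finite_isCover_of_isCompact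
      (ε := η / 2) (div_ne_zero hη0 two_ne_zero) hK
    have h := Metric.packingNumber_two_mul_le_externalCoveringNumber (η / 2) K
    rw [mul_div_cancel₀ η two_ne_zero] at h
    exact ne_top_of_le_ne_top (Set.encard_ne_top_iff.2 hN)
      (h.trans hcov.externalCoveringNumber_le_encard)
  have hsf : (Metric.maximalSeparatedSet η K).Finite := by
    rwa [← Set.encard_ne_top_iff, Metric.encard_maximalSeparatedSet hfin]
  refine ⟨hsf.toFinset, by simpa using Metric.maximalSeparatedSet_subset, ?_, ?_⟩
  · rw [Set.Finite.coe_toFinset]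
    intro p hp q hq hpq
    have h : (η : ℝ≥0∞) < edist p q := Metric.isSeparated_maximalSeparatedSet hp hq hpq
    rw [edist_nndist, ENNReal.coe_lt_coe] at h
    exact NNReal.coe_lt_coe.2 h
  · intro x hx
    obtain ⟨p, hp, hxp⟩ := Metric.isCover_maximalSeparatedSet hfin hx
    refine ⟨p, by simpa using hp, ?_⟩
    have h : edist x p ≤ η := hxp
    rw [edist_nndist, ENNReal.coe_le_coe] at h
    exact NNReal.coe_le_coe.2 h

/-- Discrete `α`-dimensional upper regularity at scale `η`: at most `C (r / η) ^ α` points of `P`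
lie in any ball of radius `r ≥ η`. -/
def HasGrowth {X : Type*} [PseudoMetricSpace X] (α C η : ℝ) (P : Finset X) : Prop :=
  ∀ (x : X) (r : ℝ), η ≤ r → ((P.filter fun p => dist p x < r).card : ℝ) ≤ C * (r / η) ^ α

/-- The pairs of points of `P` whose distance differs from `1` by at most `2 η`, a discrete
substitute for the unit distance set at scale `η`. -/
noncomputable def nearUnitPairs {X : Type*} [PseudoMetricSpace X] (η : ℝ) (P : Finset X) :
    Finset (X × X) :=
  (P ×ˢ P).filter fun z => |dist z.1 z.2 - 1| ≤ 2 * η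

theorem card_mul_volume_ball_le_volume_thickening_inter_ball {d : ℕ}
    {K : Set (EuclideanSpace ℝ (Fin d))} {F : Finset (EuclideanSpace ℝ (Fin d))} {η r : ℝ}
    {x : EuclideanSpace ℝ (Fin d)} (hFK : ↑F ⊆ K) (hηr : η ≤ r)
    (hsep : (F : Set (EuclideanSpace ℝ (Fin d))).Pairwise fun p q => η < dist p q)
    (hFx : ∀ p ∈ F, dist p x < r) :
    F.card * volume (Metric.ball (0 : EuclideanSpace ℝ (Fin d)) (η / 2)) ≤
      volume (Metric.thickening (η / 2) K ∩ Metric.ball x (2 * r)) := by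
  have hdisj : (F : Set (EuclideanSpace ℝ (Fin d))).PairwiseDisjoint
      fun p => Metric.ball p (η / 2) := fun p hp q hq hpq =>
    Metric.ball_disjoint_ball (by linarith [hsep hp hq hpq])
  calc F.card * volume (Metric.ball (0 : EuclideanSpace ℝ (Fin d)) (η / 2))
      = ∑ p ∈ F, volume (Metric.ball p (η / 2)) := by
        simp only [Measure.addHaar_ball_center volume _ (η / 2), Finset.sum_const, nsmul_eq_mul]
    _ = volume (⋃ p ∈ F, Metric.ball p (η / 2)) :=
        (measure_biUnion_finset hdisj fun p _ => measurableSet_ball).symm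
    _ ≤ _ := by
        refine measure_mono (Set.iUnion₂_subset fun p hp y hy => ?_)
        rw [Metric.mem_ball] at hy
        have hη : 0 < η / 2 := dist_nonneg.trans_lt hy
        exact ⟨Metric.mem_thickening_iff.2 ⟨p, hFK hp, hy⟩,
          Metric.mem_ball.2 (by linarith [dist_triangle y p x, hFx p hp])⟩

theorem IsDiscreteAlphaSet.exists_hasGrowth {d : ℕ} [NeZero d] {α : ℝ}
    {K : Set (EuclideanSpace ℝ (Fin d))} (hK : IsDiscreteAlphaSet α K) :
    ∃ C : ℝ, 0 ≤ C ∧ ∀ (η : ℝ) (P : Finset (EuclideanSpace ℝ (Fin d))), 0 < η → ↑P ⊆ K →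
      (P : Set (EuclideanSpace ℝ (Fin d))).Pairwise (fun p q => η < dist p q) →
      HasGrowth α C η P := by
  obtain ⟨C, hC⟩ := hK
  set v := (volume (Metric.ball (0 : EuclideanSpace ℝ (Fin d)) 1)).toReal with hv_def
  have hv : 0 < v := ENNReal.toReal_pos (Metric.measure_ball_pos volume _ one_pos).ne'
    measure_ball_lt_top.ne
  refine ⟨|C| * 4 ^ α / v, by positivity, fun η P hη hPK hsep x r hr => ?_⟩
  have hr0 : 0 < r := hη.trans_le hr
  set F := P.filter fun p => dist p x < r
  have hFP : (F : Set (EuclideanSpace ℝ (Fin d))) ⊆ P := Finset.coe_subset.2 (P.filter_subset _)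
  have hvol := (card_mul_volume_ball_le_volume_thickening_inter_ball (hFP.trans hPK) hr
    (hsep.mono hFP) fun p hp => (Finset.mem_filter.1 hp).2).trans
      (hC (η / 2) (by positivity) x (2 * r) (by linarith))
  have hcard : F.card * ((η / 2) ^ d * v) ≤ |C| * (2 * r / (η / 2)) ^ α * (η / 2) ^ d := by
    rw [Measure.addHaar_ball _ _ (by positivity), finrank_euclideanSpace_fin,
      ← ENNReal.ofReal_toReal (measure_ball_lt_top (x := 0) (r := 1)).ne, ← hv_def,
      ← ENNReal.ofReal_mul (by positivity), ← ENNReal.ofReal_natCast,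
      ← ENNReal.ofReal_mul (by positivity)] at hvol
    refine (ENNReal.ofReal_le_ofReal_iff (by positivity)).1 (hvol.trans ?_)
    gcongr
    exact le_abs_self C
  rw [div_mul_eq_mul_div, le_div_iff₀ hv, mul_assoc, ← Real.mul_rpow (by norm_num) (by positivity)]
  have h4 : 2 * r / (η / 2) = 4 * (r / η) := by field_simp; norm_num
  rw [h4] at hcard
  have hηd : 0 < (η / 2) ^ d := by positivity
  exact le_of_mul_le_mul_right (by linarith) hηd

theorem coveringNumber_unitDistancePairs_le {d : ℕ} {K : Set (EuclideanSpace ℝ (Fin d))}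
    {P : Finset (EuclideanSpace ℝ (Fin d))} {η : ℝ≥0} (hP : ∀ x ∈ K, ∃ p ∈ P, dist x p ≤ η) :
    Metric.coveringNumber (2 * η) (unitDistancePairs K) ≤ (nearUnitPairs η P).card := by
  have hcov : Metric.IsCover η (unitDistancePairs K) (nearUnitPairs (η : ℝ) P) := by
    rintro z ⟨hz1, hz2, hz⟩
    obtain ⟨p, hp, hzp⟩ := hP z.1 hz1
    obtain ⟨q, hq, hzq⟩ := hP z.2 hz2
    rw [← dist_eq_norm, dist_comm] at hz
    refine ⟨(p, q), Finset.mem_coe.2 (Finset.mem_filter.2 ⟨Finset.mk_mem_product hp hq, ?_⟩), ?_⟩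
    · rw [abs_le]
      constructor
      · linarith [dist_triangle4 z.1 p q z.2, dist_comm q z.2]
      · linarith [dist_triangle4 p z.1 z.2 q, dist_comm p z.1]
    · change edist z (p, q) ≤ η
      rw [edist_nndist, ENNReal.coe_le_coe, ← NNReal.coe_le_coe, coe_nndist, Prod.dist_eq]
      exact max_le hzp hzq
  refine (Metric.coveringNumber_two_mul_le_externalCoveringNumber _ _).trans
    (hcov.externalCoveringNumber_le_encard.trans_eq ?_)
  rw [Set.encard_coe_eq_coe_finsetCard]

theorem upperMinkowskiDim_unitDistancePairs_le {d : ℕ} [NeZero d] {α t : ℝ} (ht : 0 ≤ t)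
    {K : Set (EuclideanSpace ℝ (Fin d))} (hK : IsCompact K) (hd : IsDiscreteAlphaSet α K)
    (h : ∀ C R : ℝ, 0 ≤ C → 1 ≤ R → ∃ C' : ℝ,
      ∀ (J : ℕ) (P : Finset (EuclideanSpace ℝ (Fin d))),
        HasGrowth α C ((2 : ℝ)⁻¹ ^ J / 4) P → (∀ p ∈ P, ‖p‖ < R) →
        ((nearUnitPairs ((2 : ℝ)⁻¹ ^ J / 4) P).card : ℝ) ≤ C' * (J + 1) * 2 ^ (t * J)) :
    upperMinkowskiDim (unitDistancePairs K) ≤ (t : EReal) := by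
  obtain ⟨C, hC0, hC⟩ := hd.exists_hasGrowth
  obtain ⟨R, hR⟩ := hK.isBounded.subset_ball 0
  obtain ⟨C', hC'⟩ := h C (max R 1) hC0 (le_max_right _ _)
  refine upperMinkowskiDim_le (C := C') ht fun J => ?_
  have hη : (0 : ℝ) < (2 : ℝ)⁻¹ ^ J / 4 := by positivity
  obtain ⟨P, hPK, hsep, hnet⟩ := exists_separated_net hK hη
  have hcard := hC' J P (hC _ P hη hPK hsep) fun p hp =>
    (mem_ball_zero_iff.1 (hR (hPK hp))).trans_le (le_max_left _ _)
  have hcov := coveringNumber_unitDistancePairs_le (η := 2⁻¹ ^ J / 4) (P := P) (K := K)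
    (by simpa using hnet)
  rw [NNReal.coe_div, NNReal.coe_pow, NNReal.coe_inv, NNReal.coe_ofNat, NNReal.coe_ofNat] at hcov
  have hanti : Metric.coveringNumber ((2 : ℝ≥0)⁻¹ ^ J) (unitDistancePairs K) ≤
      Metric.coveringNumber (2 * ((2 : ℝ≥0)⁻¹ ^ J / 4)) (unitDistancePairs K) := by
    refine Metric.coveringNumber_anti ?_
    rw [← NNReal.coe_le_coe]
    push_cast
    linarith
  calc (Metric.coveringNumber ((2 : ℝ≥0)⁻¹ ^ J) (unitDistancePairs K) : ℝ≥0∞)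
      ≤ (((nearUnitPairs ((2 : ℝ)⁻¹ ^ J / 4) P).card : ℕ∞) : ℝ≥0∞) := by
        exact_mod_cast hanti.trans hcov
    _ = ENNReal.ofReal ((nearUnitPairs ((2 : ℝ)⁻¹ ^ J / 4) P).card : ℝ) := by simp
    _ ≤ _ := ENNReal.ofReal_le_ofReal hcard

/-- The number of points of `P` at distance within `2 η` of `1` from both `q` and `q'`: the
codegree of `q` and `q'` in the graph of nearly unit distances. -/
noncomputable def codegree {X : Type*} [PseudoMetricSpace X] (η : ℝ) (P : Finset X) (q q' : X) :
    ℕ :=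
  (P.filter fun p => |dist p q - 1| ≤ 2 * η ∧ |dist p q' - 1| ≤ 2 * η).card

theorem sq_card_near_le_card_mul_sum_codegree {X : Type*} [PseudoMetricSpace X] (η : ℝ)
    (P Q : Finset X) :
    ((P ×ˢ Q).filter fun z => |dist z.1 z.2 - 1| ≤ 2 * η).card ^ 2 ≤
      P.card * ∑ q ∈ Q, ∑ q' ∈ Q, codegree η P q q' := by
  have hsq : ∑ p ∈ P, (Q.filter fun q => |dist p q - 1| ≤ 2 * η).card ^ 2 =
      ∑ q ∈ Q, ∑ q' ∈ Q, codegree η P q q' := by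
    simp_rw [codegree, Finset.card_filter, sq, Finset.sum_mul_sum, ite_and, ite_mul, one_mul,
      zero_mul]
    rw [Finset.sum_comm]
    exact Finset.sum_congr rfl fun q _ => Finset.sum_comm
  have hcard : ((P ×ˢ Q).filter fun z => |dist z.1 z.2 - 1| ≤ 2 * η).card =
      ∑ p ∈ P, (Q.filter fun q => |dist p q - 1| ≤ 2 * η).card := by
    simp_rw [Finset.card_filter, Finset.sum_product]
  rw [hcard, ← hsq]
  exact sq_sum_le_card_mul_sum_sq

theorem lt_two_pow_size_floor {t : ℝ} (ht : 0 ≤ t) : t < 2 ^ Nat.size ⌊t⌋₊ := by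
  exact_mod_cast (Nat.floor_lt ht).1 (Nat.lt_size_self ⌊t⌋₊)

theorem two_pow_le_of_lt_size_floor {t : ℝ} {i : ℕ} (h : i < Nat.size ⌊t⌋₊) : 2 ^ i ≤ t := by
  exact_mod_cast (Nat.le_floor_iff' (by positivity)).1 (Nat.lt_size.1 h)

namespace HasGrowth

section PseudoMetricSpace

variable {X : Type*} [PseudoMetricSpace X] {α C η : ℝ} {P Q : Finset X}

theorem card_le_of_dist_lt {ρ : ℝ} (hP : HasGrowth α C η P) (hη : 0 < η) (hC : 0 ≤ C) (hρ : η ≤ ρ)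
    (hQP : Q ⊆ P) (hd : ∀ p ∈ Q, ∀ q ∈ Q, dist p q < ρ) : (Q.card : ℝ) ≤ C * (ρ / η) ^ α := by
  have hρ0 : 0 < ρ := hη.trans_le hρ
  rcases Q.eq_empty_or_nonempty with rfl | ⟨q, hq⟩
  · simp only [Finset.card_empty, Nat.cast_zero]
    positivity
  · refine le_trans ?_ (hP q ρ hρ)
    exact_mod_cast Finset.card_le_card fun p hp => Finset.mem_filter.2 ⟨hQP hp, hd p hp q hq⟩

theorem card_shell_le {ρ : ℝ} (hP : HasGrowth α C η P) (hη : 0 < η) (hρ : η ≤ ρ) (q : X) (i : ℕ) :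
    ((P.filter fun p => Nat.size ⌊dist p q / ρ⌋₊ = i).card : ℝ) ≤ C * (2 ^ i * (ρ / η)) ^ α := by
  have hρ0 : 0 < ρ := hη.trans_le hρ
  rw [← mul_div_assoc]
  refine le_trans (Nat.cast_le.2 (Finset.card_le_card fun p hp => ?_))
    (hP q (2 ^ i * ρ) (hρ.trans (le_mul_of_one_le_left hρ0.le (one_le_pow₀ one_le_two))))
  obtain ⟨hpP, rfl⟩ := Finset.mem_filter.1 hp
  refine Finset.mem_filter.2 ⟨hpP, ?_⟩
  rw [← div_lt_iff₀ hρ0]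
  exact lt_two_pow_size_floor (by positivity)

theorem sum_shell_le {A : ℝ} {f : X → ℝ} {q : X} (hα : 0 ≤ α) (hη : 0 < η) (hA : 0 ≤ A)
    (hP : HasGrowth α C η P) (hQP : Q ⊆ P)
    (hf : ∀ p ∈ Q, f p ≤ A * (η / max η (dist p q)) ^ α) (i : ℕ) :
    ∑ p ∈ Q with Nat.size ⌊dist p q / η⌋₊ = i, f p ≤ C * A * 2 ^ α := by
  have hcard : ((Q.filter fun p => Nat.size ⌊dist p q / η⌋₊ = i).card : ℝ) ≤ C * (2 ^ i) ^ α := by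
    have hshell := hP.card_shell_le hη le_rfl q i
    rw [div_self hη.ne', mul_one] at hshell
    exact (Nat.cast_le.2 (Finset.card_le_card (Finset.filter_subset_filter _ hQP))).trans hshell
  have hterm : ∀ p ∈ Q.filter fun p => Nat.size ⌊dist p q / η⌋₊ = i, f p ≤ A * (2 / 2 ^ i) ^ α := by
    intro p hp
    obtain ⟨hpQ, hpi⟩ := Finset.mem_filter.1 hp
    have hshell : η / max η (dist p q) ≤ 2 / 2 ^ i := ?_
    · exact (hf p hpQ).trans (by gcongr)
    rw [div_le_div_iff₀ (by positivity) (by positivity)]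
    rcases i with _ | i
    · linarith [le_max_left η (dist p q)]
    · have hi : (2 : ℝ) ^ i * η ≤ dist p q := by
        rw [← le_div_iff₀ hη]
        exact two_pow_le_of_lt_size_floor (by omega)
      rw [pow_succ]
      linarith [le_max_right η (dist p q)]
  calc ∑ p ∈ Q with Nat.size ⌊dist p q / η⌋₊ = i, f p
      ≤ (Q.filter fun p => Nat.size ⌊dist p q / η⌋₊ = i).card * (A * (2 / 2 ^ i) ^ α) := by
        rw [← nsmul_eq_mul]
        exact Finset.sum_le_card_nsmul _ _ _ hterm
    _ ≤ C * (2 ^ i) ^ α * (A * (2 / 2 ^ i) ^ α) := by gcongr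
    _ = C * A * ((2 ^ i) ^ α * (2 / 2 ^ i) ^ α) := by ring
    _ = C * A * 2 ^ α := by
        rw [← Real.mul_rpow (by positivity) (by positivity), mul_div_cancel₀ _ (by positivity)]

theorem sum_le_of_le_rpow {A : ℝ} {f : X → ℝ} {q : X} {M : ℕ} (hα : 0 ≤ α) (hη : 0 < η) (hA : 0 ≤ A)
    (hP : HasGrowth α C η P) (hQP : Q ⊆ P) (hM : ∀ p ∈ Q, dist p q < 2 ^ M * η)
    (hf : ∀ p ∈ Q, f p ≤ A * (η / max η (dist p q)) ^ α) :
    ∑ p ∈ Q, f p ≤ (M + 1) * (C * A * 2 ^ α) := by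
  have hmaps : ∀ p ∈ Q, Nat.size ⌊dist p q / η⌋₊ ∈ Finset.range (M + 1) := by
    intro p hp
    rw [Finset.mem_range, Nat.lt_succ_iff, Nat.size_le, Nat.floor_lt (by positivity),
      div_lt_iff₀ hη]
    exact_mod_cast hM p hp
  rw [← Finset.sum_fiberwise_of_maps_to hmaps]
  refine (Finset.sum_le_card_nsmul _ _ _ fun i _ =>
    hP.sum_shell_le hα hη hA hQP hf i).trans_eq ?_
  rw [Finset.card_range, nsmul_eq_mul, Nat.cast_succ]

end PseudoMetricSpace

section Plane

variable {α C η : ℝ} {P Q : Finset Plane}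

theorem codegree_le_div_dist {q q' : Plane} (hP : HasGrowth α C η P) (hη : 0 < η) (hη4 : η ≤ 1 / 4)
    (hC : 0 ≤ C) (hqq : 0 < dist q q') (hqq2 : dist q q' ≤ 1 / 2) :
    (codegree η P q q' : ℝ) ≤ 2 * (C * (600 / dist q q') ^ α) := by
  set F := P.filter fun p => |dist p q - 1| ≤ 2 * η ∧ |dist p q' - 1| ≤ 2 * η with hF
  have hclose : ∀ p ∈ F, ∀ p' ∈ F, 0 ≤ Plane.side q q' p * Plane.side q q' p' →
      dist p p' < 600 * η / dist q q' := by
    intro p hp p' hp' hs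
    obtain ⟨-, hpq, hpq'⟩ := Finset.mem_filter.1 hp
    obtain ⟨-, hp'q, hp'q'⟩ := Finset.mem_filter.1 hp'
    rw [lt_div_iff₀ hqq]
    rcases le_or_gt (100 * η) (dist q q') with hfar | hnear
    · linarith [Plane.dist_mul_dist_le_of_near_unit hη hqq2 hfar
        (Plane.abs_dist_sq_sub_one_le hη4 hpq) (Plane.abs_dist_sq_sub_one_le hη4 hpq')
        (Plane.abs_dist_sq_sub_one_le hη4 hp'q) (Plane.abs_dist_sq_sub_one_le hη4 hp'q') hs]
    · have hpp : dist p p' ≤ 3 := by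
        linarith [dist_triangle_right p p' q, (abs_le.1 hpq).2, (abs_le.1 hp'q).2]
      nlinarith
  have hρ : η ≤ 600 * η / dist q q' := by
    rw [le_div_iff₀ hqq]
    nlinarith
  have hFP : F ⊆ P := Finset.filter_subset _ _
  have hleft := hP.card_le_of_dist_lt hη hC hρ ((Finset.filter_subset _ _).trans hFP)
    (Q := F.filter fun p => 0 ≤ Plane.side q q' p) fun p hp p' hp' => by
      rw [Finset.mem_filter] at hp hp'
      exact hclose p hp.1 p' hp'.1 (mul_nonneg hp.2 hp'.2)
  have hright := hP.card_le_of_dist_lt hη hC hρ ((Finset.filter_subset _ _).trans hFP)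
    (Q := F.filter fun p => ¬ 0 ≤ Plane.side q q' p) fun p hp p' hp' => by
      rw [Finset.mem_filter, not_le] at hp hp'
      exact hclose p hp.1 p' hp'.1 (mul_nonneg_of_nonpos_of_nonpos hp.2.le hp'.2.le)
  rw [show 600 * η / dist q q' / η = 600 / dist q q' by field_simp] at hleft hright
  rw [codegree, ← hF, ← Finset.card_filter_add_card_filter_not fun p => 0 ≤ Plane.side q q' p]
  push_cast
  linarith

theorem card_le_of_norm_lt {R : ℝ} (hP : HasGrowth α C η P) (hR : η ≤ R)
    (hPR : ∀ p ∈ P, ‖p‖ < R) : (P.card : ℝ) ≤ C * (R / η) ^ α := by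
  have hball := hP 0 R hR
  rwa [Finset.filter_true_of_mem fun p hp => by rw [dist_zero_right]; exact hPR p hp] at hball

theorem codegree_le {R : ℝ} {q q' : Plane} (hα : 0 ≤ α) (hP : HasGrowth α C η P) (hη : 0 < η)
    (hη4 : η ≤ 1 / 4) (hC : 0 ≤ C) (hR : 600 ≤ R) (hPR : ∀ p ∈ P, ‖p‖ < R)
    (hqq : dist q q' ≤ 1 / 2) :
    (codegree η P q q' : ℝ) ≤ 2 * C * (R / η) ^ α * (η / max η (dist q q')) ^ α := by
  rw [mul_assoc, ← Real.mul_rpow (by positivity) (by positivity), div_mul_div_cancel₀ hη.ne',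
    mul_assoc]
  rcases le_or_gt (dist q q') η with hnear | hfar
  · rw [max_eq_left hnear]
    have hcard := hP.card_le_of_norm_lt (by linarith) hPR
    have hcod : (codegree η P q q' : ℝ) ≤ P.card := Nat.cast_le.2 (Finset.card_filter_le _ _)
    linarith [Nat.cast_nonneg (α := ℝ) P.card]
  · rw [max_eq_right hfar.le]
    have hqq0 : 0 < dist q q' := hη.trans hfar
    refine (hP.codegree_le_div_dist hη hη4 hC hqq0 hqq).trans ?_
    gcongr

theorem sq_card_near_le {R : ℝ} {M : ℕ} (hα : 0 ≤ α) (hP : HasGrowth α C η P) (hη : 0 < η)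
    (hη4 : η ≤ 1 / 4) (hC : 0 ≤ C) (hR : 600 ≤ R) (hPR : ∀ p ∈ P, ‖p‖ < R) (hQP : Q ⊆ P)
    (hQ : ∀ q ∈ Q, ∀ q' ∈ Q, dist q q' < 1 / 2) (hM : 1 / 2 ≤ 2 ^ M * η) :
    (((P ×ˢ Q).filter fun z => |dist z.1 z.2 - 1| ≤ 2 * η).card : ℝ) ^ 2 ≤
      2 * 2 ^ α * C ^ 4 * (M + 1) * ((R / η) ^ α) ^ 3 := by
  have hPcard : (P.card : ℝ) ≤ C * (R / η) ^ α := hP.card_le_of_norm_lt (by linarith) hPR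
  have hQcard : (Q.card : ℝ) ≤ C * (R / η) ^ α :=
    (Nat.cast_le.2 (Finset.card_le_card hQP)).trans hPcard
  have hcod : ∀ q ∈ Q, ∑ q' ∈ Q, (codegree η P q q' : ℝ) ≤
      (M + 1) * (C * (2 * C * (R / η) ^ α) * 2 ^ α) := fun q hq =>
    hP.sum_le_of_le_rpow hα hη (by positivity) hQP (q := q)
      (fun q' hq' => (hQ q' hq' q hq).trans_le hM) fun q' hq' => by
        rw [dist_comm q' q]
        exact hP.codegree_le hα hη hη4 hC hR hPR (hQ q hq q' hq').le
  calc (((P ×ˢ Q).filter fun z => |dist z.1 z.2 - 1| ≤ 2 * η).card : ℝ) ^ 2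
      ≤ P.card * ∑ q ∈ Q, ∑ q' ∈ Q, (codegree η P q q' : ℝ) :=
        mod_cast sq_card_near_le_card_mul_sum_codegree η P Q
    _ ≤ P.card * (Q.card * ((M + 1) * (C * (2 * C * (R / η) ^ α) * 2 ^ α))) := by
        gcongr
        rw [← nsmul_eq_mul]
        exact Finset.sum_le_card_nsmul _ _ _ hcod
    _ ≤ (C * (R / η) ^ α) *
        ((C * (R / η) ^ α) * ((M + 1) * (C * (2 * C * (R / η) ^ α) * 2 ^ α))) := by
        gcongr
    _ = _ := by ring

theorem card_near_le {S : ℝ} {J : ℕ} (hα : 0 ≤ α) (hC : 0 ≤ C) (hS : 600 ≤ S)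
    (hP : HasGrowth α C ((2 : ℝ)⁻¹ ^ J / 4) P) (hPS : ∀ p ∈ P, ‖p‖ < S) (hQP : Q ⊆ P)
    (hQ : ∀ q ∈ Q, ∀ q' ∈ Q, dist q q' < 1 / 2) :
    (((P ×ˢ Q).filter fun z => |dist z.1 z.2 - 1| ≤ 2 * ((2 : ℝ)⁻¹ ^ J / 4)).card : ℝ) ≤
      2 * 2 ^ α * C ^ 2 * (4 * S) ^ (3 * α / 2) * (J + 1) * 2 ^ (3 * α / 2 * J) := by
  have hJ : (2 : ℝ)⁻¹ ^ J / 4 ≤ 1 / 4 := by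
    linarith [pow_le_one₀ (n := J) (by norm_num : (0 : ℝ) ≤ 2⁻¹) (by norm_num)]
  have hM : (1 : ℝ) / 2 ≤ 2 ^ (J + 1) * ((2 : ℝ)⁻¹ ^ J / 4) := by
    rw [pow_succ, inv_pow]
    field_simp
    norm_num
  have hscale : ((S / ((2 : ℝ)⁻¹ ^ J / 4)) ^ α) ^ 3 =
      ((4 * S) ^ (3 * α / 2) * 2 ^ (3 * α / 2 * J)) ^ 2 := by
    rw [show S / ((2 : ℝ)⁻¹ ^ J / 4) = 4 * S * 2 ^ (J : ℝ) by
        rw [inv_pow, Real.rpow_natCast]; field_simp,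
      mul_comm (3 * α / 2) (J : ℝ), Real.rpow_mul two_pos.le,
      ← Real.mul_rpow (by positivity) (by positivity), ← Real.rpow_mul_natCast (by positivity),
      ← Real.rpow_mul_natCast (by positivity)]
    congr 1
    push_cast
    ring
  have hJ2 : 2 * 2 ^ α * (((J + 1 : ℕ) : ℝ) + 1) ≤ (2 * 2 ^ α * (J + 1)) ^ 2 := by
    have h2α : (1 : ℝ) ≤ 2 ^ α := Real.one_le_rpow one_le_two hα
    push_cast
    nlinarith [mul_nonneg (Nat.cast_nonneg (α := ℝ) J) (by linarith : (0 : ℝ) ≤ 2 ^ α)]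
  refine (abs_le_of_sq_le_sq' ?_ (by positivity)).2
  calc (((P ×ˢ Q).filter fun z => |dist z.1 z.2 - 1| ≤ 2 * ((2 : ℝ)⁻¹ ^ J / 4)).card : ℝ) ^ 2
      ≤ 2 * 2 ^ α * C ^ 4 * (((J + 1 : ℕ) : ℝ) + 1) *
        ((4 * S) ^ (3 * α / 2) * 2 ^ (3 * α / 2 * (J : ℝ))) ^ 2 := by
        rw [← hscale]
        exact hP.sq_card_near_le hα (by positivity) hJ hC hS hPS hQP hQ hM
    _ = 2 * 2 ^ α * (((J + 1 : ℕ) : ℝ) + 1) *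
        (C ^ 2 * ((4 * S) ^ (3 * α / 2) * 2 ^ (3 * α / 2 * (J : ℝ)))) ^ 2 := by ring
    _ ≤ (2 * 2 ^ α * (J + 1)) ^ 2 *
        (C ^ 2 * ((4 * S) ^ (3 * α / 2) * 2 ^ (3 * α / 2 * (J : ℝ)))) ^ 2 := by gcongr
    _ = _ := by ring

end Plane

end HasGrowth

theorem exists_card_nearUnitPairs_le_sum {X : Type*} [PseudoMetricSpace X] {K : Set X}
    (hK : IsCompact K) {ε : ℝ} (hε : 0 < ε) :
    ∃ N : Finset X, ∀ (η : ℝ) (P : Finset X), ↑P ⊆ K → (nearUnitPairs η P).card ≤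
      ∑ c ∈ N, ((P ×ˢ P.filter fun q => dist q c < ε).filter fun z =>
        |dist z.1 z.2 - 1| ≤ 2 * η).card := by
  classical
  obtain ⟨N, -, hN, hcov⟩ := finite_cover_balls_of_compact hK hε
  refine ⟨hN.toFinset, fun η P hP => (Finset.card_le_card fun z hz => ?_).trans
    Finset.card_biUnion_le⟩
  obtain ⟨hzP, hz1⟩ := Finset.mem_filter.1 hz
  obtain ⟨hz₁, hz₂⟩ := Finset.mem_product.1 hzP
  obtain ⟨c, hc, hzc⟩ := Set.mem_iUnion₂.1 (hcov (hP hz₂))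
  exact Finset.mem_biUnion.2 ⟨c, hN.mem_toFinset.2 hc, Finset.mem_filter.2
    ⟨Finset.mk_mem_product hz₁ (Finset.mem_filter.2 ⟨hz₂, hzc⟩), hz1⟩⟩

theorem exists_card_nearUnitPairs_le_three_halves {α C : ℝ} (R : ℝ) (hα : 0 ≤ α) (hC : 0 ≤ C) :
    ∃ C' : ℝ, ∀ (J : ℕ) (P : Finset Plane),
      HasGrowth α C ((2 : ℝ)⁻¹ ^ J / 4) P → (∀ p ∈ P, ‖p‖ < R) →
      ((nearUnitPairs ((2 : ℝ)⁻¹ ^ J / 4) P).card : ℝ) ≤ C' * (J + 1) * 2 ^ (3 * α / 2 * J) := by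
  set S : ℝ := max R 600
  obtain ⟨N, hN⟩ := exists_card_nearUnitPairs_le_sum (isCompact_closedBall (0 : Plane) S)
    (ε := 1 / 4) (by norm_num)
  refine ⟨N.card * (2 * 2 ^ α * C ^ 2 * (4 * S) ^ (3 * α / 2)), fun J P hP hPR => ?_⟩
  replace hPR : ∀ p ∈ P, ‖p‖ < S := fun p hp => (hPR p hp).trans_le (le_max_left _ _)
  have hsum := hN ((2 : ℝ)⁻¹ ^ J / 4) P fun p hp => by simpa using (hPR p hp).le
  calc ((nearUnitPairs ((2 : ℝ)⁻¹ ^ J / 4) P).card : ℝ)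
      ≤ ∑ c ∈ N, (((P ×ˢ P.filter fun q => dist q c < 1 / 4).filter fun z =>
        |dist z.1 z.2 - 1| ≤ 2 * ((2 : ℝ)⁻¹ ^ J / 4)).card : ℝ) := mod_cast hsum
    _ ≤ N.card • (2 * 2 ^ α * C ^ 2 * (4 * S) ^ (3 * α / 2) * (J + 1) * 2 ^ (3 * α / 2 * J)) := by
        refine Finset.sum_le_card_nsmul _ _ _ fun c _ => ?_
        refine hP.card_near_le hα hC (le_max_right _ _) hPR (Finset.filter_subset _ _)
          fun q hq q' hq' => ?_
        linarith [dist_triangle_right q q' c, (Finset.mem_filter.1 hq).2,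
          (Finset.mem_filter.1 hq').2]
    _ = _ := by rw [nsmul_eq_mul]; ring

section OscillatoryIntegrals

variable {φ φ' φ'' : ℝ → ℝ} {a b : ℝ}

/- Integration by parts applied to `exp (φ I) * I = (φ')⁻¹ * (exp (φ I))'`. -/
theorem integral_exp_mul_I_mul_I_eq
    (hφ : ∀ x ∈ Set.uIcc a b, HasDerivAt φ (φ' x) x)
    (hφ' : ∀ x ∈ Set.uIcc a b, HasDerivAt φ' (φ'' x) x) (hcont : ContinuousOn φ'' (Set.uIcc a b))
    (hne : ∀ x ∈ Set.uIcc a b, φ' x ≠ 0) :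
    (∫ x in a..b, Complex.exp (φ x * Complex.I)) * Complex.I =
      ((φ' b)⁻¹ : ℝ) * Complex.exp (φ b * Complex.I) -
        ((φ' a)⁻¹ : ℝ) * Complex.exp (φ a * Complex.I) -
        ∫ x in a..b, ((-φ'' x / φ' x ^ 2 : ℝ) : ℂ) * Complex.exp (φ x * Complex.I) := by
  have hφc : ContinuousOn φ (Set.uIcc a b) := fun x hx => (hφ x hx).continuousAt.continuousWithinAt
  have hφ'c : ContinuousOn φ' (Set.uIcc a b) :=
    fun x hx => (hφ' x hx).continuousAt.continuousWithinAt
  have hinvc : ContinuousOn (fun x => -φ'' x / φ' x ^ 2) (Set.uIcc a b) :=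
    hcont.neg.div (hφ'c.pow 2) fun x hx => pow_ne_zero 2 (hne x hx)
  have hexpc : ContinuousOn (fun x => Complex.exp (φ x * Complex.I) * (φ' x * Complex.I))
      (Set.uIcc a b) := by fun_prop
  rw [← intervalIntegral.integral_mul_deriv_eq_deriv_mul
    (fun x hx => ((hφ' x hx).fun_inv (hne x hx)).ofReal_comp)
    (fun x hx => ((hφ x hx).ofReal_comp.mul_const Complex.I).cexp)
    (Complex.continuous_ofReal.comp_continuousOn hinvc).intervalIntegrable
    hexpc.intervalIntegrable, ← intervalIntegral.integral_mul_const]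
  refine intervalIntegral.integral_congr fun x hx => ?_
  have hne' : (φ' x : ℂ) ≠ 0 := Complex.ofReal_ne_zero.2 (hne x hx)
  push_cast
  field_simp

/-- Van der Corput's first derivative test. -/
theorem norm_integral_exp_mul_I_le_two_div (hab : a ≤ b)
    (hφ : ∀ x ∈ Set.Icc a b, HasDerivAt φ (φ' x) x)
    (hφ' : ∀ x ∈ Set.Icc a b, HasDerivAt φ' (φ'' x) x) (hcont : ContinuousOn φ'' (Set.Icc a b))
    (hpos : ∀ x ∈ Set.Icc a b, 0 < φ' x) (hconv : ∀ x ∈ Set.Icc a b, 0 ≤ φ'' x) :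
    ‖∫ x in a..b, Complex.exp (φ x * Complex.I)‖ ≤ 2 / φ' a := by
  have hinvc : ContinuousOn (fun x => -φ'' x / φ' x ^ 2) (Set.Icc a b) :=
    hcont.neg.div (ContinuousOn.pow (fun x hx => (hφ' x hx).continuousAt.continuousWithinAt) 2)
      fun x hx => (pow_pos (hpos x hx) 2).ne'
  have hinterior : ‖∫ x in a..b, ((-φ'' x / φ' x ^ 2 : ℝ) : ℂ) * Complex.exp (φ x * Complex.I)‖ ≤
      (φ' a)⁻¹ - (φ' b)⁻¹ := by
    rw [← Set.uIcc_of_le hab] at hφ' hpos hinvc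
    rw [← neg_sub, ← intervalIntegral.integral_eq_sub_of_hasDerivAt
      (fun x hx => (hφ' x hx).fun_inv (hpos x hx).ne') hinvc.intervalIntegrable,
      ← intervalIntegral.integral_neg]
    refine intervalIntegral.norm_integral_le_of_norm_le hab (Eventually.of_forall fun x hx => ?_)
      hinvc.intervalIntegrable.neg
    rw [norm_mul, Complex.norm_exp_ofReal_mul_I, mul_one, Complex.norm_real, Real.norm_eq_abs,
      neg_div, abs_neg, neg_neg,
      abs_of_nonneg (div_nonneg (hconv x (Set.Ioc_subset_Icc_self hx)) (sq_nonneg _))]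
  have hboundary : ∀ x ∈ Set.Icc a b,
      ‖((φ' x)⁻¹ : ℝ) * Complex.exp (φ x * Complex.I)‖ = (φ' x)⁻¹ := fun x hx => by
    rw [norm_mul, Complex.norm_exp_ofReal_mul_I, mul_one, Complex.norm_real,
      Real.norm_of_nonneg (inv_pos.2 (hpos x hx)).le]
  have ha := hboundary a (Set.left_mem_Icc.2 hab)
  have hb := hboundary b (Set.right_mem_Icc.2 hab)
  rw [← Set.uIcc_of_le hab] at hφ hφ' hpos hcont
  calc ‖∫ x in a..b, Complex.exp (φ x * Complex.I)‖
      = ‖(∫ x in a..b, Complex.exp (φ x * Complex.I)) * Complex.I‖ := by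
        rw [norm_mul, Complex.norm_I, mul_one]
    _ ≤ (φ' b)⁻¹ + (φ' a)⁻¹ + ((φ' a)⁻¹ - (φ' b)⁻¹) := by
        rw [integral_exp_mul_I_mul_I_eq hφ hφ' hcont fun x hx => (hpos x hx).ne']
        exact (norm_sub_le _ _).trans
          (add_le_add ((norm_sub_le _ _).trans_eq (by rw [ha, hb])) hinterior)
    _ = 2 / φ' a := by ring

theorem norm_integral_exp_mul_I_le_abs_sub :
    ‖∫ x in a..b, Complex.exp (φ x * Complex.I)‖ ≤ |b - a| := by
  rw [← one_mul |b - a|]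
  exact intervalIntegral.norm_integral_le_of_norm_le_const fun x _ =>
    (Complex.norm_exp_ofReal_mul_I (φ x)).le

theorem norm_integral_exp_neg_mul_I :
    ‖∫ x in a..b, Complex.exp ((-φ x : ℝ) * Complex.I)‖ =
      ‖∫ x in a..b, Complex.exp (φ x * Complex.I)‖ := by
  rw [← RCLike.norm_conj, ← intervalIntegral.intervalIntegral_conj]
  simp [← Complex.exp_conj]

end OscillatoryIntegrals

section CircleIntegral

variable {r : ℝ}

/- The phase is stationary only at `0`, so the interval is split at distance `1 / √r` from it. -/
theorem norm_integral_exp_neg_mul_cos_mul_I_quarter_le (hr : 1 ≤ r) :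
    ‖∫ θ in (0 : ℝ)..(Real.pi / 2), Complex.exp ((-(r * Real.cos θ) : ℝ) * Complex.I)‖ ≤
      5 / √r := by
  have hr0 : 0 < r := by linarith
  have hs : 1 ≤ √r := Real.one_le_sqrt.2 hr
  have hcont : Continuous fun θ : ℝ => Complex.exp ((-(r * Real.cos θ) : ℝ) * Complex.I) := by
    fun_prop
  set ε : ℝ := 1 / √r
  have hε0 : 0 < ε := by positivity
  have hε2 : ε ≤ Real.pi / 2 := by
    linarith [(div_le_one (by positivity)).2 hs, Real.pi_gt_three]
  have hsin : √r / 2 ≤ r * Real.sin ε := by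
    calc √r / 2 = r / √r / 2 := by rw [Real.div_sqrt]
      _ = r * (1 / 2 * ε) := by ring
      _ ≤ r * (2 / Real.pi * ε) := by
          gcongr r * (?_ * ε)
          rw [div_le_div_iff₀ two_pos Real.pi_pos]
          linarith [Real.pi_lt_four]
      _ ≤ r * Real.sin ε := by
          gcongr
          exact Real.mul_le_sin hε0.le hε2
  have hnear := norm_integral_exp_mul_I_le_abs_sub (φ := fun θ => -(r * Real.cos θ))
    (a := 0) (b := ε)
  have hfar := norm_integral_exp_mul_I_le_two_div (φ := fun θ => -(r * Real.cos θ)) hε2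
    (φ' := fun θ => r * Real.sin θ) (φ'' := fun θ => r * Real.cos θ)
    (fun θ _ => by
      simpa using ((Real.hasDerivAt_cos θ).const_mul r).fun_neg)
    (fun θ _ => (Real.hasDerivAt_sin θ).const_mul r) (by fun_prop)
    (fun θ hθ => mul_pos hr0 (Real.sin_pos_of_pos_of_lt_pi (hε0.trans_le hθ.1)
      (by linarith [hθ.2, Real.pi_pos])))
    (fun θ hθ => mul_nonneg hr0.le (Real.cos_nonneg_of_neg_pi_div_two_le_of_le
      (by linarith [hθ.1, Real.pi_pos]) hθ.2))
  rw [sub_zero, abs_of_pos hε0] at hnear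
  rw [← intervalIntegral.integral_add_adjacent_intervals (hcont.intervalIntegrable 0 ε)
    (hcont.intervalIntegrable ε _)]
  calc _ ≤ ε + 2 / (r * Real.sin ε) := (norm_add_le _ _).trans (add_le_add hnear hfar)
    _ ≤ 1 / √r + 2 / (√r / 2) := by gcongr
    _ = 5 / √r := by
        field_simp
        norm_num

theorem integral_exp_mul_cos_mul_I_eq (r : ℝ) :
    ∫ θ in (0 : ℝ)..(2 * Real.pi), Complex.exp ((r * Real.cos θ : ℝ) * Complex.I) =
      2 * ((∫ θ in (0 : ℝ)..(Real.pi / 2), Complex.exp ((r * Real.cos θ : ℝ) * Complex.I)) +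
        ∫ θ in (0 : ℝ)..(Real.pi / 2), Complex.exp ((-(r * Real.cos θ) : ℝ) * Complex.I)) := by
  have hcont : Continuous fun θ : ℝ => Complex.exp ((r * Real.cos θ : ℝ) * Complex.I) := by
    fun_prop
  have hlower : ∫ θ in Real.pi..(2 * Real.pi), Complex.exp ((r * Real.cos θ : ℝ) * Complex.I) =
      ∫ θ in (0 : ℝ)..Real.pi, Complex.exp ((r * Real.cos θ : ℝ) * Complex.I) := by
    have := intervalIntegral.integral_comp_sub_left (a := 0) (b := Real.pi)
      (fun θ : ℝ => Complex.exp ((r * Real.cos θ : ℝ) * Complex.I)) (2 * Real.pi)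
    rw [sub_zero, show 2 * Real.pi - Real.pi = Real.pi by ring] at this
    simp only [← this, Real.cos_two_pi_sub]
  have hleft : ∫ θ in (Real.pi / 2)..Real.pi, Complex.exp ((r * Real.cos θ : ℝ) * Complex.I) =
      ∫ θ in (0 : ℝ)..(Real.pi / 2), Complex.exp ((-(r * Real.cos θ) : ℝ) * Complex.I) := by
    have := intervalIntegral.integral_comp_sub_left (a := 0) (b := Real.pi / 2)
      (fun θ : ℝ => Complex.exp ((r * Real.cos θ : ℝ) * Complex.I)) Real.pi
    rw [sub_zero, show Real.pi - Real.pi / 2 = Real.pi / 2 by ring] at this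
    simp only [← this, Real.cos_pi_sub, mul_neg]
  rw [← intervalIntegral.integral_add_adjacent_intervals (hcont.intervalIntegrable 0 Real.pi)
    (hcont.intervalIntegrable _ _), hlower, ← intervalIntegral.integral_add_adjacent_intervals
    (hcont.intervalIntegrable 0 (Real.pi / 2)) (hcont.intervalIntegrable _ _), hleft]
  ring

theorem norm_integral_exp_mul_cos_mul_I_le (hr : 0 < r) :
    ‖∫ θ in (0 : ℝ)..(2 * Real.pi), Complex.exp ((r * Real.cos θ : ℝ) * Complex.I)‖ ≤
      20 / √r := by
  have hs : 0 < √r := Real.sqrt_pos.2 hr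
  rcases le_or_gt 1 r with h1 | h1
  · have hneg := norm_integral_exp_neg_mul_cos_mul_I_quarter_le h1
    have hpos := hneg
    rw [norm_integral_exp_neg_mul_I] at hpos
    rw [integral_exp_mul_cos_mul_I_eq, norm_mul, Complex.norm_ofNat]
    calc _ ≤ 2 * (5 / √r + 5 / √r) := by
          gcongr
          exact (norm_add_le _ _).trans (add_le_add hpos hneg)
      _ = 20 / √r := by ring
  · refine norm_integral_exp_mul_I_le_abs_sub.trans ?_
    rw [sub_zero, abs_of_pos Real.two_pi_pos, le_div_iff₀ hs]
    nlinarith [Real.sqrt_le_one.2 h1.le, Real.pi_lt_four]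

end CircleIntegral

section GaussianEnergy

variable {V : Type*} [NormedAddCommGroup V]

/-- The Gaussian `exp (-‖x‖² / 2)`, which is its own Fourier transform up to a constant. It serves
both as a smooth cutoff in frequency and as a smoothed indicator of the unit ball in space. -/
noncomputable def gaussian (x : V) : ℝ := Real.exp (-‖x‖ ^ 2 / 2)

theorem gaussian_nonneg (x : V) : 0 ≤ gaussian x := (Real.exp_pos _).le

theorem gaussian_le_one (x : V) : gaussian x ≤ 1 :=
  Real.exp_le_one_iff.2 (by linarith [sq_nonneg ‖x‖])

theorem continuous_gaussian : Continuous (gaussian : V → ℝ) := by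
  unfold gaussian
  fun_prop

theorem one_le_two_mul_gaussian {x : V} (hx : ‖x‖ ≤ 1) : 1 ≤ 2 * gaussian x := by
  have := Real.add_one_le_exp (-‖x‖ ^ 2 / 2)
  rw [gaussian]
  nlinarith [norm_nonneg x]

variable [InnerProductSpace ℝ V]

/-- The exponential sum `∑ exp (⟨p, ξ⟩ I)` with frequencies in `P`, the Fourier transform of the
counting measure on `P`. -/
noncomputable def expSum (P : Finset V) (ξ : V) : ℂ :=
  ∑ p ∈ P, Complex.exp (inner ℝ p ξ * Complex.I)

theorem sq_norm_expSum (P : Finset V) (ξ : V) :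
    ((‖expSum P ξ‖ ^ 2 : ℝ) : ℂ) =
      ∑ p ∈ P, ∑ q ∈ P, Complex.exp (inner ℝ (q - p) ξ * Complex.I) := by
  rw [Complex.ofReal_pow, ← Complex.conj_mul', expSum, map_sum, Finset.sum_mul_sum]
  refine Finset.sum_congr rfl fun p _ => Finset.sum_congr rfl fun q _ => ?_
  rw [← Complex.exp_conj, ← Complex.exp_add, inner_sub_left]
  congr 1
  simp only [map_mul, Complex.conj_I, Complex.conj_ofReal]
  push_cast
  ring

variable [FiniteDimensional ℝ V] [MeasurableSpace V] [BorelSpace V]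

theorem integrable_gaussian_smul {δ : ℝ} (hδ : 0 < δ) :
    Integrable fun ξ : V => gaussian (δ • ξ) := by
  have h := (GaussianFourier.integrable_cexp_neg_mul_sq_norm_add (V := V)
    (b := ((δ ^ 2 / 2 : ℝ) : ℂ)) (by rw [Complex.ofReal_re]; positivity) 0 0).norm
  refine h.congr (Eventually.of_forall fun ξ => ?_)
  simp only [gaussian, Complex.norm_exp, norm_smul, Real.norm_of_nonneg hδ.le]
  congr 1
  norm_cast
  simp only [inner_zero_left, mul_zero, add_zero]
  ring

theorem integral_gaussian_mul_exp_inner {δ : ℝ} (hδ : 0 < δ) (x : V) :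
    ∫ ξ : V, (gaussian (δ • ξ) : ℂ) * Complex.exp (inner ℝ x ξ * Complex.I) =
      ((√(2 * Real.pi) / δ) ^ Module.finrank ℝ V * gaussian (δ⁻¹ • x) : ℝ) := by
  have hb : (0 : ℝ) < δ ^ 2 / 2 := by positivity
  have h := GaussianFourier.integral_cexp_neg_mul_sq_norm_add (V := V)
    (b := ((δ ^ 2 / 2 : ℝ) : ℂ)) (by rwa [Complex.ofReal_re]) Complex.I x
  convert! h using 1
  · refine congrArg _ (funext fun ξ => ?_)
    rw [gaussian, Complex.ofReal_exp, ← Complex.exp_add, norm_smul, Real.norm_of_nonneg hδ.le]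
    congr 1
    push_cast
    ring
  · have hconst : (√(2 * Real.pi) / δ) ^ Module.finrank ℝ V =
        (Real.pi / (δ ^ 2 / 2)) ^ (Module.finrank ℝ V / 2 : ℝ) := by
      rw [Real.rpow_div_two_eq_sqrt _ (by positivity), Real.rpow_natCast]
      congr 1
      rw [← Real.sqrt_sq hδ.le, ← Real.sqrt_div (by positivity), Real.sqrt_sq hδ.le]
      congr 1
      field_simp
    rw [hconst, Complex.ofReal_mul, Complex.ofReal_cpow (by positivity), gaussian,
      Complex.ofReal_exp, norm_smul, Real.norm_of_nonneg (by positivity)]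
    push_cast
    congr 2
    field_simp
    rw [Complex.I_sq]
    ring

variable {σ : Measure V} [IsFiniteMeasure σ] {δ : ℝ}

theorem integrable_charFun_mul_gaussian (hδ : 0 < δ) :
    Integrable fun ξ : V => charFun σ ξ * (gaussian (δ • ξ) : ℂ) :=
  (integrable_gaussian_smul hδ).ofReal.bdd_mul
    stronglyMeasurable_charFun.aestronglyMeasurable (Eventually.of_forall norm_charFun_le)

theorem integral_charFun_mul_gaussian (hδ : 0 < δ) :
    ∫ ξ : V, charFun σ ξ * (gaussian (δ • ξ) : ℂ) =
      ((√(2 * Real.pi) / δ) ^ Module.finrank ℝ V * ∫ x, gaussian (δ⁻¹ • x) ∂σ : ℝ) := by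
  have hint : Integrable (Function.uncurry fun (ξ x : V) =>
      (gaussian (δ • ξ) : ℂ) * Complex.exp (inner ℝ x ξ * Complex.I)) (volume.prod σ) := by
    have hg : Continuous (gaussian : V → ℝ) := continuous_gaussian
    refine ((integrable_gaussian_smul (V := V) hδ).comp_fst σ).mono'
      (Continuous.aestronglyMeasurable ?_) (Eventually.of_forall fun z => ?_)
    · simp only [Function.uncurry_def]
      fun_prop
    · simp only [Function.uncurry_def]
      rw [norm_mul, Complex.norm_exp_ofReal_mul_I, mul_one, Complex.norm_real,
        Real.norm_of_nonneg (gaussian_nonneg _)]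
  calc ∫ ξ : V, charFun σ ξ * (gaussian (δ • ξ) : ℂ)
      = ∫ ξ : V, ∫ x, (gaussian (δ • ξ) : ℂ) * Complex.exp (inner ℝ x ξ * Complex.I) ∂σ := by
        simp_rw [integral_const_mul, charFun_apply, mul_comm]
    _ = ∫ x, (∫ ξ : V, (gaussian (δ • ξ) : ℂ) * Complex.exp (inner ℝ x ξ * Complex.I)) ∂σ :=
        integral_integral_swap hint
    _ = _ := by
        simp_rw [integral_gaussian_mul_exp_inner hδ, integral_complex_ofReal, integral_const_mul]

theorem integrable_gaussian_mul_sq_norm_expSum (hδ : 0 < δ) (P : Finset V) :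
    Integrable fun ξ : V => gaussian (δ • ξ) * ‖expSum P ξ‖ ^ 2 := by
  refine (integrable_gaussian_smul hδ).mul_bdd (c := (P.card : ℝ) ^ 2)
    (Continuous.aestronglyMeasurable ?_) (Eventually.of_forall fun ξ => ?_)
  · unfold expSum
    fun_prop
  · rw [norm_pow, norm_norm]
    gcongr
    refine (norm_sum_le _ _).trans_eq ?_
    simp only [Complex.norm_exp_ofReal_mul_I, Finset.sum_const, nsmul_eq_mul, mul_one]

theorem integral_charFun_mul_gaussian_mul_sq_norm_expSum (hδ : 0 < δ) (P : Finset V) :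
    ∫ ξ : V, charFun σ ξ * ((gaussian (δ • ξ) * ‖expSum P ξ‖ ^ 2 : ℝ) : ℂ) =
      ((√(2 * Real.pi) / δ) ^ Module.finrank ℝ V *
        ∑ p ∈ P, ∑ q ∈ P, ∫ x, gaussian (δ⁻¹ • (x + (q - p))) ∂σ : ℝ) := by
  have hg : Continuous (gaussian : V → ℝ) := continuous_gaussian
  have htranslate : ∀ x : V, ∫ ξ : V, charFun σ ξ * (gaussian (δ • ξ) : ℂ) *
      Complex.exp (inner ℝ x ξ * Complex.I) =
      ((√(2 * Real.pi) / δ) ^ Module.finrank ℝ V * ∫ y, gaussian (δ⁻¹ • (y + x)) ∂σ : ℝ) := by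
    intro x
    have hmap : ∫ y, gaussian (δ⁻¹ • y) ∂(σ.map (· + x)) = ∫ y, gaussian (δ⁻¹ • (y + x)) ∂σ :=
      integral_map (by fun_prop) (by fun_prop)
    rw [← hmap, ← integral_charFun_mul_gaussian hδ]
    simp_rw [charFun_map_add_const, mul_right_comm]
  have hint : ∀ x : V, Integrable fun ξ : V => charFun σ ξ * (gaussian (δ • ξ) : ℂ) *
      Complex.exp (inner ℝ x ξ * Complex.I) := fun x =>
    (integrable_charFun_mul_gaussian hδ).mul_bdd (c := 1)
      (Continuous.aestronglyMeasurable (by fun_prop))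
      (Eventually.of_forall fun ξ => (Complex.norm_exp_ofReal_mul_I _).le)
  simp_rw [Finset.mul_sum, Complex.ofReal_sum, ← htranslate, ← integral_finsetSum _ fun _ _ =>
    hint _]
  rw [← integral_finsetSum _ fun p _ => integrable_finsetSum _ fun q _ => hint _]
  simp_rw [← Finset.mul_sum, ← sq_norm_expSum, Complex.ofReal_mul, mul_assoc]

theorem integral_gaussian_mul_sq_norm_expSum (hδ : 0 < δ) (P : Finset V) :
    ∫ ξ : V, gaussian (δ • ξ) * ‖expSum P ξ‖ ^ 2 = (√(2 * Real.pi) / δ) ^ Module.finrank ℝ V *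
      ∑ p ∈ P, ∑ q ∈ P, gaussian (δ⁻¹ • (q - p)) := by
  have h := integral_charFun_mul_gaussian_mul_sq_norm_expSum (σ := Measure.dirac (0 : V)) hδ P
  simp only [charFun_dirac, inner_zero_left, Complex.ofReal_zero, zero_mul, Complex.exp_zero,
    one_mul, integral_dirac, zero_add, integral_complex_ofReal] at h
  exact_mod_cast h

/- All the energies are integrals of `‖expSum P‖²` against a weight on the frequency side, so that
an inequality between the weights gives one between the energies. -/
theorem sum_sum_integral_gaussian_le_of_charFun_le {ι : Type*} {s : Finset ι} {c ε : ι → ℝ}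
    (hδ : 0 < δ) (hε : ∀ j ∈ s, 0 < ε j)
    (h : ∀ ξ, gaussian (δ • ξ) * ‖charFun σ ξ‖ ≤ ∑ j ∈ s, c j * gaussian (ε j • ξ))
    (P : Finset V) :
    δ⁻¹ ^ Module.finrank ℝ V * ∑ p ∈ P, ∑ q ∈ P, ∫ x, gaussian (δ⁻¹ • (x + (q - p))) ∂σ ≤
      ∑ j ∈ s, c j * ((ε j)⁻¹ ^ Module.finrank ℝ V *
        ∑ p ∈ P, ∑ q ∈ P, gaussian ((ε j)⁻¹ • (q - p))) := by
  have hint : ∀ j ∈ s, Integrable fun ξ : V =>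
      c j * (gaussian (ε j • ξ) * ‖expSum P ξ‖ ^ 2) := fun j hj =>
    (integrable_gaussian_mul_sq_norm_expSum (hε j hj) P).const_mul _
  have hweights : ‖∫ ξ : V, charFun σ ξ * ((gaussian (δ • ξ) * ‖expSum P ξ‖ ^ 2 : ℝ) : ℂ)‖ ≤
      ∑ j ∈ s, c j * ∫ ξ : V, gaussian (ε j • ξ) * ‖expSum P ξ‖ ^ 2 := by
    simp_rw [← integral_const_mul]
    rw [← integral_finsetSum _ hint]
    refine norm_integral_le_of_norm_le (integrable_finsetSum _ hint)
      (Eventually.of_forall fun ξ => ?_)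
    rw [norm_mul, Complex.norm_real,
      Real.norm_of_nonneg (mul_nonneg (gaussian_nonneg _) (sq_nonneg _)), ← mul_assoc,
      mul_comm ‖charFun σ ξ‖]
    simp_rw [← mul_assoc, ← Finset.sum_mul]
    exact mul_le_mul_of_nonneg_right (h ξ) (sq_nonneg _)
  rw [integral_charFun_mul_gaussian_mul_sq_norm_expSum hδ, Complex.norm_real] at hweights
  refine le_of_mul_le_mul_left ?_ (by positivity : 0 < √(2 * Real.pi) ^ Module.finrank ℝ V)
  calc _ = (√(2 * Real.pi) / δ) ^ Module.finrank ℝ V *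
        ∑ p ∈ P, ∑ q ∈ P, ∫ x, gaussian (δ⁻¹ • (x + (q - p))) ∂σ := by
        rw [div_eq_mul_inv, mul_pow, mul_assoc]
    _ ≤ ∑ j ∈ s, c j * ∫ ξ : V, gaussian (ε j • ξ) * ‖expSum P ξ‖ ^ 2 :=
        (le_abs_self _).trans hweights
    _ = _ := by
        rw [Finset.mul_sum]
        refine Finset.sum_congr rfl fun j hj => ?_
        rw [integral_gaussian_mul_sq_norm_expSum (hε j hj), div_eq_mul_inv, mul_pow]
        ring

end GaussianEnergy

section Circle

/-- The point of the unit circle with argument `θ`. -/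
noncomputable def circlePoint (θ : ℝ) : Plane := !₂[Real.cos θ, Real.sin θ]

theorem continuous_circlePoint : Continuous circlePoint := by
  unfold circlePoint
  fun_prop

theorem periodic_circlePoint : Function.Periodic circlePoint (2 * Real.pi) := fun θ => by
  rw [circlePoint, Real.cos_add_two_pi, Real.sin_add_two_pi, circlePoint]

theorem inner_circlePoint (θ φ : ℝ) :
    inner ℝ (circlePoint θ) (circlePoint φ) = Real.cos (θ - φ) := by
  simp only [circlePoint, PiLp.inner_apply, Fin.sum_univ_two, Real.cos_sub]
  simp [mul_comm]

theorem norm_circlePoint (θ : ℝ) : ‖circlePoint θ‖ = 1 := by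
  rw [norm_eq_sqrt_real_inner, inner_circlePoint, sub_self, Real.cos_zero, Real.sqrt_one]

theorem dist_circlePoint_le (θ φ : ℝ) : dist (circlePoint θ) (circlePoint φ) ≤ 2 * |θ - φ| := by
  refine (Plane.dist_le _ _).trans ?_
  rw [two_mul]
  exact add_le_add (Real.abs_cos_sub_cos_le θ φ) (Real.abs_sin_sub_sin_le θ φ)

theorem Plane.exists_eq_norm_smul_circlePoint (x : Plane) : ∃ φ, x = ‖x‖ • circlePoint φ := by
  have hnorm : ‖(⟨x 0, x 1⟩ : ℂ)‖ = ‖x‖ := by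
    rw [Complex.norm_eq_sqrt_sq_add_sq, EuclideanSpace.norm_eq, Fin.sum_univ_two, Real.norm_eq_abs,
      Real.norm_eq_abs, sq_abs, sq_abs]
  refine ⟨Complex.arg ⟨x 0, x 1⟩, ?_⟩
  ext i
  fin_cases i
  · simpa [circlePoint, hnorm] using (Complex.norm_mul_cos_arg ⟨x 0, x 1⟩).symm
  · simpa [circlePoint, hnorm] using (Complex.norm_mul_sin_arg ⟨x 0, x 1⟩).symm

/-- Arc length on the unit circle, as a measure on the plane. -/
noncomputable def circleMeasure : Measure Plane :=
  (volume.restrict (Set.Ioc 0 (2 * Real.pi))).map circlePoint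

instance : IsFiniteMeasure circleMeasure := by
  unfold circleMeasure
  infer_instance

theorem integral_circleMeasure {E : Type*} [NormedAddCommGroup E] [NormedSpace ℝ E] {f : Plane → E}
    (hf : Continuous f) (a : ℝ) :
    ∫ x, f x ∂circleMeasure = ∫ θ in a..a + 2 * Real.pi, f (circlePoint θ) := by
  rw [circleMeasure, integral_map continuous_circlePoint.aemeasurable hf.aestronglyMeasurable,
    ← intervalIntegral.integral_of_le Real.two_pi_pos.le]
  simpa only [zero_add, Function.comp_apply] using
    (periodic_circlePoint.comp f).intervalIntegral_add_eq 0 a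

theorem charFun_circleMeasure (ξ : Plane) : charFun circleMeasure ξ =
    ∫ θ in (0 : ℝ)..(2 * Real.pi), Complex.exp ((‖ξ‖ * Real.cos θ : ℝ) * Complex.I) := by
  obtain ⟨φ, hφ⟩ := ξ.exists_eq_norm_smul_circlePoint
  have hinner : ∀ θ, inner ℝ (circlePoint θ) ξ = ‖ξ‖ * Real.cos (θ - φ) := fun θ => by
    conv_lhs => rw [hφ]
    rw [inner_smul_right, inner_circlePoint]
  rw [charFun_apply, integral_circleMeasure (by fun_prop) φ]
  simp_rw [hinner]
  rw [intervalIntegral.integral_comp_sub_right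
    (fun θ => Complex.exp ((‖ξ‖ * Real.cos θ : ℝ) * Complex.I)), sub_self, add_sub_cancel_left]

theorem norm_charFun_circleMeasure_le (ξ : Plane) : ‖charFun circleMeasure ξ‖ ≤ 2 * Real.pi := by
  rw [charFun_circleMeasure]
  refine norm_integral_exp_mul_I_le_abs_sub.trans_eq ?_
  rw [sub_zero, abs_of_pos Real.two_pi_pos]

theorem norm_charFun_circleMeasure_le_div_sqrt {ξ : Plane} (hξ : ξ ≠ 0) :
    ‖charFun circleMeasure ξ‖ ≤ 20 / √‖ξ‖ := by
  rw [charFun_circleMeasure]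
  exact norm_integral_exp_mul_cos_mul_I_le (norm_pos_iff.2 hξ)

theorem norm_charFun_circleMeasure_le_of_two_pow_le {n : ℕ} {ξ : Plane} (hn : 2 ^ n ≤ ‖ξ‖) :
    ‖charFun circleMeasure ξ‖ ≤ 20 * (√2)⁻¹ ^ n := by
  have hξ : ξ ≠ 0 := norm_pos_iff.1 (lt_of_lt_of_le (by positivity) hn)
  refine (norm_charFun_circleMeasure_le_div_sqrt hξ).trans ?_
  rw [inv_pow, ← div_eq_mul_inv]
  gcongr
  apply Real.le_sqrt_of_sq_le
  rwa [pow_right_comm, Real.sq_sqrt zero_le_two]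

theorem norm_charFun_circleMeasure_le_size (ξ : Plane) :
    ‖charFun circleMeasure ξ‖ ≤ 30 * (√2)⁻¹ ^ Nat.size ⌊‖ξ‖⌋₊ := by
  rcases hn : Nat.size ⌊‖ξ‖⌋₊ with _ | n
  · linarith [norm_charFun_circleMeasure_le ξ, Real.pi_lt_four]
  · calc _ ≤ 20 * (√2)⁻¹ ^ n :=
          norm_charFun_circleMeasure_le_of_two_pow_le (two_pow_le_of_lt_size_floor (by omega))
      _ = 20 * √2 * (√2)⁻¹ ^ (n + 1) := by
          rw [pow_succ]
          field_simp
      _ ≤ _ := by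
          gcongr
          nlinarith [Real.sqrt_two_lt_three_halves]

/- Frequencies of size about `2 ^ j` are detected by the Gaussian at scale `2⁻¹ ^ j`; those beyond
`2 ^ J` by the cutoff on the left itself. -/
theorem gaussian_mul_norm_charFun_circleMeasure_le (J : ℕ) (ξ : Plane) :
    gaussian ((2 : ℝ)⁻¹ ^ J • ξ) * ‖charFun circleMeasure ξ‖ ≤
      ∑ j ∈ Finset.range (J + 1), 60 * (√2)⁻¹ ^ j * gaussian ((2 : ℝ)⁻¹ ^ j • ξ) := by
  suffices ∃ j ∈ Finset.range (J + 1), gaussian ((2 : ℝ)⁻¹ ^ J • ξ) * ‖charFun circleMeasure ξ‖ ≤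
      60 * (√2)⁻¹ ^ j * gaussian ((2 : ℝ)⁻¹ ^ j • ξ) by
    obtain ⟨j, hj, h⟩ := this
    exact h.trans (Finset.single_le_sum
      (f := fun j => 60 * (√2)⁻¹ ^ j * gaussian ((2 : ℝ)⁻¹ ^ j • ξ))
      (fun j _ => mul_nonneg (by positivity) (gaussian_nonneg _)) hj)
  rcases le_or_gt (Nat.size ⌊‖ξ‖⌋₊) J with hJ | hJ
  · set j := Nat.size ⌊‖ξ‖⌋₊
    have hj : ‖(2 : ℝ)⁻¹ ^ j • ξ‖ ≤ 1 := by
      rw [norm_smul, Real.norm_of_nonneg (by positivity), inv_pow, inv_mul_le_one₀ (by positivity)]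
      exact (lt_two_pow_size_floor (norm_nonneg ξ)).le
    refine ⟨j, Finset.mem_range.2 (by omega), ?_⟩
    calc _ ≤ 1 * (30 * (√2)⁻¹ ^ j) :=
          mul_le_mul (gaussian_le_one _) (norm_charFun_circleMeasure_le_size ξ) (norm_nonneg _)
            zero_le_one
      _ ≤ 2 * gaussian ((2 : ℝ)⁻¹ ^ j • ξ) * (30 * (√2)⁻¹ ^ j) := by
          gcongr
          exact one_le_two_mul_gaussian hj
      _ = _ := by ring
  · refine ⟨J, Finset.self_mem_range_succ J, ?_⟩
    have hdecay := norm_charFun_circleMeasure_le_of_two_pow_le (two_pow_le_of_lt_size_floor hJ)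
    rw [mul_comm]
    refine mul_le_mul_of_nonneg_right (hdecay.trans ?_) (gaussian_nonneg _)
    gcongr
    norm_num

theorem le_integral_gaussian_circleMeasure {δ : ℝ} (hδ : 0 < δ) (hδ1 : δ ≤ 1) {v : Plane}
    (hv : |‖v‖ - 1| ≤ δ / 2) :
    δ / 8 ≤ ∫ x, gaussian (δ⁻¹ • (x - v)) ∂circleMeasure := by
  obtain ⟨φ, hφ⟩ := v.exists_eq_norm_smul_circlePoint
  have hv' : dist (circlePoint φ) v ≤ δ / 2 := by
    have : v - circlePoint φ = (‖v‖ - 1) • circlePoint φ := by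
      rw [sub_smul, one_smul, ← hφ]
    rwa [dist_comm, dist_eq_norm, this, norm_smul, norm_circlePoint, mul_one, Real.norm_eq_abs]
  have hnear : ∀ θ ∈ Set.Icc φ (φ + δ / 4), 1 ≤ 2 * gaussian (δ⁻¹ • (circlePoint θ - v)) := by
    intro θ hθ
    refine one_le_two_mul_gaussian ?_
    rw [norm_smul, Real.norm_of_nonneg (by positivity), inv_mul_le_one₀ hδ, ← dist_eq_norm]
    have harc : |θ - φ| ≤ δ / 4 := by
      rw [abs_of_nonneg (by linarith [hθ.1])]
      linarith [hθ.2]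
    linarith [dist_triangle (circlePoint θ) (circlePoint φ) v, dist_circlePoint_le θ φ]
  have hcont : Continuous fun x : Plane => gaussian (δ⁻¹ • (x - v)) :=
    continuous_gaussian.comp (by fun_prop)
  rw [integral_circleMeasure hcont φ]
  calc δ / 8 = ∫ _ in φ..φ + δ / 4, (1 / 2 : ℝ) := by
        rw [intervalIntegral.integral_const, smul_eq_mul]
        ring
    _ ≤ ∫ θ in φ..φ + δ / 4, gaussian (δ⁻¹ • (circlePoint θ - v)) :=
        intervalIntegral.integral_mono_on (by linarith) intervalIntegrable_const
          ((hcont.comp continuous_circlePoint).intervalIntegrable _ _)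
          fun θ hθ => by linarith [hnear θ hθ]
    _ ≤ _ := intervalIntegral.integral_mono_interval le_rfl (by linarith)
          (by linarith [Real.pi_gt_three]) (Eventually.of_forall fun θ => gaussian_nonneg _)
          ((hcont.comp continuous_circlePoint).intervalIntegrable _ _)

theorem card_nearUnitPairs_mul_le {δ : ℝ} (hδ : 0 < δ) (hδ1 : δ ≤ 1) (P : Finset Plane) :
    ((nearUnitPairs (δ / 4) P).card : ℝ) * (δ / 8) ≤
      ∑ p ∈ P, ∑ q ∈ P, ∫ x, gaussian (δ⁻¹ • (x + (q - p))) ∂circleMeasure := by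
  rw [← Finset.sum_product' P P
    fun p q => ∫ x, gaussian (δ⁻¹ • (x + (q - p))) ∂circleMeasure, ← nsmul_eq_mul,
    ← Finset.sum_const]
  calc _ ≤ ∑ z ∈ nearUnitPairs (δ / 4) P,
        ∫ x, gaussian (δ⁻¹ • (x + (z.2 - z.1))) ∂circleMeasure := by
        refine Finset.sum_le_sum fun z hz => ?_
        have hz' := (Finset.mem_filter.1 hz).2
        rw [dist_eq_norm] at hz'
        simp_rw [← neg_sub z.1 z.2, ← sub_eq_add_neg]
        exact le_integral_gaussian_circleMeasure hδ hδ1 (by linarith)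
    _ ≤ _ := Finset.sum_le_sum_of_subset_of_nonneg (Finset.filter_subset _ _)
        fun z _ _ => integral_nonneg fun x => gaussian_nonneg _

theorem card_nearUnitPairs_le_sum_energy (J : ℕ) (P : Finset Plane) :
    ((nearUnitPairs ((2 : ℝ)⁻¹ ^ J / 4) P).card : ℝ) * 2 ^ J ≤
      480 * ∑ j ∈ Finset.range (J + 1), (√2)⁻¹ ^ j *
        (4 ^ j * ∑ p ∈ P, ∑ q ∈ P, gaussian ((2 : ℝ) ^ j • (q - p))) := by
  have hδ : (0 : ℝ) < 2⁻¹ ^ J := by positivity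
  have henergy := sum_sum_integral_gaussian_le_of_charFun_le hδ (fun j _ => by positivity)
    (gaussian_mul_norm_charFun_circleMeasure_le J) P
  have hcount := card_nearUnitPairs_mul_le hδ (pow_le_one₀ (by norm_num) (by norm_num)) P
  have hfour : ∀ j : ℕ, ((2 : ℝ) ^ j) ^ 2 = 4 ^ j := fun j => by
    rw [pow_right_comm]
    norm_num
  simp only [finrank_euclideanSpace_fin, inv_pow, inv_inv, hfour, mul_assoc (60 : ℝ),
    ← Finset.mul_sum] at henergy hcount ⊢
  calc ((nearUnitPairs (((2 : ℝ) ^ J)⁻¹ / 4) P).card : ℝ) * 2 ^ J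
      = 8 * (4 ^ J * ((nearUnitPairs (((2 : ℝ) ^ J)⁻¹ / 4) P).card * (((2 : ℝ) ^ J)⁻¹ / 8))) := by
        rw [← hfour]
        field_simp
    _ ≤ 8 * (4 ^ J * ∑ p ∈ P, ∑ q ∈ P,
        ∫ x, gaussian ((2 : ℝ) ^ J • (x + (q - p))) ∂circleMeasure) := by gcongr
    _ ≤ _ := by linarith

end Circle

section FourierBound

theorem exp_neg_sq_div_two_le (t : ℝ) :
    Real.exp (-t ^ 2 / 2) ≤ 128 * (1 / 16) ^ Nat.size ⌊t⌋₊ := by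
  have hexp := Real.quadratic_le_exp_of_nonneg (by positivity : 0 ≤ t ^ 2 / 2)
  rw [neg_div, Real.exp_neg, inv_le_comm₀ (Real.exp_pos _) (by positivity), mul_inv, ← inv_pow,
    one_div, inv_inv]
  rcases hi : Nat.size ⌊t⌋₊ with _ | i
  · nlinarith [sq_nonneg t]
  · have hti : (16 : ℝ) ^ i ≤ t ^ 4 := by
      calc (16 : ℝ) ^ i = (2 ^ i) ^ 4 := by rw [pow_right_comm]; norm_num
        _ ≤ t ^ 4 := by
          gcongr
          exact two_pow_le_of_lt_size_floor (by omega)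
    rw [pow_succ]
    nlinarith [sq_nonneg t]

theorem HasGrowth.sum_exp_neg_sq_dist_le {X : Type*} [PseudoMetricSpace X] {α C η ρ : ℝ}
    {P : Finset X} (hP : HasGrowth α C η P) (hα2 : α ≤ 2) (hη : 0 < η) (hC : 0 ≤ C) (hρ : η ≤ ρ)
    (p : X) :
    ∑ q ∈ P, Real.exp (-(dist q p / ρ) ^ 2 / 2) ≤ 256 * (C * (ρ / η) ^ α) := by
  have hρ0 : 0 < ρ := hη.trans_le hρ
  have hshell : ∀ i, ∑ q ∈ P with Nat.size ⌊dist q p / ρ⌋₊ = i,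
      Real.exp (-(dist q p / ρ) ^ 2 / 2) ≤ 128 * (C * (ρ / η) ^ α) * (1 / 4) ^ i := by
    intro i
    have hcard : ((P.filter fun q => Nat.size ⌊dist q p / ρ⌋₊ = i).card : ℝ) ≤
        C * (4 ^ i * (ρ / η) ^ α) := by
      refine (hP.card_shell_le hη hρ p i).trans ?_
      rw [Real.mul_rpow (by positivity) (by positivity)]
      gcongr
      calc ((2 : ℝ) ^ i) ^ α ≤ (2 ^ i) ^ (2 : ℝ) :=
            Real.rpow_le_rpow_of_exponent_le (one_le_pow₀ one_le_two) hα2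
        _ = 4 ^ i := by
            rw [Real.rpow_two, pow_right_comm]
            norm_num
    calc _ ≤ ((P.filter fun q => Nat.size ⌊dist q p / ρ⌋₊ = i).card : ℝ) *
          (128 * (1 / 16) ^ i) := by
          rw [← nsmul_eq_mul]
          refine Finset.sum_le_card_nsmul _ _ _ fun q hq => ?_
          rw [← (Finset.mem_filter.1 hq).2]
          exact exp_neg_sq_div_two_le _
      _ ≤ C * (4 ^ i * (ρ / η) ^ α) * (128 * (1 / 16) ^ i) := by gcongr
      _ = 128 * (C * (ρ / η) ^ α) * (4 ^ i * (1 / 16) ^ i) := by ring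
      _ = _ := by
          rw [← mul_pow]
          norm_num
  have hgeom : ∀ s : Finset ℕ, ∑ i ∈ s, (1 / 4 : ℝ) ^ i ≤ 2 := fun s =>
    ((summable_geometric_of_lt_one (by norm_num) (by norm_num)).sum_le_tsum s
      fun _ _ => by positivity).trans <| by
        rw [tsum_geometric_of_lt_one (by norm_num) (by norm_num)]
        norm_num
  rw [← Finset.sum_fiberwise_of_maps_to fun q hq =>
    Finset.mem_image_of_mem (fun q => Nat.size ⌊dist q p / ρ⌋₊) hq]
  refine (Finset.sum_le_sum fun i _ => hshell i).trans ?_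
  rw [← Finset.mul_sum]
  nlinarith [hgeom (P.image fun q => Nat.size ⌊dist q p / ρ⌋₊),
    (by positivity : 0 ≤ C * (ρ / η) ^ α)]

theorem HasGrowth.sum_sum_gaussian_le {α C η ρ R : ℝ} {P : Finset Plane}
    (hP : HasGrowth α C η P) (hα2 : α ≤ 2) (hη : 0 < η) (hC : 0 ≤ C) (hρ : η ≤ ρ) (hR : η ≤ R)
    (hPR : ∀ p ∈ P, ‖p‖ < R) :
    ∑ p ∈ P, ∑ q ∈ P, gaussian (ρ⁻¹ • (q - p)) ≤ 256 * C ^ 2 * (R / η * (ρ / η)) ^ α := by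
  have hρ0 : 0 < ρ := hη.trans_le hρ
  have hR0 : 0 < R := hη.trans_le hR
  have hrow : ∀ p, ∑ q ∈ P, gaussian (ρ⁻¹ • (q - p)) ≤ 256 * (C * (ρ / η) ^ α) := fun p => by
    refine (Finset.sum_congr rfl fun q _ => ?_).trans_le
      (hP.sum_exp_neg_sq_dist_le hα2 hη hC hρ p)
    rw [gaussian, norm_smul, Real.norm_of_nonneg (by positivity), ← dist_eq_norm,
      inv_mul_eq_div]
  calc _ ≤ P.card * (256 * (C * (ρ / η) ^ α)) := by
        rw [← nsmul_eq_mul]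
        exact Finset.sum_le_card_nsmul _ _ _ fun p _ => hrow p
    _ ≤ C * (R / η) ^ α * (256 * (C * (ρ / η) ^ α)) := by
        gcongr
        exact hP.card_le_of_norm_lt hR hPR
    _ = _ := by
        rw [Real.mul_rpow (by positivity) (by positivity)]
        ring

theorem HasGrowth.sum_sum_gaussian_two_pow_le {α C R : ℝ} {J j : ℕ} {P : Finset Plane}
    (hP : HasGrowth α C ((2 : ℝ)⁻¹ ^ J / 4) P) (hα2 : α ≤ 2) (hC : 0 ≤ C) (hR : 1 ≤ R)
    (hPR : ∀ p ∈ P, ‖p‖ < R) (hj : j ≤ J) :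
    ∑ p ∈ P, ∑ q ∈ P, gaussian ((2 : ℝ) ^ j • (q - p)) ≤
      256 * C ^ 2 * (16 * R) ^ α * 2 ^ (2 * α * J - α * j) := by
  have hJ1 : (2 : ℝ)⁻¹ ^ J ≤ 1 := pow_le_one₀ (by norm_num) (by norm_num)
  have hJj : (2 : ℝ)⁻¹ ^ J ≤ 2⁻¹ ^ j := pow_le_pow_of_le_one (by norm_num) (by norm_num) hj
  have henergy := hP.sum_sum_gaussian_le (ρ := (2 : ℝ)⁻¹ ^ j) hα2 (by positivity) hC
    (by linarith [(by positivity : (0 : ℝ) ≤ 2⁻¹ ^ j)]) (by linarith) hPR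
  rw [inv_pow, inv_inv] at henergy
  have hscale : R / ((2 : ℝ)⁻¹ ^ J / 4) * (((2 : ℝ) ^ j)⁻¹ / ((2 : ℝ)⁻¹ ^ J / 4)) =
      16 * R * (2 : ℝ) ^ (2 * J - j : ℝ) := by
    rw [Real.rpow_sub two_pos, Real.rpow_natCast, mul_comm 2 (J : ℝ), Real.rpow_mul zero_le_two,
      Real.rpow_natCast, Real.rpow_two, inv_pow]
    field_simp
    norm_num
  refine henergy.trans_eq ?_
  rw [hscale, Real.mul_rpow (by positivity) (by positivity), ← Real.rpow_mul zero_le_two,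
    ← mul_assoc]
  congr 2
  ring

theorem HasGrowth.weighted_energy_le {α τ C R : ℝ} {J j : ℕ} {P : Finset Plane}
    (hP : HasGrowth α C ((2 : ℝ)⁻¹ ^ J / 4) P) (hα2 : α ≤ 2) (hτ : 0 ≤ τ) (hτα : 3 / 2 - α ≤ τ)
    (hC : 0 ≤ C) (hR : 1 ≤ R) (hPR : ∀ p ∈ P, ‖p‖ < R) (hj : j ≤ J) :
    (√2)⁻¹ ^ j * (4 ^ j * ∑ p ∈ P, ∑ q ∈ P, gaussian ((2 : ℝ) ^ j • (q - p))) ≤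
      256 * C ^ 2 * (16 * R) ^ α * 2 ^ ((2 * α + τ) * J) := by
  have hweight : (√2)⁻¹ ^ j * (4 : ℝ) ^ j = 2 ^ (3 / 2 * j : ℝ) := by
    rw [Real.rpow_mul zero_le_two, Real.rpow_natCast, ← mul_pow]
    congr 1
    rw [show (3 / 2 : ℝ) = 2 - 1 / 2 by norm_num, Real.rpow_sub two_pos, ← Real.sqrt_eq_rpow,
      Real.rpow_two]
    ring
  have hexponent : (3 / 2 - α) * j ≤ τ * J := by gcongr
  rw [← mul_assoc, hweight]
  calc _ ≤ 2 ^ (3 / 2 * j : ℝ) * (256 * C ^ 2 * (16 * R) ^ α * 2 ^ (2 * α * J - α * j)) := by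
        gcongr
        exact hP.sum_sum_gaussian_two_pow_le hα2 hC hR hPR hj
    _ = 256 * C ^ 2 * (16 * R) ^ α * 2 ^ (3 / 2 * j + (2 * α * J - α * j)) := by
        rw [Real.rpow_add two_pos]
        ring
    _ ≤ _ := by
        gcongr
        · exact one_le_two
        · linarith

theorem exists_card_nearUnitPairs_le_of_three_halves_sub_le {α τ C R : ℝ} (hα2 : α ≤ 2)
    (hτ : 0 ≤ τ) (hτα : 3 / 2 - α ≤ τ) (hC : 0 ≤ C) (hR : 1 ≤ R) :
    ∃ C' : ℝ, ∀ (J : ℕ) (P : Finset Plane),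
      HasGrowth α C ((2 : ℝ)⁻¹ ^ J / 4) P → (∀ p ∈ P, ‖p‖ < R) →
      ((nearUnitPairs ((2 : ℝ)⁻¹ ^ J / 4) P).card : ℝ) ≤
        C' * (J + 1) * 2 ^ ((2 * α - 1 + τ) * J) := by
  refine ⟨480 * (256 * C ^ 2 * (16 * R) ^ α), fun J P hP hPR => ?_⟩
  have hsum : ∑ j ∈ Finset.range (J + 1), (√2)⁻¹ ^ j *
      (4 ^ j * ∑ p ∈ P, ∑ q ∈ P, gaussian ((2 : ℝ) ^ j • (q - p))) ≤
      (J + 1) * (256 * C ^ 2 * (16 * R) ^ α * 2 ^ ((2 * α + τ) * J)) := by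
    refine (Finset.sum_le_card_nsmul _ _ _ fun j hj => hP.weighted_energy_le hα2 hτ hτα hC hR hPR
      (Finset.mem_range_succ_iff.1 hj)).trans_eq ?_
    rw [Finset.card_range, nsmul_eq_mul, Nat.cast_succ]
  refine le_of_mul_le_mul_right ?_ (by positivity : (0 : ℝ) < 2 ^ J)
  calc _ ≤ 480 * ((J + 1) * (256 * C ^ 2 * (16 * R) ^ α * 2 ^ ((2 * α + τ) * J))) := by
        linarith [card_nearUnitPairs_le_sum_energy J P]
    _ = 480 * (256 * C ^ 2 * (16 * R) ^ α) * (J + 1) * 2 ^ ((2 * α - 1 + τ) * J + J) := by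
        ring_nf
    _ = _ := by
        rw [Real.rpow_add two_pos, Real.rpow_natCast]
        ring

end FourierBound

theorem unitDistanceDim_le {d : ℕ} [NeZero d] {α t : ℝ} (ht : 0 ≤ t)
    (h : ∀ C R : ℝ, 0 ≤ C → 1 ≤ R → ∃ C' : ℝ, ∀ (J : ℕ) (P : Finset (EuclideanSpace ℝ (Fin d))),
      HasGrowth α C ((2 : ℝ)⁻¹ ^ J / 4) P → (∀ p ∈ P, ‖p‖ < R) →
      ((nearUnitPairs ((2 : ℝ)⁻¹ ^ J / 4) P).card : ℝ) ≤ C' * (J + 1) * 2 ^ (t * J)) :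
    unitDistanceDim d α ≤ (t : EReal) := by
  refine sSup_le ?_
  rintro _ ⟨K, hK, -, hd, rfl⟩
  exact upperMinkowskiDim_unitDistancePairs_le ht hK hd h

theorem unitDistanceDim_le_three_mul_div_two {α : ℝ} (hα : 0 ≤ α) :
    unitDistanceDim 2 α ≤ ((3 * α / 2 : ℝ) : EReal) :=
  unitDistanceDim_le (by positivity) fun _ R hC _ =>
    exists_card_nearUnitPairs_le_three_halves R hα hC

theorem unitDistanceDim_le_of_three_halves_sub_le {α τ : ℝ} (hα : 0 ≤ 2 * α - 1 + τ) (hα2 : α ≤ 2)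
    (hτ : 0 ≤ τ) (hτα : 3 / 2 - α ≤ τ) :
    unitDistanceDim 2 α ≤ ((2 * α - 1 + τ : ℝ) : EReal) :=
  unitDistanceDim_le hα fun _ _ hC hR =>
    exists_card_nearUnitPairs_le_of_three_halves_sub_le hα2 hτ hτα hC hR

theorem theorem3_general :
    (∀ α : ℝ, 0 < α → α ≤ 1 → unitDistanceDim 2 α = ((3 * α / 2 : ℝ) : EReal)) ∧
    (∀ α : ℝ, 1 ≤ α → α ≤ 3 / 2 → unitDistanceDim 2 α = ((α + 1 / 2 : ℝ) : EReal)) ∧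
    (∀ α : ℝ, 3 / 2 ≤ α → α ≤ 2 → unitDistanceDim 2 α = ((2 * α - 1 : ℝ) : EReal)) := by
  refine ⟨fun α h0 h1 => le_antisymm (unitDistanceDim_le_three_mul_div_two h0.le)
      (three_mul_div_two_le_unitDistanceDim h0 h1),
    fun α h1 h2 => le_antisymm ?_ (add_half_le_unitDistanceDim h1 (by linarith)),
    fun α h1 h2 => le_antisymm ?_ (two_mul_sub_one_le_unitDistanceDim (by linarith) h2)⟩
  · have := unitDistanceDim_le_of_three_halves_sub_le (α := α) (τ := 3 / 2 - α) (by linarith)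
      (by linarith) (by linarith) le_rfl
    rwa [show 2 * α - 1 + (3 / 2 - α) = α + 1 / 2 by ring] at this
  · simpa only [add_zero] using unitDistanceDim_le_of_three_halves_sub_le (α := α) (τ := 0)
      (by linarith) h2 le_rfl (by linarith)

theorem three_mul_div_two_le_min {α : ℝ} (hα : 0 ≤ α) (hα1 : α ≤ 1) :
    3 * α / 2 ≤ min (5 * α / 3) (α * (2 + α) / (1 + α)) := by
  refine le_min (by linarith) ?_
  rw [div_le_div_iff₀ two_pos (by linarith)]
  nlinarith

theorem theorem3 :
    (∀ α : ℝ, 0 < α → α ≤ 1 →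
      ((3 * α / 2 : ℝ) : EReal) ≤ unitDistanceDim 2 α ∧
      unitDistanceDim 2 α ≤ ((min (5 * α / 3) (α * (2 + α) / (1 + α)) : ℝ) : EReal)) ∧
    (∀ α : ℝ, 1 ≤ α → α ≤ 3 / 2 →
      unitDistanceDim 2 α = ((α + 1 / 2 : ℝ) : EReal)) ∧
    (∀ α : ℝ, 3 / 2 ≤ α → α ≤ 2 →
      unitDistanceDim 2 α = ((2 * α - 1 : ℝ) : EReal)) :=
  theorem3_general.imp_left fun h α h0 h1 => ⟨(h α h0 h1).ge, (h α h0 h1).le.trans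
    (EReal.coe_le_coe_iff.2 (three_mul_div_two_le_min h0.le h1))⟩
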